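/- Let $G$ be a real Lie group whose Lie algebra $\mathfrak g$ is semisimple (i.e. has nondegenerate Killing form), let $\sigma$ be a smooth involutive automorphism of $G$, and let $K$ be a closed subgroup of $G$ with $(G^\sigma)_0\subseteq K\subseteq G^\sigma$ such that $\mathrm{Ad}(K)$ is compact. Let $\mathfrak p$ be the $(-1)$-eigenspace of $d\sigma$ in $\mathfrak g$, and assume that the symmetric space $G/K$ has rank greater than one, i.e. that $\mathfrak p$ contains an abelian subspace of dimension at least two. Let $\rho:K\to O(V)$ be the isotropy representation of $G/K$, that is, $V=\mathfrak p\cong T_o(G/K)$ with the action of $\mathrm{Ad}(K)$, equipped with an arbitrary $K$-invariant inner product. For a unit vector $p\in V$ let $\mathrm{II}_p:T_p(Kp)\times T_p(Kp)\to\nu_p(Kp)$ be the second fundamental form at $p$ of the orbit $Kp$ in the unit sphere of $V$, and let $\|\mathrm{II}_p\|=\sup\{\|\mathrm{II}_p(u,v)\| : \|u\|=\|v\|=1\}$. Then there is a unit vector $p\in V$ with $\|\mathrm{II}_p\|\le 2$. More precisely, let $\Sigma\subset V$ be a maximal abelian subspace and let $\Delta\subset\Sigma^*$ be the set of restricted roots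 with respect to $\Sigma$: the nonzero $\alpha\in\Sigma^*$ for which there are a sign $\varepsilon\in\{1,-1\}$ and a nonzero $x\in\mathfrak p$ with $\mathrm{ad}(h)^2x=\varepsilon\,\alpha(h)^2x$ for all $h\in\Sigma$. For $\alpha\in\Delta$ let $h_\alpha\in\Sigma$ be the vector with $\langle h_\alpha,h\rangle=2\alpha(h)/\|\alpha\|^2$ for all $h\in\Sigma$. Then for every total vector space ordering of $\Sigma^*$ the set $\Delta$ has a highest element $\tilde\alpha$, and the point $p=\frac{\|\tilde\alpha\|}{2}h_{\tilde\alpha}$ satisfies $\|p\|=1$ and $\|\mathrm{II}_p\|\le 2$; in fact the same holds for $p=\frac{\|\alpha\|}{2}h_\alpha$ with any $\alpha\in\Delta$. -/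

import Mathlib

open scoped Manifold ContDiff InnerProductSpace ENNReal

noncomputable section

namespace SymmetricSpaceOrbit

/-! ### Riemannian symmetric pairs -/

section Pair

variable {E : Type*} [NormedAddCommGroup E] [NormedSpace ℝ E] [FiniteDimensional ℝ E]
  {G : Type*} [TopologicalSpace G] [ChartedSpace E G] [Group G]

/-- A smooth Lie group has the finite smoothness used by Mathlib to define its Lie algebra. -/
instance lieGroupMinSmoothness [LieGroup 𝓘(ℝ, E) ∞ G] :
    LieGroup 𝓘(ℝ, E) (minSmoothness ℝ 3) G :=
  LieGroup.of_le (n := ∞) (by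
    rw [minSmoothness_of_isRCLikeNormedField]
    exact ENat.LEInfty.out)

/-- The adjoint action `Ad g` of `g ∈ G` on the Lie algebra `𝔤 = T₁G`: the differential at the
identity of the conjugation `x ↦ g x g⁻¹`. -/
def Ad (g : G) : GroupLieAlgebra 𝓘(ℝ, E) G →L[ℝ] GroupLieAlgebra 𝓘(ℝ, E) G :=
  mfderiv 𝓘(ℝ, E) 𝓘(ℝ, E) (fun x : G => g * x * g⁻¹) 1

variable (E G) in
/-- A Riemannian symmetric pair `(G, K)`: a Lie group `G` with a smooth involutive automorphism
`σ`, and a closed subgroup `K` lying between the fixed point group `G^σ` and its identity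
component, such that `Ad(K)` is compact. The symmetric space is `G / K`. -/
structure RiemannianSymmetricPair [LieGroup 𝓘(ℝ, E) ∞ G] where
  /-- the involution -/
  σ : G →* G
  /-- the isotropy group -/
  K : Subgroup G
  smooth_σ : ContMDiff 𝓘(ℝ, E) 𝓘(ℝ, E) ∞ σ
  involutive_σ : ∀ g, σ (σ g) = g
  isClosed_K : IsClosed (K : Set G)
  K_le_fixed : ∀ k ∈ K, σ k = k
  identityComponent_subset_K : connectedComponentIn {g : G | σ g = g} 1 ⊆ (K : Set G)
  isCompact_Ad_K : IsCompact (Ad (E := E) '' (K : Set G))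

namespace RiemannianSymmetricPair

variable [LieGroup 𝓘(ℝ, E) ∞ G] (S : RiemannianSymmetricPair E G)

/-- The involution `dσ` of the Lie algebra `𝔤`. -/
def dσ : GroupLieAlgebra 𝓘(ℝ, E) G →L[ℝ] GroupLieAlgebra 𝓘(ℝ, E) G :=
  mfderiv 𝓘(ℝ, E) 𝓘(ℝ, E) S.σ 1

/-- The `(-1)`-eigenspace `𝔭` of `dσ`, which is the tangent space of `G / K` at the base point. -/
def 𝔭 : Submodule ℝ (GroupLieAlgebra 𝓘(ℝ, E) G) where
  carrier := {X | S.dσ X = -X}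
  add_mem' := fun {X Y} hX hY => by
    simp only [Set.mem_ofPred_eq] at hX hY ⊢
    rw [map_add, hX, hY]; abel
  zero_mem' := by simp
  smul_mem' := fun c X hX => by
    simp only [Set.mem_ofPred_eq] at hX ⊢
    rw [map_smul, hX, smul_neg]

/-- The rank of `G / K`: the maximal dimension of an abelian subspace of `𝔭`. -/
def rank : ℕ :=
  sSup {n : ℕ | ∃ 𝔞 : Submodule ℝ (GroupLieAlgebra 𝓘(ℝ, E) G),
    𝔞 ≤ S.𝔭 ∧ (∀ X ∈ 𝔞, ∀ Y ∈ 𝔞, ⁅X, Y⁆ = 0) ∧ Module.finrank ℝ 𝔞 = n}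

variable {V : Type*} [NormedAddCommGroup V] [InnerProductSpace ℝ V]

/-- The orthogonal representation `ρ` of `K` on the Euclidean space `V` is the isotropy
representation of `G / K`: the linear isomorphism `e : V ≃ 𝔭 = T_o(G / K)` intertwines `ρ` with
the restriction of `Ad(K)` to `𝔭`. The inner product of `V`, transported by `e`, is the inner
product of `T_o(G / K)` given by the `G`-invariant Riemannian metric. -/
def IsIsotropyRepresentation (ρ : S.K →* (V ≃ₗᵢ[ℝ] V)) (e : V ≃ₗ[ℝ] S.𝔭) : Prop :=
  ∀ (k : S.K) (v : V),
    (e (ρ k v) : GroupLieAlgebra 𝓘(ℝ, E) G) = Ad (k : G) (e v : GroupLieAlgebra 𝓘(ℝ, E) G)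

/-- The Lie bracket `[v, w] ∈ 𝔤` of two elements `v, w ∈ V ≃ 𝔭`. -/
def bracket (e : V ≃ₗ[ℝ] S.𝔭) (v w : V) : GroupLieAlgebra 𝓘(ℝ, E) G :=
  ⁅(e v : GroupLieAlgebra 𝓘(ℝ, E) G), (e w : GroupLieAlgebra 𝓘(ℝ, E) G)⁆

/-- `Sec` is a maximal abelian subspace of `V ≃ 𝔭` (a section of the isotropy representation). -/
def IsMaximalAbelian (e : V ≃ₗ[ℝ] S.𝔭) (Sec : Submodule ℝ V) : Prop :=
  Maximal (fun A : Submodule ℝ V => ∀ v ∈ A, ∀ w ∈ A, S.bracket e v w = 0) Sec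

/-- The restricted roots with respect to `Sec`: the nonzero linear functionals `α` on `Sec` for
which some nonzero `x ∈ 𝔭` satisfies `ad(h)² x = α(h)² x` for all `h ∈ Sec` (roots coming from
noncompact factors), or `ad(h)² x = -α(h)² x` for all `h ∈ Sec` (roots coming from compact
factors, where the eigenvalues of `ad(h)` are `± i α(h)`). -/
def restrictedRoots (e : V ≃ₗ[ℝ] S.𝔭) (Sec : Submodule ℝ V) : Set (StrongDual ℝ Sec) :=
  {α | α ≠ 0 ∧ ∃ ε : ℝ, (ε = 1 ∨ ε = -1) ∧ ∃ x : V, x ≠ 0 ∧ ∀ h : Sec,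
    ⁅(e (h : V) : GroupLieAlgebra 𝓘(ℝ, E) G), S.bracket e h x⁆ =
      (ε * α h ^ 2) • (e x : GroupLieAlgebra 𝓘(ℝ, E) G)}

end RiemannianSymmetricPair

end Pair

/-! ### Orderings and highest roots -/

/-- A total ordering of a real vector space compatible with the vector space operations, given by
its set of positive vectors; `a < b` means that `b - a` is positive. -/
structure VectorOrdering (W : Type*) [AddCommGroup W] [Module ℝ W] where
  /-- positivity of a vector -/
  Pos : W → Prop
  add_pos : ∀ a b, Pos a → Pos b → Pos (a + b)
  smul_pos : ∀ (c : ℝ) (a : W), 0 < c → Pos a → Pos (c • a)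
  not_pos_zero : ¬ Pos 0
  total : ∀ a, a ≠ 0 → Pos a ∨ Pos (-a)

/-- `a` is the highest element of `Δ` with respect to the ordering `O`. -/
def VectorOrdering.IsHighest {W : Type*} [AddCommGroup W] [Module ℝ W] (O : VectorOrdering W)
    (Δ : Set W) (a : W) : Prop :=
  a ∈ Δ ∧ ∀ b ∈ Δ, b ≠ a → O.Pos (a - b)

section Euclidean

variable {V : Type*} [NormedAddCommGroup V] [InnerProductSpace ℝ V] [FiniteDimensional ℝ V]

/-- The vector `h_α ∈ Sec` with `⟪h_α, h⟫ = α^∨(h) = 2 α(h) / ‖α‖²` for all `h ∈ Sec`. -/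
def corootVector (Sec : Submodule ℝ V) (α : StrongDual ℝ Sec) : Sec :=
  (2 / ‖α‖ ^ 2) • (InnerProductSpace.toDual ℝ Sec).symm α

/-! ### The second fundamental form of an orbit in the unit sphere

For an orthogonal representation `ρ : K → O(V)` the orbit `K p` is the image of an immersion of a
homogeneous space of the group `ρ(K) ⊆ O(V)`. Smooth curves and surfaces in it are written as
`x ↦ ρ (k x) p` with `x ↦ ρ (k x)` smooth. -/

variable {K : Type*} [Group K]

/-- The map `k`, defined on a normed space, is a smooth family of elements of `ρ(K)`. -/
def IsSmoothFamily (ρ : K →* (V ≃ₗᵢ[ℝ] V)) {P : Type*} [NormedAddCommGroup P] [NormedSpace ℝ P]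
    (k : P → K) : Prop :=
  ContDiff ℝ ∞ (fun x : P => ((ρ (k x)).toContinuousLinearEquiv : V →L[ℝ] V))

/-- The tangent space `T_p(K p)` of the orbit at `p`, spanned by the velocities at `p` of smooth
curves in the orbit. -/
def orbitTangentSpace (ρ : K →* (V ≃ₗᵢ[ℝ] V)) (p : V) : Submodule ℝ V :=
  Submodule.span ℝ {u : V | ∃ k : ℝ → K, IsSmoothFamily ρ k ∧ ρ (k 0) p = p ∧
    u = deriv (fun t : ℝ => ρ (k t) p) 0}

/-- The normal space `ν_p(K p)` at a unit vector `p` of the orbit in the unit sphere: the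
orthogonal complement in `V` of `ℝ p + T_p(K p)`. -/
def orbitNormalSpace (ρ : K →* (V ≃ₗᵢ[ℝ] V)) (p : V) : Submodule ℝ V :=
  (Submodule.span ℝ {p} ⊔ orbitTangentSpace ρ p)ᗮ

/-- `w = II_p(u, v)`, where `II` is the second fundamental form of the orbit `K p` in the unit
sphere: for a smooth surface `f(s, t) = ρ(k(s, t)) p` in the orbit with `f(0, 0) = p`,
`∂f/∂s(0, 0) = u` and `∂f/∂t(0, 0) = v`, the vector `w` is the component of `∂²f/∂s∂t(0, 0)` in
the normal space `ν_p(K p)`. -/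
def IsSecondFundamentalForm (ρ : K →* (V ≃ₗᵢ[ℝ] V)) (p u v w : V) : Prop :=
  ∃ k : ℝ × ℝ → K, IsSmoothFamily ρ k ∧ ρ (k (0, 0)) p = p ∧
    u = deriv (fun s : ℝ => ρ (k (s, 0)) p) 0 ∧
    v = deriv (fun t : ℝ => ρ (k (0, t)) p) 0 ∧
    w = (orbitNormalSpace ρ p).starProjection
      (deriv (fun s : ℝ => deriv (fun t : ℝ => ρ (k (s, t)) p) 0) 0)

/-- The supremum norm `‖II_p‖ = sup {‖II_p(u, v)‖ : ‖u‖ = ‖v‖ = 1}`. -/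
def secondFundamentalFormNorm (ρ : K →* (V ≃ₗᵢ[ℝ] V)) (p : V) : ℝ≥0∞ :=
  ⨆ (u : V) (v : V) (w : V) (_ : ‖u‖ = 1) (_ : ‖v‖ = 1)
    (_ : IsSecondFundamentalForm ρ p u v w), ENNReal.ofReal ‖w‖

end Euclidean

end SymmetricSpaceOrbit

end

/-! Write 𝔤 = 𝔨 + 𝔭 for the eigenspaces of dσ. Velocities of the orbit at p are the vectors Xp with
X ∈ 𝔨, and for a normal vector ξ one has ⟨II(Xp, Yp), ξ⟩ = ⟨YXp, ξ⟩ = -⟨Xp, Yξ⟩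
(`exists_act_of_surface`). A normal ξ commutes with p, and some element of the stabilizer of p
carries it into the maximal abelian subspace Σ: maximize ⟨kξ, h⟩ over the stabilizer for a regular h
∈ Σ (`exists_ρ_mem_section`). By equivariance only ξ ∈ Σ matters.

For ξ ∈ Σ, differentiating [p, ξ] = 0 along Y gives β(p)⟨Yξ, b⟩ = β(ξ)⟨Yp, b⟩ on a weight vector b
with root β. The shape operator is therefore diagonal with entries -β(ξ)/β(p), over the roots with
β(p) ≠ 0. If p is the unit vector in the direction dual to a root α, then |β(ξ)| ≤ ‖β‖‖ξ‖ and |β(p)|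
= |⟨α, β⟩|/‖α‖. Integrality of both Cartan numbers gives ‖α‖‖β‖ ≤ 2|⟨α, β⟩| as soon as ⟨α, β⟩ ≠ 0
(`cartan_bound`), so every entry is at most 2‖ξ‖ in absolute value. Integrality comes from a
complexified sl₂ spanned by the dual vector t of α, a root vector x, and [t, x].

The inner product is an arbitrary invariant one and compact and noncompact factors may be mixed, so
no Cartan involution is used. The operator `A` of V representing the Killing form commutes with 𝔨
and with the triple product `T`; this makes ad(h)² self-adjoint for the given inner product
(`inner_T`). The required positivity is that the Killing form is negative definite on brackets of
elements of 𝔭 (`killingForm_bracket_self`); the sign ε records the type of a root.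

The passage from groups to algebras rests on d Ad = ad, computed from the second derivative of the
multiplication in a chart, and on two facts. Each X ∈ 𝔨 generates a one-parameter group in Ad(K)
(`exists_Ad_eq_exp`). Conversely, the velocity of a curve k for which only ρ(k) is smooth is the
action of an element of 𝔨, because it extends to a derivation of 𝔤, which is inner
(`exists_act_eq_deriv`). -/

namespace SymmetricSpaceOrbit

/-! ### Linear algebra -/

section LinearAlgebra

open Module LinearMap

/-- A map that is skew for a positive semidefinite form, and kills the kernel of the form, has a
square of nonpositive trace. -/
theorem trace_sq_nonpos_of_skew {M : Type*} [AddCommGroup M] [Module ℝ M] [FiniteDimensional ℝ M]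
    (S : LinearMap.BilinForm ℝ M) (hS : S.IsSymm) (hpos : ∀ x, 0 ≤ S x x) (T : M →ₗ[ℝ] M)
    (hskew : ∀ x y, S (T x) y = -S x (T y)) (hker : ∀ x, S x x = 0 → T x = 0) :
    LinearMap.trace ℝ M (T ∘ₗ T) ≤ 0 ∧
      (LinearMap.trace ℝ M (T ∘ₗ T) = 0 → ∀ x, S (T x) (T x) = 0) := by
  obtain ⟨v, hv⟩ := LinearMap.BilinForm.exists_orthogonal_basis (B := S) ⟨hS.eq⟩
  have hexp : ∀ w i, S w (v i) = v.repr w i * S (v i) (v i) := by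
    intro w i
    conv_lhs => rw [← v.sum_repr w]
    rw [map_sum, LinearMap.sum_apply, Finset.sum_eq_single i]
    · simp
    · intro j _ hji
      have : S (v j) (v i) = 0 := hv hji
      simp [this]
    · simp
  have htr : LinearMap.trace ℝ M (T ∘ₗ T) = ∑ i, v.repr (T (T (v i))) i := by
    rw [LinearMap.trace_eq_matrix_trace ℝ v, Matrix.trace]
    simp [LinearMap.toMatrix_apply]
  -- In an orthogonal basis the i-th diagonal entry of T² times S(vᵢ, vᵢ) equals -S(Tvᵢ, Tvᵢ). Null
  -- basis vectors are killed by T, so no division by zero arises.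
  have hterm : ∀ i, v.repr (T (T (v i))) i ≤ 0 ∧
      (v.repr (T (T (v i))) i = 0 → T (T (v i)) = 0) := by
    intro i
    rcases (hpos (v i)).eq_or_lt with h0 | h0
    · have := hker _ h0.symm
      simp [this]
    · have h1 := hexp (T (T (v i))) i
      rw [hskew] at h1
      have h2 := hpos (T (v i))
      constructor
      · by_contra! h3
        nlinarith [mul_pos h3 h0]
      · intro h3
        rw [h3, zero_mul] at h1
        exact hker _ (by linarith)
  rw [htr]
  refine ⟨Finset.sum_nonpos fun i _ => (hterm i).1, fun h x => ?_⟩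
  have h1 := (Finset.sum_eq_zero_iff_of_nonpos fun i _ => (hterm i).1).1 h
  have h2 : T ∘ₗ T = 0 := v.ext fun i => by
    simpa using (hterm i).2 (h1 i (Finset.mem_univ i))
  have h3 : T (T x) = 0 := by simpa using LinearMap.congr_fun h2 x
  rw [hskew, h3]; simp

/-- A commuting family of symmetric operators has a joint orthonormal eigenbasis. -/
theorem exists_joint_eigenbasis {V ι : Type*} [NormedAddCommGroup V] [InnerProductSpace ℝ V]
    [FiniteDimensional ℝ V] (T : ι → V →ₗ[ℝ] V) (hT : ∀ i, (T i).IsSymmetric)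
    (hc : ∀ i j, Commute (T i) (T j)) :
    ∃ (κ : Type) (_ : Fintype κ) (b : OrthonormalBasis κ ℝ V),
      ∀ i j, ∃ c : ℝ, T i (b j) = c • b j := by
  classical
  let F : (ι → ℝ) → Submodule ℝ V := fun χ => ⨅ i, Module.End.eigenspace (T i) (χ i)
  have hint : DirectSum.IsInternal F :=
    LinearMap.IsSymmetric.directSum_isInternal_of_pairwise_commute hT (fun i j _ => hc i j)
  have horth : OrthogonalFamily ℝ (fun χ => F χ) fun χ => (F χ).subtypeₗᵢ :=
    LinearMap.IsSymmetric.orthogonalFamily_iInf_eigenspaces hT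
  have hfin : Finite {χ // F χ ≠ ⊥} :=
    (WellFoundedGT.finite_ne_bot_of_iSupIndep hint.submodule_iSupIndep).to_subtype
  have := Fintype.ofFinite {χ // F χ ≠ ⊥}
  have hint' := (DirectSum.isInternal_ne_bot_iff (A := F)).2 hint
  have horth' : OrthogonalFamily ℝ (fun χ : {χ // F χ ≠ ⊥} => F χ) fun χ => (F χ).subtypeₗᵢ :=
    horth.comp Subtype.val_injective
  let b := hint'.subordinateOrthonormalBasis rfl horth'
  refine ⟨Fin (Module.finrank ℝ V), inferInstance, b, fun i j => ?_⟩
  have hmem := hint'.subordinateOrthonormalBasis_subordinate rfl j horth'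
  have h2 := (Submodule.mem_iInf _).1 hmem i
  exact ⟨_, Module.End.mem_eigenspace_iff.1 h2⟩

end LinearAlgebra

/-! ### Integrality for three-dimensional simple subalgebras -/

section Integrality

open TensorProduct

attribute [local instance] LieRing.ofAssociativeRing LieAlgebra.ofAssociativeAlgebra

/-- Eigenvalues of the neutral element of an `sl₂`-triple are integers. -/
theorem _root_.IsSl2Triple.exists_int_of_eigenvalue {L M : Type*} [LieRing L] [LieAlgebra ℂ L]
    [AddCommGroup M] [Module ℂ M] [LieRingModule L M] [LieModule ℂ L M] [FiniteDimensional ℂ M]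
    {h e f : L} (t : IsSl2Triple h e f) {ν : ℂ} {m : M} (hm : m ≠ 0) (hν : ⁅h, m⁆ = ν • m) :
    ∃ n : ℤ, ν = n := by
  -- Otherwise the vectors eᵏm would be eigenvectors for the distinct values ν + 2k. The last
  -- nonzero one is primitive, so ν + 2k is a natural number.
  have key : ∃ k : ℕ, ((LieModule.toEnd ℂ L M e) ^ k) m = 0 := by
    by_contra! hne
    have hinj : Function.Injective fun n : ℕ => ν + 2 * (n : ℂ) := fun a b hab => by
      simpa using hab
    have aux : ∀ μ : Set.range fun n : ℕ => ν + 2 * (n : ℂ),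
        (LieModule.toEnd ℂ L M h).HasEigenvector μ
          (((LieModule.toEnd ℂ L M e) ^ μ.property.choose) m) := by
      intro μ
      refine ⟨?_, hne _⟩
      rw [Module.End.mem_eigenspace_iff, LieModule.toEnd_apply_apply, t.lie_h_pow_toEnd_e hν]
      exact congrArg (· • _) μ.property.choose_spec
    have := ((LieModule.toEnd ℂ L M h).eigenvectors_linearIndependent _ _ aux).finite
    exact Set.infinite_range_of_injective hinj (Set.toFinite _)
  obtain ⟨k, hk, hk'⟩ := Nat.exists_not_and_succ_of_not_zero_of_exists hm key
  have P : IsSl2Triple.HasPrimitiveVectorWith t (((LieModule.toEnd ℂ L M e) ^ k) m)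
      (ν + 2 * (k : ℂ)) :=
    { ne_zero := hk
      lie_h := t.lie_h_pow_toEnd_e hν k
      lie_e := by rwa [IsSl2Triple.lie_e_pow_toEnd_e k] }
  obtain ⟨n, hn⟩ := P.exists_nat
  exact ⟨(n : ℤ) - 2 * k, by push_cast; linear_combination hn⟩

/-- With s² = ε, so s = ±1 or ±i, the elements sh and x ± sy, the latter suitably scaled, form an
sl₂-triple after complexification. This treats both types of roots at once. Since (sh)² acts on v by
ελ, an eigenvalue of sh is a square root of ελ, and it is an integer. -/
theorem exists_int_sq_of_triple {L : Type*} [LieRing L] [LieAlgebra ℝ L] [FiniteDimensional ℝ L]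
    {h x y v : L} {ε c lam : ℝ} (hε : ε = 1 ∨ ε = -1) (hc : c ≠ 0)
    (hx : ⁅h, x⁆ = (2 : ℝ) • y) (hy : ⁅h, y⁆ = (2 * ε) • x) (hxy : ⁅x, y⁆ = (-(ε * c)) • h)
    (hv : v ≠ 0) (hlam : ⁅h, ⁅h, v⁆⁆ = lam • v) : ∃ n : ℤ, ε * lam = (n : ℝ) ^ 2 := by
  have hεε : ε * ε = 1 := by rcases hε with rfl | rfl <;> norm_num
  have hεε' : (ε : ℂ) * ε = 1 := by exact_mod_cast hεε
  obtain ⟨s, hs⟩ : ∃ s : ℂ, s * s = ε := by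
    obtain ⟨s, hs⟩ := IsAlgClosed.exists_pow_nat_eq (ε : ℂ) (n := 2) (by norm_num)
    exact ⟨s, by rw [← hs, sq]⟩
  let a : L → Module.End ℂ (ℂ ⊗[ℝ] L) := fun z => (LieAlgebra.ad ℝ L z).baseChange ℂ
  have a_lie : ∀ z w, ⁅a z, a w⁆ = a ⁅z, w⁆ := by
    intro z w
    apply TensorProduct.AlgebraTensorModule.ext
    intro z₁ u
    simp [a, Ring.lie_def, Module.End.mul_apply, ← TensorProduct.tmul_sub]
  have a_smul : ∀ (r : ℝ) z, a (r • z) = (r : ℂ) • a z := by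
    intro r z
    apply TensorProduct.AlgebraTensorModule.ext
    intro s u
    simp [a, TensorProduct.smul_tmul']
  let H := s • a h
  let E := a x + s • a y
  let F := ((ε / (2 * c) : ℝ) : ℂ) • (a x - s • a y)
  have hm0 : (1 : ℂ) ⊗ₜ[ℝ] v ≠ 0 := by
    intro h0
    apply hv
    have : Function.Injective (TensorProduct.mk ℝ ℂ L 1) :=
      Module.Flat.tensorProduct_mk_injective (R := ℝ) (S := ℂ) (M := L)
    exact this (by simpa using h0)
  have hHH : H (H (1 ⊗ₜ[ℝ] v)) = ((ε * lam : ℝ) : ℂ) • (1 ⊗ₜ[ℝ] v) := by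
    simp only [H, a, LinearMap.smul_apply, LinearMap.baseChange_tmul, map_smul,
      LieAlgebra.ad_apply, hlam, smul_smul, hs, TensorProduct.tmul_smul]
    push_cast
    rw [mul_smul]
    simp [TensorProduct.smul_tmul']
  -- An `IsSl2Triple` needs a nonzero neutral element; if it acts by zero then λ = 0.
  by_cases hH : H = 0
  · refine ⟨0, ?_⟩
    rw [hH] at hHH
    simp only [LinearMap.zero_apply] at hHH
    have := (smul_eq_zero.1 hHH.symm).resolve_right hm0
    have h2 : ε * lam = 0 := by exact_mod_cast this
    simp [h2]
  have lx : a h * a x - a x * a h = (2 : ℂ) • a y := by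
    rw [← Ring.lie_def, a_lie, hx, a_smul]; norm_num
  have ly : a h * a y - a y * a h = (2 * ε : ℂ) • a x := by
    rw [← Ring.lie_def, a_lie, hy, a_smul]; norm_num
  have lxy : a x * a y - a y * a x = (-(ε * c) : ℂ) • a h := by
    rw [← Ring.lie_def, a_lie, hxy, a_smul]; norm_num
  have hc' : (c : ℂ) ≠ 0 := by exact_mod_cast hc
  have t : IsSl2Triple H E F := by
    refine ⟨hH, ?_, ?_, ?_⟩
    · calc ⁅E, F⁆ = (((ε / (2 * c) : ℝ) : ℂ) * (-2 * s)) • (a x * a y - a y * a x) := by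
            simp only [E, F, Ring.lie_def, mul_add, add_mul, mul_sub, sub_mul, smul_mul_assoc,
              mul_smul_comm]
            module
        _ = H := by
            rw [lxy, smul_smul]
            congr 1
            push_cast
            field_simp
            linear_combination s * hεε'
    · calc ⁅H, E⁆ = s • (a h * a x - a x * a h) + (s * s) • (a h * a y - a y * a h) := by
            simp only [H, E, Ring.lie_def, mul_add, add_mul, smul_mul_assoc, mul_smul_comm]
            module
        _ = (2 * (ε * ε) : ℂ) • a x + (2 * s) • a y := by
            rw [lx, ly, hs]
            module
        _ = 2 • E := by
            rw [hεε', ← Nat.cast_smul_eq_nsmul ℂ]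
            simp only [E]
            push_cast
            module
    · calc ⁅H, F⁆ = ((ε / (2 * c) : ℝ) : ℂ) • (s • (a h * a x - a x * a h)
              - (s * s) • (a h * a y - a y * a h)) := by
            simp only [H, F, Ring.lie_def, mul_sub, sub_mul, smul_mul_assoc, mul_smul_comm]
            module
        _ = ((ε / (2 * c) : ℝ) : ℂ) • ((2 * s) • a y - (2 * (ε * ε) : ℂ) • a x) := by
            rw [lx, ly, hs]
            module
        _ = -(2 • F) := by
            rw [hεε', ← Nat.cast_smul_eq_nsmul ℂ]
            simp only [F]
            push_cast
            module
  obtain ⟨ν, hν⟩ := IsAlgClosed.exists_pow_nat_eq ((ε * lam : ℝ) : ℂ) (n := 2) (by norm_num)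
  -- From (H - ν)(H + ν)v = 0, either v has eigenvalue ν or (H - ν)v has eigenvalue -ν.
  have heig : ∃ (μ : ℂ) (m : ℂ ⊗[ℝ] L), μ ^ 2 = ((ε * lam : ℝ) : ℂ) ∧ m ≠ 0 ∧ H m = μ • m := by
    by_cases h1 : H (1 ⊗ₜ[ℝ] v) - ν • (1 ⊗ₜ[ℝ] v) = 0
    · exact ⟨ν, _, hν, hm0, sub_eq_zero.1 h1⟩
    · refine ⟨-ν, _, by rw [neg_sq, hν], h1, ?_⟩
      rw [map_sub, hHH, map_smul, ← hν]
      module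
  obtain ⟨μ, m, hμ, hm, hHm⟩ := heig
  obtain ⟨n, hn⟩ := t.exists_int_of_eigenvalue (M := ℂ ⊗[ℝ] L) hm
    (show ⁅H, m⁆ = μ • m from hHm)
  refine ⟨n, ?_⟩
  rw [hn] at hμ
  exact_mod_cast hμ.symm

end Integrality

end SymmetricSpaceOrbit
namespace SymmetricSpaceOrbit

/-! ### Orthogonal symmetric Lie algebras -/

/-- A Lie algebra `L` with an involution `θ`, whose `(-1)`-eigenspace is identified by `e` with a
Euclidean space `V` on which the fixed point algebra of `θ` acts by skew maps. -/
structure OrthogonalSymmetric (L V : Type*) [LieRing L] [LieAlgebra ℝ L] [NormedAddCommGroup V]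
    [InnerProductSpace ℝ V] where
  /-- the involution -/
  θ : L →ₗ⁅ℝ⁆ L
  /-- the identification of `V` with the `(-1)`-eigenspace -/
  e : V →ₗ[ℝ] L
  /-- the projection to the `(-1)`-eigenspace -/
  pr : L →ₗ[ℝ] V
  θ_θ : ∀ a, θ (θ a) = a
  θ_e : ∀ v, θ (e v) = -e v
  pr_e : ∀ v, pr (e v) = v
  e_pr : ∀ a, e (pr a) = (1 / 2 : ℝ) • (a - θ a)
  skew : ∀ X v w, θ X = X → ⟪pr ⁅X, e v⁆, w⟫_ℝ = -⟪v, pr ⁅X, e w⁆⟫_ℝ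

namespace OrthogonalSymmetric

set_option linter.unusedSectionVars false

variable {L V : Type*} [LieRing L] [LieAlgebra ℝ L] [NormedAddCommGroup V]
  [InnerProductSpace ℝ V] (D : OrthogonalSymmetric L V)

/-- The action of `L` on `V` through the fixed point algebra of `θ`. -/
noncomputable def act : L →ₗ[ℝ] V →ₗ[ℝ] V :=
  LinearMap.mk₂ ℝ (fun X v => D.pr ⁅X, D.e v⁆) (by simp) (by simp) (by simp) (by simp)

/-- The triple product `v ↦ [h, [k, v]]` of `V`. -/
noncomputable def T (h k : V) : V →ₗ[ℝ] V :=
  D.pr ∘ₗ LieAlgebra.ad ℝ L (D.e h) ∘ₗ LieAlgebra.ad ℝ L (D.e k) ∘ₗ D.e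

theorem act_apply (X : L) (v : V) : D.act X v = D.pr ⁅X, D.e v⁆ := rfl

theorem T_apply (h k v : V) : D.T h k v = D.pr ⁅D.e h, ⁅D.e k, D.e v⁆⁆ := rfl

theorem e_injective : Function.Injective D.e := fun v w h => by
  rw [← D.pr_e v, h, D.pr_e]

theorem pr_eq_zero {X : L} (hX : D.θ X = X) : D.pr X = 0 :=
  D.e_injective (by rw [D.e_pr, hX]; simp)

theorem e_pr_of_neg {a : L} (ha : D.θ a = -a) : D.e (D.pr a) = a := by
  rw [D.e_pr, ha]; module

theorem θ_lie_e (v w : V) : D.θ ⁅D.e v, D.e w⁆ = ⁅D.e v, D.e w⁆ := by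
  simp [LieHom.map_lie, D.θ_e]

theorem e_act {X : L} (hX : D.θ X = X) (v : V) : D.e (D.act X v) = ⁅X, D.e v⁆ :=
  D.e_pr_of_neg (by simp [LieHom.map_lie, D.θ_e, hX])

theorem e_T (h k v : V) : D.e (D.T h k v) = ⁅D.e h, ⁅D.e k, D.e v⁆⁆ :=
  D.e_pr_of_neg (by simp [LieHom.map_lie, D.θ_e])

theorem act_e (w : V) : D.act (D.e w) = 0 := by
  ext v
  rw [act_apply, D.pr_eq_zero (D.θ_lie_e w v)]; rfl

/-- The component of `a` in the fixed point algebra. -/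
noncomputable def fixedPart (a : L) : L := a - D.e (D.pr a)

theorem θ_fixedPart (a : L) : D.θ (D.fixedPart a) = D.fixedPart a := by
  rw [fixedPart, map_sub, D.θ_e, D.e_pr]
  module

theorem fixedPart_add (a : L) : D.fixedPart a + D.e (D.pr a) = a := by
  simp [fixedPart]

theorem act_fixedPart (a : L) : D.act (D.fixedPart a) = D.act a := by
  simp [fixedPart, act_e]

theorem act_skew (X : L) (v w : V) : ⟪D.act X v, w⟫_ℝ = -⟪v, D.act X w⟫_ℝ := by
  rw [← act_fixedPart]
  exact D.skew _ _ _ (D.θ_fixedPart X)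

theorem act_lie_of_fixed {X Y : L} (hX : D.θ X = X) (hY : D.θ Y = Y) :
    D.act ⁅X, Y⁆ = D.act X ∘ₗ D.act Y - D.act Y ∘ₗ D.act X := by
  ext v
  apply D.e_injective
  rw [D.e_act (by simp [LieHom.map_lie, hX, hY])]
  simp [D.e_act hX, D.e_act hY]

theorem act_lie {X : L} (hX : D.θ X = X) (a : L) :
    D.act ⁅X, a⁆ = D.act X ∘ₗ D.act a - D.act a ∘ₗ D.act X := by
  rw [← D.act_fixedPart a, ← D.act_lie_of_fixed hX (D.θ_fixedPart a), fixedPart, lie_sub, map_sub,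
    ← D.e_act hX, act_e, sub_zero]

theorem pr_lie {X : L} (hX : D.θ X = X) (a : L) : D.pr ⁅X, a⁆ = D.act X (D.pr a) := by
  conv_lhs => rw [← D.fixedPart_add a]
  rw [lie_add, map_add, D.pr_eq_zero (by rw [LieHom.map_lie, hX, D.θ_fixedPart]), zero_add]
  rfl

theorem T_eq_neg_act (h k v : V) : D.T h k v = -D.act ⁅D.e k, D.e v⁆ h := by
  apply D.e_injective
  rw [D.e_T, map_neg, D.e_act (D.θ_lie_e k v), lie_skew]

theorem act_lie_e (k v h : V) : D.act ⁅D.e k, D.e v⁆ h = -D.T h k v := by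
  rw [T_eq_neg_act, neg_neg]

theorem T_skew (a b c : V) : D.T a b c = -D.T a c b := by
  apply D.e_injective
  rw [map_neg, D.e_T, D.e_T, ← lie_neg, lie_skew]

theorem T_jacobi (a b c : V) : D.T a b c + D.T b c a + D.T c a b = 0 := by
  apply D.e_injective
  simp only [map_add, D.e_T, map_zero]
  exact lie_jacobi _ _ _

theorem T_add_left (a a' b c : V) : D.T (a + a') b c = D.T a b c + D.T a' b c := by
  simp [T_apply]

theorem T_add_mid (a b b' c : V) : D.T a (b + b') c = D.T a b c + D.T a b' c := by
  simp [T_apply]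

theorem T_smul_left (r : ℝ) (a b c : V) : D.T (r • a) b c = r • D.T a b c := by
  simp [T_apply]

/-! ### The Killing form as an operator on V, and self-adjointness of the triple product -/

section Killing

theorem killingForm_lie (a b c : L) : killingForm ℝ L ⁅a, b⁆ c = killingForm ℝ L a ⁅b, c⁆ :=
  LieModule.traceForm_apply_lie_apply ℝ L L a b c

theorem killingForm_lie_left (a b c : L) :
    killingForm ℝ L ⁅a, b⁆ c = -killingForm ℝ L b ⁅a, c⁆ := by
  rw [← lie_skew, map_neg, LinearMap.neg_apply, killingForm_lie]

theorem killingForm_comm (a b : L) : killingForm ℝ L a b = killingForm ℝ L b a :=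
  LieModule.traceForm_comm ℝ L L a b

theorem killingForm_θ (a b : L) : killingForm ℝ L (D.θ a) (D.θ b) = killingForm ℝ L a b := by
  let E : L ≃ₗ⁅ℝ⁆ L := { D.θ with invFun := D.θ, left_inv := D.θ_θ, right_inv := D.θ_θ }
  exact LieAlgebra.killingForm_of_equiv_apply E a b

theorem killingForm_fixed_e {X : L} (hX : D.θ X = X) (v : V) :
    killingForm ℝ L X (D.e v) = 0 := by
  have := D.killingForm_θ X (D.e v)
  rw [hX, D.θ_e, map_neg] at this
  linarith

variable [FiniteDimensional ℝ V]

/-- The symmetric operator of `V` representing the Killing form. -/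
noncomputable def A : V →ₗ[ℝ] V where
  toFun v := (InnerProductSpace.toDual ℝ V).symm
    (LinearMap.toContinuousLinearMap ((killingForm ℝ L (D.e v)) ∘ₗ D.e))
  map_add' v w := by
    rw [← map_add]; congr 1; ext; simp
  map_smul' r v := by
    rw [RingHom.id_apply, ← LinearIsometryEquiv.map_smul]; congr 1; ext; simp

theorem inner_A (v w : V) : ⟪D.A v, w⟫_ℝ = killingForm ℝ L (D.e v) (D.e w) := by
  simp [A, InnerProductSpace.toDual_symm_apply]

theorem A_symm (v w : V) : ⟪D.A v, w⟫_ℝ = ⟪v, D.A w⟫_ℝ := by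
  rw [inner_A, real_inner_comm, inner_A, killingForm_comm]

/-- Both the Killing form and the inner product are invariant under the fixed point algebra. -/
theorem A_act (X : L) (v : V) : D.A (D.act X v) = D.act X (D.A v) := by
  rw [← D.act_fixedPart X]
  have hX := D.θ_fixedPart X
  refine ext_inner_right ℝ fun w => ?_
  rw [inner_A, act_skew, inner_A, D.e_act hX, D.e_act hX, killingForm_comm, ← lie_skew, map_neg,
    killingForm_comm, killingForm_lie]

theorem killingForm_lie_e {X : L} (hX : D.θ X = X) (v w : V) :
    killingForm ℝ L X ⁅D.e v, D.e w⁆ = ⟪D.A (D.act X v), w⟫_ℝ := by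
  rw [inner_A, D.e_act hX, killingForm_lie]

variable [FiniteDimensional ℝ L] [LieAlgebra.IsKilling ℝ L]

theorem eq_zero_of_killingForm {Z : L} (h : ∀ W, killingForm ℝ L Z W = 0) : Z = 0 :=
  (LieAlgebra.IsKilling.killingForm_nondegenerate ℝ L).1 Z h

theorem eq_zero_of_killingForm_fixed {Z : L} (hZ : D.θ Z = Z)
    (h : ∀ W, D.θ W = W → killingForm ℝ L W Z = 0) : Z = 0 := by
  refine eq_zero_of_killingForm fun W => ?_
  rw [← D.fixedPart_add W, map_add, D.killingForm_fixed_e hZ, killingForm_comm,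
    h _ (D.θ_fixedPart W), add_zero]

theorem A_injective : Function.Injective D.A := by
  rw [← LinearMap.ker_eq_bot, LinearMap.ker_eq_bot']
  intro v hv
  apply D.e_injective
  rw [map_zero]
  refine eq_zero_of_killingForm fun W => ?_
  rw [← D.fixedPart_add W, map_add, killingForm_comm, D.killingForm_fixed_e (D.θ_fixedPart W),
    ← inner_A, hv]
  simp

theorem A_surjective : Function.Surjective D.A :=
  LinearMap.surjective_of_injective D.A_injective

/-- Both sides are fixed by θ, so it is enough to pair them with fixed W under the Killing form.
Both pairings then agree, because `A` is symmetric and commutes with W. -/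
theorem lie_A (v w : V) : ⁅D.e v, D.e (D.A w)⁆ = ⁅D.e (D.A v), D.e w⁆ := by
  rw [← sub_eq_zero]
  refine D.eq_zero_of_killingForm_fixed (by rw [map_sub, θ_lie_e, θ_lie_e]) fun W hW => ?_
  rw [map_sub, D.killingForm_lie_e hW, D.killingForm_lie_e hW, ← A_act, A_symm, A_symm, A_symm,
    sub_self]

theorem T_A_mid (a b c : V) : D.T a (D.A b) c = D.T a b (D.A c) :=
  D.e_injective (by rw [e_T, e_T, lie_A])

theorem A_T (a b c : V) : D.A (D.T a b c) = D.T (D.A a) b c := by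
  rw [T_eq_neg_act, T_eq_neg_act, map_neg, A_act]

/-- `A` can already be moved between the last two slots. The first slot follows from four Jacobi
identities, with `A` applied to a, to b, to c and to the whole sum: in their alternating sum all
other terms cancel. -/
theorem T_A_left (a b c : V) : D.T (D.A a) b c = D.T a b (D.A c) := by
  have h1 := D.T_jacobi (D.A a) b c
  have h2 := D.T_jacobi a (D.A b) c
  have h3 := D.T_jacobi a b (D.A c)
  have h4 := congrArg D.A (D.T_jacobi a b c)
  simp only [map_add, A_T, map_zero] at h4
  simp only [T_A_mid] at h1 h2 h3 h4
  linear_combination (norm := module) (1 / 2 : ℝ) • (h1 - h2 - h3 + h4)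

theorem A_T_comm (a b c : V) : D.A (D.T a b c) = D.T a b (D.A c) := by
  rw [A_T, T_A_left]

/-- For the Killing form this is invariance. It transfers to the given inner product because `A` is
onto and commutes with `T h k`. -/
theorem inner_T (h k v w : V) : ⟪D.T h k v, w⟫_ℝ = ⟪v, D.T k h w⟫_ℝ := by
  obtain ⟨v, rfl⟩ := D.A_surjective v
  rw [← A_T_comm, inner_A, inner_A, e_T, e_T, killingForm_lie_left, killingForm_lie_left, neg_neg]

end Killing

end OrthogonalSymmetric
end SymmetricSpaceOrbit
namespace SymmetricSpaceOrbit
namespace OrthogonalSymmetric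
set_option linter.unusedSectionVars false

variable {L V : Type*} [LieRing L] [LieAlgebra ℝ L] [NormedAddCommGroup V]
  [InnerProductSpace ℝ V] (D : OrthogonalSymmetric L V)

/-! ### Definiteness of the Killing form on brackets of 𝔭 -/

section Definite

variable [FiniteDimensional ℝ V]

theorem trace_act_sq (a : L) : LinearMap.trace ℝ V (D.act a ∘ₗ D.act a) ≤ 0 ∧
    (LinearMap.trace ℝ V (D.act a ∘ₗ D.act a) = 0 → D.act a = 0) := by
  have h := trace_sq_nonpos_of_skew (M := V) (innerₗ V)
    ⟨fun x y => by simp [real_inner_comm]⟩ (fun x => real_inner_self_nonneg) (D.act a)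
    (fun x y => D.act_skew a x y)
    (fun x hx => by rw [inner_self_eq_zero.1 hx, map_zero])
  exact ⟨h.1, fun h0 => LinearMap.ext fun x => inner_self_eq_zero.1 (h.2 h0 x)⟩

/-- The semidefinite form of `L` given by the inner product of `V` and the trace form of `V`. -/
noncomputable def semiForm : LinearMap.BilinForm ℝ L :=
  LinearMap.mk₂ ℝ
    (fun a b => ⟪D.pr a, D.pr b⟫_ℝ - LinearMap.trace ℝ V (D.act a ∘ₗ D.act b))
    (fun a b c => by simp [inner_add_left, LinearMap.add_comp]; ring)
    (fun r a b => by simp [inner_smul_left, LinearMap.smul_comp]; ring)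
    (fun a b c => by simp [inner_add_right, LinearMap.comp_add]; ring)
    (fun r a b => by simp [inner_smul_right, LinearMap.comp_smul]; ring)

theorem semiForm_apply (a b : L) : D.semiForm a b =
    ⟪D.pr a, D.pr b⟫_ℝ - LinearMap.trace ℝ V (D.act a ∘ₗ D.act b) := rfl

theorem semiForm_self (a : L) : 0 ≤ D.semiForm a a ∧
    (D.semiForm a a = 0 → D.pr a = 0 ∧ D.act a = 0) := by
  have h1 := D.trace_act_sq a
  have h2 : 0 ≤ ⟪D.pr a, D.pr a⟫_ℝ := real_inner_self_nonneg
  rw [semiForm_apply]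
  refine ⟨by linarith [h1.1], fun h => ⟨?_, h1.2 (by linarith [h1.1])⟩⟩
  have h3 : ⟪D.pr a, D.pr a⟫_ℝ = 0 := by linarith [h1.1]
  exact inner_self_eq_zero.1 h3

theorem semiForm_skew {Z : L} (hZ : D.θ Z = Z) (a b : L) :
    D.semiForm ⁅Z, a⁆ b = -D.semiForm a ⁅Z, b⁆ := by
  rw [semiForm_apply, semiForm_apply, D.pr_lie hZ, D.pr_lie hZ, D.act_lie hZ, D.act_lie hZ,
    act_skew, LinearMap.sub_comp, LinearMap.comp_sub, map_sub, map_sub]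
  have h1 := LinearMap.trace_comp_comm' (D.act Z) (D.act a ∘ₗ D.act b)
  have h2 : (D.act a ∘ₗ D.act Z) ∘ₗ D.act b = D.act a ∘ₗ D.act Z ∘ₗ D.act b := rfl
  have h3 : (D.act Z ∘ₗ D.act a) ∘ₗ D.act b = D.act Z ∘ₗ D.act a ∘ₗ D.act b := rfl
  have h4 : (D.act a ∘ₗ D.act b) ∘ₗ D.act Z = D.act a ∘ₗ D.act b ∘ₗ D.act Z := rfl
  rw [h4] at h1
  rw [h2, h3]
  linarith

theorem lie_e_eq_zero_of_act {n : L} (hn : D.θ n = n) (h : D.act n = 0) (v : V) :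
    ⁅n, D.e v⁆ = 0 := by
  rw [← D.e_act hn, h]; simp

variable [FiniteDimensional ℝ L] [LieAlgebra.IsKilling ℝ L]

/-- Let N be the set of fixed elements acting trivially on V. Then ad Z maps L into N, every ad W
preserves N, and ad Z kills N. Hence (ad Z ∘ ad W)² = 0 and Z lies in the radical of the Killing
form. -/
theorem eq_zero_of_act_eq_zero {Z : L} (hZ : D.θ Z = Z) (hact : D.act Z = 0)
    (hker : ∀ n, D.θ n = n → D.act n = 0 → ⁅Z, n⁆ = 0) : Z = 0 := by
  refine eq_zero_of_killingForm fun W => ?_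
  have h1 : ∀ a, D.θ ⁅Z, a⁆ = ⁅Z, a⁆ ∧ D.act ⁅Z, a⁆ = 0 := by
    intro a
    have : ⁅Z, a⁆ = ⁅Z, D.fixedPart a⁆ := by
      conv_lhs => rw [← D.fixedPart_add a]
      rw [lie_add, D.lie_e_eq_zero_of_act hZ hact, add_zero]
    rw [this]
    refine ⟨by rw [LieHom.map_lie, hZ, D.θ_fixedPart], ?_⟩
    rw [D.act_lie hZ, hact]; simp
  have h2 : ∀ n, D.θ n = n → D.act n = 0 → D.θ ⁅W, n⁆ = ⁅W, n⁆ ∧ D.act ⁅W, n⁆ = 0 := by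
    intro n hn hn'
    have : ⁅W, n⁆ = ⁅D.fixedPart W, n⁆ := by
      conv_lhs => rw [← D.fixedPart_add W]
      rw [add_lie, ← lie_skew (D.e _) n, D.lie_e_eq_zero_of_act hn hn', neg_zero, add_zero]
    rw [this]
    refine ⟨by rw [LieHom.map_lie, hn, D.θ_fixedPart], ?_⟩
    rw [D.act_lie (D.θ_fixedPart W), hn']; simp
  have hnil : IsNilpotent (LieAlgebra.ad ℝ L Z ∘ₗ LieAlgebra.ad ℝ L W) := by
    refine ⟨2, ?_⟩
    ext a
    rw [sq, Module.End.mul_apply]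
    simp only [LinearMap.comp_apply, LieAlgebra.ad_apply, LinearMap.zero_apply]
    have h3 := h2 _ (h1 ⁅W, a⁆).1 (h1 ⁅W, a⁆).2
    exact hker _ h3.1 h3.2
  rw [killingForm_apply_apply]
  exact (LinearMap.isNilpotent_trace_of_isNilpotent hnil).eq_zero

/-- The Killing form is negative definite on brackets of elements of `V`. -/
theorem killingForm_bracket_self (x y : V) :
    killingForm ℝ L ⁅D.e x, D.e y⁆ ⁅D.e x, D.e y⁆ ≤ 0 ∧
      (killingForm ℝ L ⁅D.e x, D.e y⁆ ⁅D.e x, D.e y⁆ = 0 → ⁅D.e x, D.e y⁆ = 0) := by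
  have hZ := D.θ_lie_e x y
  -- `semiForm` may be degenerate, its kernel consisting of fixed elements acting trivially on V.
  -- Those commute with x and y, hence with [x, y]; this is why definiteness is claimed only for
  -- brackets.
  have hker : ∀ n, D.θ n = n → D.act n = 0 → ⁅⁅D.e x, D.e y⁆, n⁆ = 0 := by
    intro n hn hn'
    rw [lie_lie, ← lie_skew (D.e y) n, ← lie_skew (D.e x) n, D.lie_e_eq_zero_of_act hn hn',
      D.lie_e_eq_zero_of_act hn hn']
    simp
  have h := trace_sq_nonpos_of_skew D.semiForm
    ⟨fun a b => by
      simp only [semiForm_apply, real_inner_comm (D.pr a)]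
      rw [LinearMap.trace_comp_comm']⟩ (fun a => (D.semiForm_self a).1)
    (LieAlgebra.ad ℝ L ⁅D.e x, D.e y⁆) (fun a b => D.semiForm_skew hZ a b)
    (fun a ha => by
      obtain ⟨h1, h2⟩ := (D.semiForm_self a).2 ha
      refine hker a ?_ h2
      rw [← D.fixedPart_add a, h1, map_zero, add_zero, D.θ_fixedPart])
  rw [killingForm_apply_apply]
  refine ⟨h.1, fun h0 => D.eq_zero_of_act_eq_zero hZ ?_ hker⟩
  ext v
  have h1 := ((D.semiForm_self _).2 (h.2 h0 (D.e v))).1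
  rw [LieAlgebra.ad_apply] at h1
  rw [act_apply, h1]; rfl

/-- If `[h, [h, v]] = 0` then `[h, v] = 0`. -/
theorem lie_eq_zero_of_T {h v : V} (hT : D.T h h v = 0) : ⁅D.e h, D.e v⁆ = 0 := by
  refine (D.killingForm_bracket_self h v).2 ?_
  rw [killingForm_lie_left, ← D.e_T, hT]; simp

/-- The adjoint of `T h k` is `T k h`, which is the same operator when h and k commute. -/
theorem T_isSymmetric {h k : V} (hk : ⁅D.e h, D.e k⁆ = 0) : (D.T h k).IsSymmetric := by
  intro v w
  rw [inner_T]
  congr 1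
  apply D.e_injective
  rw [e_T, e_T, leibniz_lie, ← lie_skew (D.e k) (D.e h), hk]; simp

end Definite

/-! ### Restricted roots -/

section Roots

/-- `Sec` is a maximal abelian subspace. -/
structure IsMaxAbelian (Sec : Submodule ℝ V) : Prop where
  lie_eq_zero : ∀ v ∈ Sec, ∀ w ∈ Sec, ⁅D.e v, D.e w⁆ = 0
  mem_of_lie : ∀ v, (∀ h ∈ Sec, ⁅D.e h, D.e v⁆ = 0) → v ∈ Sec

/-- `x` is a joint eigenvector for the squares of the elements of `Sec`, with weight `α`. -/
def IsWeightVector (Sec : Submodule ℝ V) (ε : ℝ) (α : StrongDual ℝ Sec) (x : V) : Prop :=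
  (ε = 1 ∨ ε = -1) ∧ x ≠ 0 ∧ ∀ h : Sec, D.T h h x = (ε * α h ^ 2) • x

variable {D} {Sec : Submodule ℝ V}

theorem IsMaxAbelian.lie_lie_comm (hS : D.IsMaxAbelian Sec) {h k : V} (hh : h ∈ Sec) (hk : k ∈ Sec)
    (u : L) : ⁅D.e h, ⁅D.e k, u⁆⁆ = ⁅D.e k, ⁅D.e h, u⁆⁆ := by
  rw [leibniz_lie, hS.lie_eq_zero h hh k hk, zero_lie, zero_add]

theorem IsMaxAbelian.T_comm (hS : D.IsMaxAbelian Sec) {h k : V} (hh : h ∈ Sec) (hk : k ∈ Sec)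
    (v : V) : D.T h k v = D.T k h v :=
  D.e_injective (by rw [e_T, e_T, hS.lie_lie_comm hh hk])

theorem IsMaxAbelian.T_T_comm (hS : D.IsMaxAbelian Sec) {h k h' k' : V} (hh : h ∈ Sec)
    (hk : k ∈ Sec) (hh' : h' ∈ Sec) (hk' : k' ∈ Sec) (v : V) :
    D.T h k (D.T h' k' v) = D.T h' k' (D.T h k v) := by
  apply D.e_injective
  simp only [e_T]
  rw [hS.lie_lie_comm hk hh', hS.lie_lie_comm hh hh', hS.lie_lie_comm hk hk',
    hS.lie_lie_comm hh hk']

theorem IsMaxAbelian.T_T_swap (hS : D.IsMaxAbelian Sec) {h k : V} (hh : h ∈ Sec)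
    (hk : k ∈ Sec) (v : V) :
    D.T h h (D.T k k v) = D.T h k (D.T h k v) := by
  apply D.e_injective
  simp only [e_T]
  rw [hS.lie_lie_comm hh hk]

/-- Polarization of the weight condition. -/
theorem IsWeightVector.T_apply (hS : D.IsMaxAbelian Sec) {ε : ℝ} {α : StrongDual ℝ Sec} {x : V}
    (hx : D.IsWeightVector Sec ε α x) (h k : Sec) : D.T h k x = (ε * (α h * α k)) • x := by
  have h1 := hx.2.2 (h + k)
  have h2 := hx.2.2 h
  have h3 := hx.2.2 k
  simp only [Submodule.coe_add, map_add, T_add_left, T_add_mid] at h1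
  rw [hS.T_comm k.2 h.2, h2, h3] at h1
  linear_combination (norm := module) (1 / 2 : ℝ) • h1

variable [FiniteDimensional ℝ V] [FiniteDimensional ℝ L] [LieAlgebra.IsKilling ℝ L]

/-- The operators `T h k` with h, k ∈ Sec commute and are symmetric. On a joint eigenvector the
eigenvalue q(h, k) is bilinear with q(h, h) q(k, k) = q(h, k)², so q has rank at most one and equals
±β ⊗ β. -/
theorem IsMaxAbelian.exists_weight_basis (hS : D.IsMaxAbelian Sec) :
    ∃ (κ : Type) (_ : Fintype κ) (b : OrthonormalBasis κ ℝ V),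
      ∀ j, ∃ ε α, D.IsWeightVector Sec ε α (b j) := by
  obtain ⟨κ, _, b, hb⟩ := exists_joint_eigenbasis (fun i : Sec × Sec => D.T i.1 i.2)
    (fun i => D.T_isSymmetric (hS.lie_eq_zero _ i.1.2 _ i.2.2))
    (fun i j => LinearMap.ext fun v => hS.T_T_comm i.1.2 i.2.2 j.1.2 j.2.2 v)
  refine ⟨κ, inferInstance, b, fun j => ?_⟩
  have hbj : b j ≠ 0 := b.orthonormal.ne_zero j
  choose q hq using fun i => hb i j
  have hadd : ∀ h k l, q (h + k, l) = q (h, l) + q (k, l) := fun h k l => by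
    have := hq (h + k, l)
    simp only [Submodule.coe_add, T_add_left] at this
    rw [hq (h, l), hq (k, l), ← add_smul] at this
    exact (smul_left_injective ℝ hbj this).symm
  have hsmul : ∀ (r : ℝ) h l, q (r • h, l) = r * q (h, l) := fun r h l => by
    have := hq (r • h, l)
    simp only [Submodule.coe_smul, T_smul_left] at this
    rw [hq (h, l), smul_smul] at this
    exact (smul_left_injective ℝ hbj this).symm
  have hsq : ∀ h k, q (h, h) * q (k, k) = q (h, k) ^ 2 := fun h k => by
    have := hS.T_T_swap h.2 k.2 (b j)
    rw [hq (k, k), hq (h, k), map_smul, map_smul, hq (h, h), hq (h, k), smul_smul, smul_smul]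
      at this
    have := smul_left_injective ℝ hbj this
    linarith
  by_cases h0 : ∀ h, q (h, h) = 0
  · refine ⟨1, 0, Or.inl rfl, hbj, fun h => ?_⟩
    rw [hq (h, h), h0]; simp
  push Not at h0
  obtain ⟨h0, hh0⟩ := h0
  have hs : 0 < |q (h0, h0)| := abs_pos.2 hh0
  -- Normalized so that β(h)² = q(h, h₀)² / |q(h₀, h₀)| = |q(h, h)|; the sign of q(h₀, h₀) becomes
  -- ε.
  let β : Sec →ₗ[ℝ] ℝ :=
    { toFun := fun h => q (h, h0) / Real.sqrt |q (h0, h0)|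
      map_add' := fun h k => by rw [hadd]; ring
      map_smul' := fun r h => by rw [hsmul, RingHom.id_apply, smul_eq_mul]; ring }
  refine ⟨SignType.sign (q (h0, h0)), LinearMap.toContinuousLinearMap β, ?_, hbj, fun h => ?_⟩
  · rcases lt_or_gt_of_ne hh0 with h | h
    · right; simp [sign_neg h]
    · left; simp [sign_pos h]
  · rw [hq (h, h)]
    congr 1
    have h1 : (LinearMap.toContinuousLinearMap β) h = q (h, h0) / Real.sqrt |q (h0, h0)| := rfl
    have h2 : ((SignType.sign (q (h0, h0)) : ℝ)) * q (h0, h0) = |q (h0, h0)| := sign_mul_self _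
    rw [h1, div_pow, Real.sq_sqrt hs.le, ← hsq]
    field_simp
    linear_combination -q (h, h) * h2

theorem IsMaxAbelian.mem_of_weight_zero (hS : D.IsMaxAbelian Sec) {ε : ℝ} {x : V}
    (hx : D.IsWeightVector Sec ε 0 x) : x ∈ Sec :=
  hS.mem_of_lie x fun h hh => D.lie_eq_zero_of_T (by simpa using hx.2.2 ⟨h, hh⟩)

variable (D Sec) in
/-- The set of nonzero weights. -/
def roots : Set (StrongDual ℝ Sec) := {α | α ≠ 0 ∧ ∃ ε x, D.IsWeightVector Sec ε α x}

-- A root is determined by its values on a basis of Sec, and the square of each value is, up to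
-- sign, an eigenvalue of ad(bᵢ)² on V.
variable (D Sec) in
theorem finite_roots : (D.roots Sec).Finite := by
  let b := Module.finBasis ℝ Sec
  have hF : ∀ i, {c : ℝ | Module.End.HasEigenvalue (D.T (b i) (b i)) (c ^ 2) ∨
      Module.End.HasEigenvalue (D.T (b i) (b i)) (-c ^ 2)}.Finite := by
    intro i
    have hfin : {c : ℝ | Module.End.HasEigenvalue (D.T (b i) (b i)) c}.Finite :=
      Module.End.finite_hasEigenvalue _
    refine ((hfin.union (hfin.image Neg.neg)).biUnion (t := fun d => {c : ℝ | c ^ 2 = d})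
      fun d _ => ?_).subset ?_
    · refine (Set.toFinite {Real.sqrt d, -Real.sqrt d}).subset fun c hc => ?_
      have hc : c ^ 2 = d := hc
      rw [← hc, Real.sqrt_sq_eq_abs]
      rcases abs_choice c with h | h <;> rw [h] <;> simp
    · rintro c (hc | hc)
      · exact Set.mem_biUnion (Or.inl hc) rfl
      · exact Set.mem_biUnion (Or.inr ⟨_, hc, neg_neg _⟩) rfl
  refine Set.Finite.of_finite_image (f := fun (α : StrongDual ℝ Sec) i => α (b i))
    ((Set.Finite.pi' hF).subset ?_) ?_
  · rintro _ ⟨α, ⟨-, ε, x, hε, hx0, hx⟩, rfl⟩ i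
    have h1 := hx (b i)
    rcases hε with rfl | rfl
    · exact Or.inl (Module.End.hasEigenvalue_of_hasEigenvector
        ⟨Module.End.mem_eigenspace_iff.2 (by simpa using h1), hx0⟩)
    · exact Or.inr (Module.End.hasEigenvalue_of_hasEigenvector
        ⟨Module.End.mem_eigenspace_iff.2 (by simpa using h1), hx0⟩)
  · intro α _ β _ h
    exact ContinuousLinearMap.coe_injective (b.ext fun i => congrFun h i)

/-- Finitely many nonzero functionals have a common point of nonvanishing. There only weight zero
survives in a vector commuting with h, and weight zero vectors lie in Sec. -/
theorem IsMaxAbelian.exists_regular (hS : D.IsMaxAbelian Sec) :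
    ∃ h ∈ Sec, ∀ v, ⁅D.e h, D.e v⁆ = 0 → v ∈ Sec := by
  have := (D.finite_roots Sec).to_subtype
  obtain ⟨h, hh⟩ := Module.Dual.exists_forall_ne_zero_of_forall_exists
    (fun α : D.roots Sec => (α.1 : Sec →ₗ[ℝ] ℝ)) (fun α => by
      by_contra! hc
      exact α.2.1 (ContinuousLinearMap.ext hc))
  refine ⟨h, h.2, fun v hv => ?_⟩
  obtain ⟨κ, _, b, hb⟩ := hS.exists_weight_basis
  rw [← b.sum_repr' v]
  refine Submodule.sum_mem _ fun j _ => ?_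
  obtain ⟨ε, α, hw⟩ := hb j
  by_cases hα : α = 0
  · exact Submodule.smul_mem _ _ (hS.mem_of_weight_zero (hα ▸ hw))
  have h1 : α h ≠ 0 := hh ⟨α, hα, ε, _, hw⟩
  have h2 : D.T h h v = 0 := D.e_injective (by rw [e_T, hv]; simp)
  have h3 : ⟪D.T h h v, b j⟫_ℝ = (ε * α h ^ 2) * ⟪v, b j⟫_ℝ := by
    rw [inner_T, hw.2.2 h, inner_smul_right]
  rw [h2, inner_zero_left] at h3
  have hε : ε ≠ 0 := by rcases hw.1 with h | h <;> rw [h] <;> norm_num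
  have h4 : ⟪v, b j⟫_ℝ = 0 := by
    rcases mul_eq_zero.1 h3.symm with h | h
    · exact absurd h (mul_ne_zero hε (pow_ne_zero _ h1))
    · exact h
  rw [real_inner_comm, h4, zero_smul]
  exact Submodule.zero_mem _

/-- Without roots all of V is abelian. Then ⟨A(Xw), u⟩ is the Killing product of X with [w, u] = 0,
so the fixed algebra acts trivially on V and e(V) is central. A Killing Lie algebra has no center.
-/
theorem IsMaxAbelian.roots_nonempty [Nontrivial V] (hS : D.IsMaxAbelian Sec) :
    (D.roots Sec).Nonempty := by
  by_contra hne
  rw [Set.not_nonempty_iff_eq_empty] at hne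
  obtain ⟨κ, _, b, hb⟩ := hS.exists_weight_basis
  have htop : ∀ v, v ∈ Sec := by
    intro v
    rw [← b.sum_repr' v]
    refine Submodule.sum_mem _ fun j _ => Submodule.smul_mem _ _ ?_
    obtain ⟨ε, α, hw⟩ := hb j
    by_cases hα : α = 0
    · exact hS.mem_of_weight_zero (hα ▸ hw)
    · have : α ∈ D.roots Sec := ⟨hα, ε, _, hw⟩
      simp [hne] at this
  obtain ⟨v, hv⟩ := exists_ne (0 : V)
  have hact : ∀ X w, D.act X w = 0 := by
    intro X w
    apply D.A_injective
    rw [← act_fixedPart, map_zero]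
    refine ext_inner_right ℝ fun u => ?_
    rw [← D.killingForm_lie_e (D.θ_fixedPart X), hS.lie_eq_zero _ (htop _) _ (htop _)]
    simp
  apply hv
  apply D.e_injective
  rw [map_zero]
  have hcen : D.e v ∈ LieAlgebra.center ℝ L := by
    rw [LieModule.mem_maxTrivSubmodule]
    intro X
    rw [← D.fixedPart_add X, add_lie, hS.lie_eq_zero _ (htop _) _ (htop _),
      ← D.e_act (D.θ_fixedPart X), hact]
    simp
  simpa using hcen

end Roots

end OrthogonalSymmetric
end SymmetricSpaceOrbit
namespace SymmetricSpaceOrbit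
namespace OrthogonalSymmetric
set_option linter.unusedSectionVars false

/-! ### Cartan integers and the bound on the shape operator -/

section RootBounds

variable {L V : Type*} [LieRing L] [LieAlgebra ℝ L] [NormedAddCommGroup V]
  [InnerProductSpace ℝ V] {D : OrthogonalSymmetric L V} {Sec : Submodule ℝ V}
  [FiniteDimensional ℝ V] [FiniteDimensional ℝ L] [LieAlgebra.IsKilling ℝ L]

/-- The vector of `Sec` representing a linear functional. -/
noncomputable def dualVec (α : StrongDual ℝ Sec) : Sec := (InnerProductSpace.toDual ℝ Sec).symm α

theorem inner_dualVec (α : StrongDual ℝ Sec) (h : Sec) : ⟪dualVec α, h⟫_ℝ = α h :=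
  InnerProductSpace.toDual_symm_apply

theorem norm_dualVec (α : StrongDual ℝ Sec) : ‖dualVec α‖ = ‖α‖ :=
  LinearIsometryEquiv.norm_map _ _

theorem norm_pos_of_ne_zero {α : StrongDual ℝ Sec} (hα : α ≠ 0) : 0 < ‖α‖ := by
  rw [← norm_dualVec]
  refine norm_pos_iff.2 fun h => hα ?_
  exact (InnerProductSpace.toDual ℝ Sec).symm.injective (h.trans (map_zero _).symm)

theorem apply_dualVec (α : StrongDual ℝ Sec) : α (dualVec α) = ‖α‖ ^ 2 := by
  rw [← inner_dualVec, real_inner_self_eq_norm_sq, norm_dualVec]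

theorem apply_dualVec_comm (α β : StrongDual ℝ Sec) : α (dualVec β) = β (dualVec α) := by
  rw [← inner_dualVec, ← inner_dualVec, real_inner_comm]

/-- The part of h in the kernel of α has ad(h)²x = 0, hence [h, x] = 0 by definiteness. -/
theorem IsWeightVector.lie_e {ε : ℝ} {α : StrongDual ℝ Sec} {x : V}
    (hx : D.IsWeightVector Sec ε α x) (hα : α ≠ 0) (h : Sec) :
    ⁅D.e h, D.e x⁆ = (α h / ‖α‖ ^ 2) • ⁅D.e (dualVec α : V), D.e x⁆ := by
  have hN : ‖α‖ ^ 2 ≠ 0 := pow_ne_zero _ (norm_pos_of_ne_zero hα).ne'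
  have h1 : α (h - (α h / ‖α‖ ^ 2) • dualVec α) = 0 := by
    rw [map_sub, map_smul, apply_dualVec, smul_eq_mul]
    field_simp
    ring
  have h2 := hx.2.2 (h - (α h / ‖α‖ ^ 2) • dualVec α)
  rw [h1] at h2
  have h3 := D.lie_eq_zero_of_T (h2.trans (by simp))
  rw [Submodule.coe_sub, Submodule.coe_smul, map_sub, map_smul, sub_lie, smul_lie] at h3
  exact sub_eq_zero.1 h3

/-- This closes the span of t = `dualVec α`, x and [t, x] under brackets. By the Leibniz rule [x,
[t, x]] commutes with Sec, since [h, x] is parallel to [t, x] and [h, [t, x]] to x. So it lies in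
Sec and is found by pairing with Sec. -/
theorem IsWeightVector.T_dualVec (hS : D.IsMaxAbelian Sec) {ε : ℝ} {α : StrongDual ℝ Sec} {x : V}
    (hx : D.IsWeightVector Sec ε α x) (hα : α ≠ 0) :
    D.T x (dualVec α) x = (-(ε * (‖α‖ ^ 2 * ‖x‖ ^ 2))) • (dualVec α : V) := by
  have hmem : D.T x (dualVec α) x ∈ Sec := by
    refine hS.mem_of_lie _ fun h hh => ?_
    have h1 := hx.T_apply hS ⟨h, hh⟩ (dualVec α)
    have h2 := hx.lie_e hα ⟨h, hh⟩
    simp only at h1 h2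
    rw [e_T, leibniz_lie, ← e_T, h1, h2, smul_lie, lie_self, map_smul, lie_smul, lie_self]
    simp
  have hz : ∀ h ∈ Sec, ⟪D.T x (dualVec α) x + (ε * (‖α‖ ^ 2 * ‖x‖ ^ 2)) • (dualVec α : V), h⟫_ℝ
      = 0 := by
    intro h hh
    have h1 := hx.T_apply hS (dualVec α) ⟨h, hh⟩
    have h2 := inner_dualVec α ⟨h, hh⟩
    simp only [Submodule.coe_inner] at h1 h2
    rw [inner_add_left, inner_T, T_skew, h1, inner_neg_right, inner_smul_right,
      real_inner_self_eq_norm_sq, apply_dualVec, inner_smul_left, h2]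
    simp only [conj_trivial]
    ring
  have h0 := inner_self_eq_zero.1
    (hz _ (Submodule.add_mem _ hmem (Submodule.smul_mem _ _ (dualVec α).2)))
  rw [eq_neg_of_add_eq_zero_left h0, neg_smul]

/-- Integrality of the Cartan numbers of restricted roots. -/
theorem IsMaxAbelian.exists_int (hS : D.IsMaxAbelian Sec) {α β : StrongDual ℝ Sec}
    (hα : α ∈ D.roots Sec) (hβ : β ∈ D.roots Sec) :
    ∃ n : ℤ, (2 * β (dualVec α)) ^ 2 = (n : ℝ) ^ 2 * (‖α‖ ^ 2) ^ 2 := by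
  obtain ⟨hα0, ε, x, hx⟩ := hα
  obtain ⟨hβ0, ε', v, hv⟩ := hβ
  have hN : ‖α‖ ^ 2 ≠ 0 := pow_ne_zero _ (norm_pos_of_ne_zero hα0).ne'
  have hxn : ‖x‖ ^ 2 ≠ 0 := pow_ne_zero _ (norm_ne_zero_iff.2 hx.2.1)
  set N := ‖α‖ ^ 2 with hNdef
  have htx : ⁅D.e (dualVec α : V), ⁅D.e (dualVec α : V), D.e x⁆⁆ = (ε * N ^ 2) • D.e x := by
    rw [← e_T, hx.2.2, apply_dualVec, map_smul]
  have htv : ⁅D.e (dualVec α : V), ⁅D.e (dualVec α : V), D.e v⁆⁆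
      = (ε' * β (dualVec α) ^ 2) • D.e v := by
    rw [← e_T, hv.2.2, map_smul]
  have hxt : ⁅D.e x, ⁅D.e (dualVec α : V), D.e x⁆⁆
      = (-(ε * (N * ‖x‖ ^ 2))) • D.e (dualVec α : V) := by
    rw [← e_T, hx.T_dualVec hS hα0, map_smul]
  -- The neutral element is the coroot 2t/N, so its eigenvalues are Cartan numbers. The constant c
  -- is what [x, [t, x]] = -εN‖x‖²t becomes after rescaling.
  obtain ⟨n, hn⟩ := exists_int_sq_of_triple (h := (2 / N) • D.e (dualVec α : V)) (x := D.e x)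
    (y := (1 / N) • ⁅D.e (dualVec α : V), D.e x⁆) (v := D.e v) (ε := ε)
    (c := ‖x‖ ^ 2 * N / 2) (lam := (4 / N ^ 2) * (ε' * β (dualVec α) ^ 2)) hx.1
    (by positivity)
    (by rw [smul_lie, smul_smul]; congr 1; ring)
    (by rw [smul_lie, lie_smul, htx, smul_smul, smul_smul]; congr 1; field_simp)
    (by rw [lie_smul, hxt, smul_smul, smul_smul]; congr 1; field_simp)
    (by rw [Ne, ← map_zero D.e, D.e_injective.eq_iff]; exact hv.2.1)
    (by rw [smul_lie, smul_lie, lie_smul, htv, smul_smul, smul_smul]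
        congr 1; ring)
  have hn' : (ε * ε') * (2 * β (dualVec α)) ^ 2 = (n : ℝ) ^ 2 * N ^ 2 := by
    rw [← hn]; field_simp; ring
  have hεε : ε * ε' = 1 ∨ ε * ε' = -1 := by
    rcases hx.1 with rfl | rfl <;> rcases hv.1 with rfl | rfl <;> norm_num
  rcases hεε with h | h
  · exact ⟨n, by rw [← hn', h, one_mul]⟩
  -- For roots of opposite type a nonpositive number equals a nonnegative one, so the Cartan number
  -- vanishes.
  · refine ⟨0, ?_⟩
    rw [h] at hn'
    have h1 : 0 ≤ (n : ℝ) ^ 2 * N ^ 2 := by positivity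
    have h2 : 0 ≤ (2 * β (dualVec α)) ^ 2 := by positivity
    simp only [Int.cast_zero]
    linarith

/-- Both Cartan numbers are nonzero integers up to sign, so 4⟨α, β⟩² dominates ‖α‖⁴ and ‖β‖⁴, and
with them their geometric mean. -/
theorem IsMaxAbelian.cartan_bound (hS : D.IsMaxAbelian Sec) {α β : StrongDual ℝ Sec}
    (hα : α ∈ D.roots Sec) (hβ : β ∈ D.roots Sec) (hαβ : β (dualVec α) ≠ 0) :
    ‖α‖ ^ 2 * ‖β‖ ^ 2 ≤ 4 * β (dualVec α) ^ 2 := by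
  have key : ∀ {γ δ : StrongDual ℝ Sec}, γ ∈ D.roots Sec → δ ∈ D.roots Sec →
      δ (dualVec γ) ≠ 0 → (‖γ‖ ^ 2) ^ 2 ≤ 4 * δ (dualVec γ) ^ 2 := by
    intro γ δ hγ hδ hne
    obtain ⟨n, hn⟩ := hS.exists_int hγ hδ
    have hn0 : n ≠ 0 := by
      rintro rfl
      apply hne
      have : (2 * δ (dualVec γ)) ^ 2 = 0 := by rw [hn]; simp
      nlinarith
    have h1 : (1 : ℝ) ≤ (n : ℝ) ^ 2 := by
      have : 0 < n ^ 2 := by positivity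
      exact_mod_cast this
    nlinarith [sq_nonneg (‖γ‖ ^ 2)]
  have h1 := key hα hβ hαβ
  have h2 := key hβ hα (by rwa [apply_dualVec_comm])
  rw [apply_dualVec_comm α β] at h2
  nlinarith [sq_nonneg (‖α‖ ^ 2 - ‖β‖ ^ 2)]

theorem IsMaxAbelian.root_ratio_bound (hS : D.IsMaxAbelian Sec) {α β : StrongDual ℝ Sec}
    (hα : α ∈ D.roots Sec) (hβ : β ∈ D.roots Sec) (hαβ : β (dualVec α) ≠ 0) (ξ : Sec) :
    ‖α‖ ^ 2 * β ξ ^ 2 ≤ 4 * β (dualVec α) ^ 2 * ‖ξ‖ ^ 2 := by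
  have hN : 0 < ‖α‖ ^ 2 := pow_pos (norm_pos_of_ne_zero hα.1) _
  have h1 := hS.cartan_bound hα hβ hαβ
  have h2 : |β ξ| ≤ ‖β‖ * ‖ξ‖ := β.le_opNorm ξ
  have h3 : β ξ ^ 2 ≤ ‖β‖ ^ 2 * ‖ξ‖ ^ 2 := by
    rw [← sq_abs, ← mul_pow]
    exact pow_le_pow_left₀ (abs_nonneg _) h2 2
  nlinarith [mul_le_mul_of_nonneg_left h3 hN.le, mul_le_mul_of_nonneg_right h1 (sq_nonneg ‖ξ‖)]

/-- With w = A w', the inner product is the Killing product of the fixed part of X with [p, w'], and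
[p, w'] = 0 by definiteness. Weights vanishing at p therefore do not occur in the orbit directions.
-/
theorem inner_act_eq_zero {p w : V} (h : D.T p p w = 0) (X : L) : ⟪D.act X p, w⟫_ℝ = 0 := by
  obtain ⟨w, rfl⟩ := D.A_surjective w
  have h1 : D.T p p w = 0 := D.A_injective (by rw [A_T_comm, h, map_zero])
  rw [← act_fixedPart, ← A_symm, ← D.killingForm_lie_e (D.θ_fixedPart X), D.lie_eq_zero_of_T h1]
  simp

/-- Apply the derivation ad Y to [h, k] = 0, then bracket with h. -/
theorem T_act_swap {h k : V} (hk : ⁅D.e h, D.e k⁆ = 0) (Y : L) :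
    D.T h h (D.act Y k) = D.T h k (D.act Y h) := by
  apply D.e_injective
  rw [← act_fixedPart]
  rw [e_T, e_T, D.e_act (D.θ_fixedPart Y), D.e_act (D.θ_fixedPart Y)]
  congr 1
  have := leibniz_lie (D.fixedPart Y) (D.e h) (D.e k)
  rw [hk, lie_zero, ← lie_skew] at this
  exact (neg_add_eq_zero.1 this.symm).symm

/-- The second fundamental form bound at a point in a root direction, for normal vectors in the
section. -/
theorem IsMaxAbelian.inner_act_act_le (hS : D.IsMaxAbelian Sec) {α : StrongDual ℝ Sec}
    (hα : α ∈ D.roots Sec) {p : Sec} (hp : p = (1 / ‖α‖) • dualVec α) (ξ : Sec)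
    (X Y : L) :
    ⟪D.act Y (D.act X p), ξ⟫_ℝ ≤ 2 * ‖D.act X p‖ * ‖D.act Y p‖ * ‖ξ‖ := by
  have hN : 0 < ‖α‖ := norm_pos_of_ne_zero hα.1
  obtain ⟨κ, _, b, hb⟩ := hS.exists_weight_basis
  have hterm : ∀ j, |⟪D.act X p, b j⟫_ℝ * ⟪b j, D.act Y ξ⟫_ℝ|
      ≤ 2 * ‖ξ‖ * (|⟪D.act X p, b j⟫_ℝ| * |⟪D.act Y p, b j⟫_ℝ|) := by
    intro j
    obtain ⟨ε, β, hw⟩ := hb j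
    have hε : ε ≠ 0 := by rcases hw.1 with h | h <;> rw [h] <;> norm_num
    by_cases hβp : β p = 0
    · rw [inner_act_eq_zero (D := D) (by rw [hw.2.2 p, hβp]; simp) X]
      simp
    have hβt : β (dualVec α) ≠ 0 := by
      intro h
      apply hβp
      rw [hp, map_smul, h, smul_zero]
    have hβ0 : β ≠ 0 := by
      rintro rfl
      simp at hβt
    have h1 := hS.root_ratio_bound hα ⟨hβ0, ε, _, hw⟩ hβt ξ
    have h2 : β ξ ^ 2 ≤ (2 * ‖ξ‖ * |β p|) ^ 2 := by
      rw [mul_pow, sq_abs, hp, map_smul, smul_eq_mul, mul_pow, mul_pow, div_pow, one_pow]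
      rw [← sub_nonneg] at h1 ⊢
      have : 0 ≤ (1 / ‖α‖ ^ 2) * (4 * β (dualVec α) ^ 2 * ‖ξ‖ ^ 2 - ‖α‖ ^ 2 * β ξ ^ 2) := by
        positivity
      convert this using 1
      field_simp
      ring
    have h3 : |β ξ| ≤ 2 * ‖ξ‖ * |β p| := abs_le_of_sq_le_sq h2 (by positivity)
    have h4 := congrArg (fun z => ⟪z, b j⟫_ℝ)
      (T_act_swap (D := D) (hS.lie_eq_zero p p.2 ξ ξ.2) Y)
    simp only [inner_T] at h4
    rw [hw.2.2 p, hw.T_apply hS, inner_smul_right, inner_smul_right] at h4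
    -- This is the diagonal form of the shape operator: its entry at β is -β(ξ)/β(p).
    have h5 : β p * ⟪D.act Y ξ, b j⟫_ℝ = β ξ * ⟪D.act Y p, b j⟫_ℝ := by
      have : (ε * β p) * (β p * ⟪D.act Y ξ, b j⟫_ℝ) = (ε * β p) * (β ξ * ⟪D.act Y p, b j⟫_ℝ) := by
        linarith
      exact mul_left_cancel₀ (mul_ne_zero hε hβp) this
    have h6 : |⟪D.act Y ξ, b j⟫_ℝ| ≤ 2 * ‖ξ‖ * |⟪D.act Y p, b j⟫_ℝ| := by
      have h7 := congrArg abs h5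
      rw [abs_mul, abs_mul] at h7
      have h8 : 0 < |β p| := abs_pos.2 hβp
      have h9 := mul_le_mul_of_nonneg_right h3 (abs_nonneg ⟪D.act Y p, b j⟫_ℝ)
      rw [← h7] at h9
      refine le_of_mul_le_mul_left (h9.trans_eq ?_) h8
      ring
    rw [abs_mul, real_inner_comm (D.act Y ξ)]
    calc _ ≤ |⟪D.act X p, b j⟫_ℝ| * (2 * ‖ξ‖ * |⟪D.act Y p, b j⟫_ℝ|) :=
          mul_le_mul_of_nonneg_left h6 (abs_nonneg _)
      _ = _ := by ring
  have hCS : ∑ j, |⟪D.act X p, b j⟫_ℝ| * |⟪D.act Y p, b j⟫_ℝ| ≤ ‖D.act X p‖ * ‖D.act Y p‖ := by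
    refine abs_le_of_sq_le_sq' ?_ (by positivity) |>.2
    refine (Finset.sum_mul_sq_le_sq_mul_sq _ _ _).trans_eq ?_
    rw [mul_pow, ← b.sum_sq_norm_inner_left (D.act X p), ← b.sum_sq_norm_inner_left (D.act Y p)]
    simp [Real.norm_eq_abs]
  calc ⟪D.act Y (D.act X p), ξ⟫_ℝ = -⟪D.act X p, D.act Y ξ⟫_ℝ := D.act_skew _ _ _
    _ ≤ |⟪D.act X p, D.act Y ξ⟫_ℝ| := neg_le_abs _
    _ = |∑ j, ⟪D.act X p, b j⟫_ℝ * ⟪b j, D.act Y ξ⟫_ℝ| := by rw [b.sum_inner_mul_inner]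
    _ ≤ ∑ j, |⟪D.act X p, b j⟫_ℝ * ⟪b j, D.act Y ξ⟫_ℝ| := Finset.abs_sum_le_sum_abs _ _
    _ ≤ ∑ j, 2 * ‖ξ‖ * (|⟪D.act X p, b j⟫_ℝ| * |⟪D.act Y p, b j⟫_ℝ|) :=
        Finset.sum_le_sum fun j _ => hterm j
    _ = 2 * ‖ξ‖ * ∑ j, |⟪D.act X p, b j⟫_ℝ| * |⟪D.act Y p, b j⟫_ℝ| := by rw [Finset.mul_sum]
    _ ≤ 2 * ‖ξ‖ * (‖D.act X p‖ * ‖D.act Y p‖) := by gcongr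
    _ = _ := by ring

/-- A vector orthogonal to the orbit through `p` commutes with `p`. -/
theorem lie_eq_zero_of_normal {p ξ : V} (h : ∀ X, D.θ X = X → ⟪D.act X p, ξ⟫_ℝ = 0) :
    ⁅D.e p, D.e ξ⁆ = 0 := by
  refine D.lie_eq_zero_of_T ?_
  refine ext_inner_left ℝ fun w => ?_
  rw [← inner_T, inner_zero_right]
  have := h _ (D.θ_lie_e p w)
  rwa [act_lie_e, inner_neg_left, neg_eq_zero] at this

/-- If `ξ` is a critical point of `⟪·, h⟫` on its orbit under the stabilizer of `p`, where `ξ` and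
`h` commute with `p`, then `ξ` commutes with `h`. -/
theorem lie_eq_zero_of_critical {p ξ h : V} (hpξ : ⁅D.e p, D.e ξ⁆ = 0) (hph : ⁅D.e p, D.e h⁆ = 0)
    (hcrit : ∀ Z, D.θ Z = Z → D.act Z p = 0 → ⟪D.act Z ξ, h⟫_ℝ = 0) : ⁅D.e ξ, D.e h⁆ = 0 := by
  have hpA : ⁅D.e p, D.e (D.A ξ)⁆ = 0 := by
    apply D.lie_eq_zero_of_T
    rw [← A_T_comm]
    have : D.T p p ξ = 0 := D.e_injective (by rw [e_T, hpξ]; simp)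
    rw [this, map_zero]
  -- The test element [Aξ, h] stabilizes p because Aξ and h commute with p. The factor `A` turns
  -- ⟨Zξ, h⟩ into the Killing square of [ξ, h].
  have h1 := hcrit ⁅D.e (D.A ξ), D.e h⁆ (D.θ_lie_e _ _) (by
    apply D.e_injective
    rw [D.e_act (D.θ_lie_e _ _), ← lie_skew, leibniz_lie, hpA, hph]; simp)
  refine (D.killingForm_bracket_self ξ h).2 ?_
  rw [act_lie_e, T_A_mid, ← A_T_comm, inner_neg_left, inner_A, e_T, killingForm_lie_left,
    neg_neg] at h1
  exact h1

end RootBounds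

end OrthogonalSymmetric
end SymmetricSpaceOrbit

namespace SymmetricSpaceOrbit

/-! ### Derivatives in the preferred charts of a manifold -/

section Chart

variable {E : Type*} [NormedAddCommGroup E] [NormedSpace ℝ E]
  {G : Type*} [TopologicalSpace G] [ChartedSpace E G]

theorem mfderiv_eq_fderiv_comp_extChartAt_symm {F : Type*} [NormedAddCommGroup F]
    [NormedSpace ℝ F] {x : G} {f : G → F} (hf : MDifferentiableAt 𝓘(ℝ, E) 𝓘(ℝ, F) f x) :
    (mfderiv 𝓘(ℝ, E) 𝓘(ℝ, F) f x : E →L[ℝ] F) =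
      fderiv ℝ (f ∘ (extChartAt 𝓘(ℝ, E) x).symm) (extChartAt 𝓘(ℝ, E) x x) := by
  have h : fderivWithin ℝ (writtenInExtChartAt 𝓘(ℝ, E) 𝓘(ℝ, F) x f) (Set.range 𝓘(ℝ, E))
      (extChartAt 𝓘(ℝ, E) x x) =
      fderiv ℝ (f ∘ (extChartAt 𝓘(ℝ, E) x).symm) (extChartAt 𝓘(ℝ, E) x x) := by
    have h1 : writtenInExtChartAt 𝓘(ℝ, E) 𝓘(ℝ, F) x f = f ∘ (extChartAt 𝓘(ℝ, E) x).symm := by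
      ext u; simp only [writtenInExtChartAt, extChartAt_model_space_eq_id]; rfl
    rw [h1, modelWithCornersSelf_coe, Set.range_id, fderivWithin_univ]
  exact hf.mfderiv.trans h

/-- The tangent space at x is identified with E through this very chart. The base point y is kept
separate so that points only propositionally equal to x can be used. -/
theorem mfderiv_extChartAt_self [IsManifold 𝓘(ℝ, E) 1 G] {x y : G} (h : y = x) :
    (mfderiv 𝓘(ℝ, E) 𝓘(ℝ, E) (extChartAt 𝓘(ℝ, E) x) y : E →L[ℝ] E) =
      ContinuousLinearMap.id ℝ E := by
  subst h
  rw [mfderiv_eq_fderiv_comp_extChartAt_symm (mdifferentiableAt_extChartAt (mem_chart_source E y))]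
  have : (extChartAt 𝓘(ℝ, E) y) ∘ (extChartAt 𝓘(ℝ, E) y).symm
      =ᶠ[nhds (extChartAt 𝓘(ℝ, E) y y)] id := by
    filter_upwards [(isOpen_extChartAt_target (I := 𝓘(ℝ, E)) y).mem_nhds (mem_extChartAt_target y)]
      with u hu
    exact (extChartAt 𝓘(ℝ, E) y).right_inv hu
  rw [this.fderiv_eq, fderiv_id]

theorem mfderiv_eq_fderiv_extChartAt [IsManifold 𝓘(ℝ, E) 1 G] {x : G} {f : G → G} (hx : f x = x)
    (hf : MDifferentiableAt 𝓘(ℝ, E) 𝓘(ℝ, E) f x) :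
    (mfderiv 𝓘(ℝ, E) 𝓘(ℝ, E) f x : E →L[ℝ] E) =
      fderiv ℝ (extChartAt 𝓘(ℝ, E) x ∘ f ∘ (extChartAt 𝓘(ℝ, E) x).symm)
        (extChartAt 𝓘(ℝ, E) x x) := by
  have h1 : MDifferentiableAt 𝓘(ℝ, E) 𝓘(ℝ, E) (extChartAt 𝓘(ℝ, E) x) (f x) := by
    rw [hx]; exact mdifferentiableAt_extChartAt (mem_chart_source E x)
  have h2 := mfderiv_eq_fderiv_comp_extChartAt_symm (h1.comp x hf)
  rw [Function.comp_assoc] at h2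
  rw [← h2, mfderiv_comp x h1 hf]
  have h3 := mfderiv_extChartAt_self (E := E) hx
  ext v
  exact (congrArg (fun A : E →L[ℝ] E => A (mfderiv 𝓘(ℝ, E) 𝓘(ℝ, E) f x v)) h3).symm

end Chart

end SymmetricSpaceOrbit

namespace SymmetricSpaceOrbit

/-! ### The multiplication of a Lie group in the chart at the identity -/

theorem _root_.HasFDerivAt.comp_prodMk_left {E F : Type*} [NormedAddCommGroup E] [NormedSpace ℝ E]
    [NormedAddCommGroup F] [NormedSpace ℝ F] {f : E × E → F} {f' : E × E →L[ℝ] F} {a b : E}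
    (h : HasFDerivAt f f' (a, b)) :
    HasFDerivAt (fun u => f (u, b)) (f'.comp (ContinuousLinearMap.inl ℝ E E)) a :=
  HasFDerivAt.comp (f := fun u : E => (u, b)) a h (hasFDerivAt_prodMk_left a b)

theorem _root_.HasFDerivAt.comp_prodMk_right {E F : Type*} [NormedAddCommGroup E]
    [NormedSpace ℝ E] [NormedAddCommGroup F] [NormedSpace ℝ F] {f : E × E → F}
    {f' : E × E →L[ℝ] F} {a b : E} (h : HasFDerivAt f f' (a, b)) :
    HasFDerivAt (fun u => f (a, u)) (f'.comp (ContinuousLinearMap.inr ℝ E E)) b :=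
  HasFDerivAt.comp (f := fun u : E => (a, u)) b h (hasFDerivAt_prodMk_right a b)

section LieGroupChart

variable (E : Type*) [NormedAddCommGroup E] [NormedSpace ℝ E]
  (G : Type*) [TopologicalSpace G] [ChartedSpace E G] [Group G]

/-- The coordinate of the identity element in the preferred chart there. -/
noncomputable def chartOne : E := extChartAt 𝓘(ℝ, E) (1 : G) 1

/-- The group multiplication in the preferred chart at the identity. -/
noncomputable def chartMul (p : E × E) : E :=
  extChartAt 𝓘(ℝ, E) (1 : G)
    ((extChartAt 𝓘(ℝ, E) (1 : G)).symm p.1 * (extChartAt 𝓘(ℝ, E) (1 : G)).symm p.2)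

theorem extChartAt_symm_chartOne : (extChartAt 𝓘(ℝ, E) (1 : G)).symm (chartOne E G) = 1 :=
  extChartAt_to_inv (I := 𝓘(ℝ, E)) (1 : G)

theorem eventually_chart_target :
    ∀ᶠ u in nhds (chartOne E G), u ∈ (extChartAt 𝓘(ℝ, E) (1 : G)).target :=
  (isOpen_extChartAt_target (I := 𝓘(ℝ, E)) (1 : G)).mem_nhds (mem_extChartAt_target (1 : G))

theorem continuousAt_chart_symm :
    ContinuousAt (extChartAt 𝓘(ℝ, E) (1 : G)).symm (chartOne E G) :=
  continuousAt_extChartAt_symm (I := 𝓘(ℝ, E)) (1 : G)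

theorem eventually_chart_source :
    ∀ᶠ g in nhds (1 : G), g ∈ (extChartAt 𝓘(ℝ, E) (1 : G)).source :=
  (isOpen_extChartAt_source (I := 𝓘(ℝ, E)) (1 : G)).mem_nhds (mem_extChartAt_source (1 : G))

theorem chartMul_one_right :
    ∀ᶠ u in nhds (chartOne E G), chartMul E G (u, chartOne E G) = u := by
  filter_upwards [eventually_chart_target E G] with u hu
  simp only [chartMul, extChartAt_symm_chartOne, mul_one]
  exact PartialEquiv.right_inv _ hu

theorem chartMul_one_left :
    ∀ᶠ u in nhds (chartOne E G), chartMul E G (chartOne E G, u) = u := by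
  filter_upwards [eventually_chart_target E G] with u hu
  simp only [chartMul, extChartAt_symm_chartOne, one_mul]
  exact PartialEquiv.right_inv _ hu

variable [LieGroup 𝓘(ℝ, E) ∞ G]

theorem isManifold_one : IsManifold 𝓘(ℝ, E) 1 G :=
  have : IsManifold 𝓘(ℝ, E) ∞ G := (inferInstance : ContMDiffMul 𝓘(ℝ, E) ∞ G).toIsManifold
  IsManifold.of_le (n := ∞) ENat.LEInfty.out

theorem contDiffAt_chartMul {u v : E} (hu : u ∈ (extChartAt 𝓘(ℝ, E) (1 : G)).target)
    (hv : v ∈ (extChartAt 𝓘(ℝ, E) (1 : G)).target)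
    (huv : (extChartAt 𝓘(ℝ, E) (1 : G)).symm u * (extChartAt 𝓘(ℝ, E) (1 : G)).symm v ∈
      (extChartAt 𝓘(ℝ, E) (1 : G)).source) :
    ContDiffAt ℝ ∞ (chartMul E G) (u, v) := by
  have : IsManifold 𝓘(ℝ, E) ∞ G := (inferInstance : ContMDiffMul 𝓘(ℝ, E) ∞ G).toIsManifold
  rw [← contMDiffAt_iff_contDiffAt]
  have hs : ∀ w ∈ (extChartAt 𝓘(ℝ, E) (1 : G)).target,
      ContMDiffAt 𝓘(ℝ, E) 𝓘(ℝ, E) ∞ (extChartAt 𝓘(ℝ, E) (1 : G)).symm w := fun w hw =>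
    (contMDiffOn_extChartAt_symm (1 : G)).contMDiffAt
      ((isOpen_extChartAt_target (I := 𝓘(ℝ, E)) (1 : G)).mem_nhds hw)
  have h1 : ContMDiffAt 𝓘(ℝ, E × E) 𝓘(ℝ, E) ∞
      (fun p : E × E => (extChartAt 𝓘(ℝ, E) (1 : G)).symm p.1) (u, v) :=
    (hs u hu).comp (u, v) contDiffAt_fst.contMDiffAt
  have h2 : ContMDiffAt 𝓘(ℝ, E × E) 𝓘(ℝ, E) ∞
      (fun p : E × E => (extChartAt 𝓘(ℝ, E) (1 : G)).symm p.2) (u, v) :=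
    (hs v hv).comp (u, v) contDiffAt_snd.contMDiffAt
  have h3 := h1.mul h2
  have h4 : ContMDiffAt 𝓘(ℝ, E) 𝓘(ℝ, E) ∞ (extChartAt 𝓘(ℝ, E) (1 : G))
      ((extChartAt 𝓘(ℝ, E) (1 : G)).symm u * (extChartAt 𝓘(ℝ, E) (1 : G)).symm v) :=
    contMDiffAt_extChartAt' (by rwa [extChartAt_source] at huv)
  exact h4.comp (u, v) h3

theorem eventually_contDiffAt_chartMul_left :
    ∀ᶠ u in nhds (chartOne E G), ContDiffAt ℝ ∞ (chartMul E G) (u, chartOne E G) := by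
  filter_upwards [eventually_chart_target E G] with u hu
  refine contDiffAt_chartMul E G hu (mem_extChartAt_target (1 : G)) ?_
  rw [extChartAt_symm_chartOne, mul_one]
  exact PartialEquiv.map_target _ hu

theorem eventually_contDiffAt_chartMul_right :
    ∀ᶠ u in nhds (chartOne E G), ContDiffAt ℝ ∞ (chartMul E G) (chartOne E G, u) := by
  filter_upwards [eventually_chart_target E G] with u hu
  refine contDiffAt_chartMul E G (mem_extChartAt_target (1 : G)) hu ?_
  rw [extChartAt_symm_chartOne, one_mul]
  exact PartialEquiv.map_target _ hu

theorem contDiffAt_chartMul_one :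
    ContDiffAt ℝ ∞ (chartMul E G) (chartOne E G, chartOne E G) :=
  (eventually_contDiffAt_chartMul_left E G).self_of_nhds

theorem fderiv_chartMul_inr_one (X : E) :
    fderiv ℝ (chartMul E G) (chartOne E G, chartOne E G) (0, X) = X := by
  have h := ((contDiffAt_chartMul_one E G).differentiableAt (by simp)).hasFDerivAt.comp_prodMk_right
  have h2 : HasFDerivAt (fun u : E => u) (ContinuousLinearMap.id ℝ E) (chartOne E G) :=
    hasFDerivAt_id _
  have h3 := h.unique (h2.congr_of_eventuallyEq (chartMul_one_left E G))
  exact congrArg (fun A : E →L[ℝ] E => A X) h3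

theorem fderiv_chartMul_inl_one (X : E) :
    fderiv ℝ (chartMul E G) (chartOne E G, chartOne E G) (X, 0) = X := by
  have h := ((contDiffAt_chartMul_one E G).differentiableAt (by simp)).hasFDerivAt.comp_prodMk_left
  have h2 : HasFDerivAt (fun u : E => u) (ContinuousLinearMap.id ℝ E) (chartOne E G) :=
    hasFDerivAt_id _
  have h3 := h.unique (h2.congr_of_eventuallyEq (chartMul_one_right E G))
  exact congrArg (fun A : E →L[ℝ] E => A X) h3

/-- In the chart, left translation by the point with coordinate u is v ↦ μ(u, v), so a
left-invariant field is the partial derivative of μ in the second variable at the identity. -/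
theorem mpullbackWithin_mulInvariantVectorField {u : E}
    (hu : u ∈ (extChartAt 𝓘(ℝ, E) (1 : G)).target)
    (hd : DifferentiableAt ℝ (chartMul E G) (u, chartOne E G))
    (X : GroupLieAlgebra 𝓘(ℝ, E) G) :
    (VectorField.mpullbackWithin 𝓘(ℝ, E) 𝓘(ℝ, E) (extChartAt 𝓘(ℝ, E) (1 : G)).symm
      (mulInvariantVectorField X) (Set.range 𝓘(ℝ, E)) u : E) =
      fderiv ℝ (chartMul E G) (u, chartOne E G) ((0, X) : E × E) := by
  have := isManifold_one E G
  set g := (extChartAt 𝓘(ℝ, E) (1 : G)).symm u with hg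
  have hgs : g ∈ (chartAt E (1 : G)).source := by
    rw [← extChartAt_source 𝓘(ℝ, E)]; exact PartialEquiv.map_target _ hu
  have h1 := ContinuousLinearMap.inverse_eq
    (mfderivWithin_extChartAt_symm_comp_mfderiv_extChartAt (I := 𝓘(ℝ, E)) (x := (1 : G)) hu)
    (mfderiv_extChartAt_comp_mfderivWithin_extChartAt_symm (I := 𝓘(ℝ, E)) (x := (1 : G)) hu)
  have h2 : ∀ g', g' = g →
      (mfderiv 𝓘(ℝ, E) 𝓘(ℝ, E) (extChartAt 𝓘(ℝ, E) (1 : G)) g' : E →L[ℝ] E) =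
      mfderiv 𝓘(ℝ, E) 𝓘(ℝ, E) (extChartAt 𝓘(ℝ, E) (1 : G)) g := by
    rintro _ rfl; rfl
  have hm : MDifferentiableAt 𝓘(ℝ, E) 𝓘(ℝ, E) (fun x : G => g * x) 1 :=
    (contMDiff_mul_left (I := 𝓘(ℝ, E)) (n := ∞)).contMDiffAt.mdifferentiableAt (by simp)
  have hc : MDifferentiableAt 𝓘(ℝ, E) 𝓘(ℝ, E) (extChartAt 𝓘(ℝ, E) (1 : G)) (g * 1) := by
    rw [mul_one]; exact mdifferentiableAt_extChartAt hgs
  have h3 := mfderiv_comp (1 : G) hc hm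
  have h4 := mfderiv_eq_fderiv_comp_extChartAt_symm (hc.comp (1 : G) hm)
  have h5 : (extChartAt 𝓘(ℝ, E) (1 : G) ∘ fun x : G => g * x) ∘
      (extChartAt 𝓘(ℝ, E) (1 : G)).symm = fun v => chartMul E G (u, v) := rfl
  have h6 := hd.hasFDerivAt.comp_prodMk_right
  have h7 : fderiv ℝ (fun v => chartMul E G (u, v)) (chartOne E G) =
    (fderiv ℝ (chartMul E G) (u, chartOne E G)).comp (ContinuousLinearMap.inr ℝ E E) := h6.fderiv
  rw [h5] at h4
  have e1 : (VectorField.mpullbackWithin 𝓘(ℝ, E) 𝓘(ℝ, E) (extChartAt 𝓘(ℝ, E) (1 : G)).symm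
      (mulInvariantVectorField X) (Set.range 𝓘(ℝ, E)) u : E) =
      (mfderiv 𝓘(ℝ, E) 𝓘(ℝ, E) (extChartAt 𝓘(ℝ, E) (1 : G)) g : E →L[ℝ] E)
        (mulInvariantVectorField X g : E) :=
    congrArg (fun A : E →L[ℝ] E => A (mulInvariantVectorField X g : E)) h1
  have e2 : (mfderiv 𝓘(ℝ, E) 𝓘(ℝ, E) (extChartAt 𝓘(ℝ, E) (1 : G)) g : E →L[ℝ] E)
        (mulInvariantVectorField X g : E) =
      (mfderiv 𝓘(ℝ, E) 𝓘(ℝ, E) (extChartAt 𝓘(ℝ, E) (1 : G)) (g * 1) : E →L[ℝ] E)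
        (mulInvariantVectorField X g : E) :=
    congrArg (fun A : E →L[ℝ] E => A (mulInvariantVectorField X g : E)) (h2 _ (mul_one g)).symm
  have e3 : (mfderiv 𝓘(ℝ, E) 𝓘(ℝ, E) (extChartAt 𝓘(ℝ, E) (1 : G)) (g * 1) : E →L[ℝ] E)
        (mulInvariantVectorField X g : E) =
      (mfderiv 𝓘(ℝ, E) 𝓘(ℝ, E) (extChartAt 𝓘(ℝ, E) (1 : G) ∘ fun x : G => g * x) 1 :
          E →L[ℝ] E) X :=
    congrArg (fun A : E →L[ℝ] E => A X) h3.symm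
  have e4 : (mfderiv 𝓘(ℝ, E) 𝓘(ℝ, E) (extChartAt 𝓘(ℝ, E) (1 : G) ∘ fun x : G => g * x) 1 :
          E →L[ℝ] E) X = fderiv ℝ (fun v => chartMul E G (u, v)) (chartOne E G) X :=
    congrArg (fun A : E →L[ℝ] E => A X) h4
  exact e1.trans (e2.trans (e3.trans (e4.trans (congrArg (fun A : E →L[ℝ] E => A X) h7))))

/-- The bracket of the fields u ↦ ∂₂μ(u, 1)X and u ↦ ∂₂μ(u, 1)Y at the identity, where ∂₂μ is the
identity map, leaves the antisymmetrized mixed second derivative of μ. -/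
theorem bracket_eq_fderiv_chartMul (X Y : GroupLieAlgebra 𝓘(ℝ, E) G) :
    (⁅X, Y⁆ : GroupLieAlgebra 𝓘(ℝ, E) G) =
      (fderiv ℝ (fderiv ℝ (chartMul E G)) (chartOne E G, chartOne E G) ((X, 0) : E × E)
          ((0, Y) : E × E) -
        fderiv ℝ (fderiv ℝ (chartMul E G)) (chartOne E G, chartOne E G) ((Y, 0) : E × E)
          ((0, X) : E × E) : E) := by
  have := isManifold_one E G
  set u₀ := chartOne E G with hu₀
  have hfield : ∀ Z : E, (fun u => (VectorField.mpullbackWithin 𝓘(ℝ, E) 𝓘(ℝ, E)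
      (extChartAt 𝓘(ℝ, E) (1 : G)).symm (mulInvariantVectorField (I := 𝓘(ℝ, E)) (G := G) Z)
      (Set.range 𝓘(ℝ, E)) u : E)) =ᶠ[nhds u₀]
      fun u => fderiv ℝ (chartMul E G) (u, u₀) ((0, Z) : E × E) := by
    intro Z
    filter_upwards [eventually_chart_target E G, eventually_contDiffAt_chartMul_left E G]
      with u hu hd
    exact mpullbackWithin_mulInvariantVectorField E G hu (hd.differentiableAt (by simp)) Z
  have hD : DifferentiableAt ℝ (fderiv ℝ (chartMul E G)) (u₀, u₀) :=
    ((contDiffAt_chartMul_one E G).fderiv_right (m := 1)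
      (by norm_num; exact ENat.LEInfty.out)).differentiableAt
      (by simp)
  have hder : ∀ Z W : E, fderiv ℝ (fun u => fderiv ℝ (chartMul E G) (u, u₀) ((0, Z) : E × E)) u₀ W
      = fderiv ℝ (fderiv ℝ (chartMul E G)) (u₀, u₀) (W, 0) (0, Z) := by
    intro Z W
    have h1 := hD.hasFDerivAt.comp_prodMk_left
    have h2 := h1.clm_apply (hasFDerivAt_const ((0, Z) : E × E) u₀)
    rw [h2.fderiv]
    simp
  have hbr : ∀ X Y : E, VectorField.lieBracket ℝ
      (fun u => (VectorField.mpullbackWithin 𝓘(ℝ, E) 𝓘(ℝ, E)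
        (extChartAt 𝓘(ℝ, E) (1 : G)).symm (mulInvariantVectorField (I := 𝓘(ℝ, E)) (G := G) X)
        (Set.range 𝓘(ℝ, E)) u : E))
      (fun u => (VectorField.mpullbackWithin 𝓘(ℝ, E) 𝓘(ℝ, E)
        (extChartAt 𝓘(ℝ, E) (1 : G)).symm (mulInvariantVectorField (I := 𝓘(ℝ, E)) (G := G) Y)
        (Set.range 𝓘(ℝ, E)) u : E)) u₀ =
      fderiv ℝ (fderiv ℝ (chartMul E G)) (u₀, u₀) ((X, 0) : E × E) ((0, Y) : E × E) -
        fderiv ℝ (fderiv ℝ (chartMul E G)) (u₀, u₀) ((Y, 0) : E × E) ((0, X) : E × E) := by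
    intro X Y
    rw [Filter.EventuallyEq.lieBracket_vectorField_eq (hfield X) (hfield Y)]
    rw [VectorField.lieBracket, hder, hder, fderiv_chartMul_inr_one, fderiv_chartMul_inr_one]
  rw [← hbr X Y, GroupLieAlgebra.bracket_def, VectorField.mlieBracket,
    VectorField.mlieBracketWithin_apply]
  have h0 : (mfderiv 𝓘(ℝ, E) 𝓘(ℝ, E) (extChartAt 𝓘(ℝ, E) (1 : G)) 1 : E →L[ℝ] E).inverse =
      ContinuousLinearMap.id ℝ E := by
    rw [mfderiv_extChartAt_self rfl]; exact ContinuousLinearMap.inverse_id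
  have h1 : (extChartAt 𝓘(ℝ, E) (1 : G)).symm ⁻¹' Set.univ ∩ Set.range 𝓘(ℝ, E) = Set.univ := by
    simp
  have h2 : ∀ V W : E → E, VectorField.lieBracketWithin ℝ V W
      ((extChartAt 𝓘(ℝ, E) (1 : G)).symm ⁻¹' Set.univ ∩ Set.range 𝓘(ℝ, E)) u₀ =
      VectorField.lieBracket ℝ V W u₀ := by
    intro V W; rw [h1, VectorField.lieBracketWithin_univ]
  exact (congrArg (fun A : E →L[ℝ] E => A _) h0).trans (h2 _ _)

end LieGroupChart

end SymmetricSpaceOrbit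

namespace SymmetricSpaceOrbit

/-! ### Differentials of automorphisms -/

section Adjoint

variable {E : Type*} [NormedAddCommGroup E] [NormedSpace ℝ E]
  {G : Type*} [TopologicalSpace G] [ChartedSpace E G] [Group G]

section Automorphism

set_option linter.unusedSectionVars false

variable [LieGroup 𝓘(ℝ, E) ∞ G] {f f' : G →* G}

theorem mfderiv_comp_apply_one (hf : ContMDiff 𝓘(ℝ, E) 𝓘(ℝ, E) ∞ f)
    (hf' : ContMDiff 𝓘(ℝ, E) 𝓘(ℝ, E) ∞ f') (X : E) :
    (mfderiv 𝓘(ℝ, E) 𝓘(ℝ, E) (f ∘ f') 1 : E →L[ℝ] E) X =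
      (mfderiv 𝓘(ℝ, E) 𝓘(ℝ, E) f 1 : E →L[ℝ] E)
        ((mfderiv 𝓘(ℝ, E) 𝓘(ℝ, E) f' 1 : E →L[ℝ] E) X) := by
  have h1 := mfderiv_comp (1 : G) (hf.contMDiffAt.mdifferentiableAt (by simp))
    (hf'.contMDiffAt.mdifferentiableAt (x := (1 : G)) (by simp))
  have h2 : ∀ g : G, g = 1 → (mfderiv 𝓘(ℝ, E) 𝓘(ℝ, E) f g : E →L[ℝ] E) =
      mfderiv 𝓘(ℝ, E) 𝓘(ℝ, E) f 1 := by rintro _ rfl; rfl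
  exact (congrArg (fun A : E →L[ℝ] E => A X) h1).trans
    (congrArg (fun A : E →L[ℝ] E => A ((mfderiv 𝓘(ℝ, E) 𝓘(ℝ, E) f' 1 : E →L[ℝ] E) X))
      (h2 _ (map_one f')))

/-- The differential of an endomorphism maps invariant vector fields to invariant vector fields. -/
theorem mfderiv_mulInvariantVectorField (hf : ContMDiff 𝓘(ℝ, E) 𝓘(ℝ, E) ∞ f) (g : G) (X : E) :
    (mfderiv 𝓘(ℝ, E) 𝓘(ℝ, E) f g : E →L[ℝ] E)
        (mulInvariantVectorField (I := 𝓘(ℝ, E)) (G := G) X g : E) =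
      (mulInvariantVectorField (I := 𝓘(ℝ, E)) (G := G)
        ((mfderiv 𝓘(ℝ, E) 𝓘(ℝ, E) f 1 : E →L[ℝ] E) X) (f g) : E) := by
  have hm : ∀ g h : G, MDifferentiableAt 𝓘(ℝ, E) 𝓘(ℝ, E) (fun x : G => g * x) h := fun g h =>
    (contMDiff_mul_left (I := 𝓘(ℝ, E)) (n := ∞)).contMDiffAt.mdifferentiableAt (by simp)
  have hfd : ∀ g : G, MDifferentiableAt 𝓘(ℝ, E) 𝓘(ℝ, E) f g := fun g =>
    hf.contMDiffAt.mdifferentiableAt (by simp)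
  have h1 := mfderiv_comp (1 : G) (hfd (g * 1)) (hm g 1)
  have h2 := mfderiv_comp (1 : G) (hm (f g) (f 1)) (hfd 1)
  have h3 : (f ∘ fun x : G => g * x) = (fun x : G => f g * x) ∘ f := by
    ext x; simp
  have h4 : ∀ g', g' = g → (mfderiv 𝓘(ℝ, E) 𝓘(ℝ, E) f g' : E →L[ℝ] E) =
      mfderiv 𝓘(ℝ, E) 𝓘(ℝ, E) f g := by rintro _ rfl; rfl
  have h5 : ∀ g' : G, g' = 1 →
      (mfderiv 𝓘(ℝ, E) 𝓘(ℝ, E) (fun x : G => f g * x) g' : E →L[ℝ] E) =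
      mfderiv 𝓘(ℝ, E) 𝓘(ℝ, E) (fun x : G => f g * x) 1 := by rintro _ rfl; rfl
  have h6 : (mfderiv 𝓘(ℝ, E) 𝓘(ℝ, E) (f ∘ fun x : G => g * x) 1 : E →L[ℝ] E) =
      mfderiv 𝓘(ℝ, E) 𝓘(ℝ, E) ((fun x : G => f g * x) ∘ f) 1 := by rw [h3]
  have e1 : (mfderiv 𝓘(ℝ, E) 𝓘(ℝ, E) (f ∘ fun x : G => g * x) 1 : E →L[ℝ] E) X =
      (mfderiv 𝓘(ℝ, E) 𝓘(ℝ, E) f (g * 1) : E →L[ℝ] E)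
        ((mfderiv 𝓘(ℝ, E) 𝓘(ℝ, E) (fun x : G => g * x) 1 : E →L[ℝ] E) X) :=
    congrArg (fun A : E →L[ℝ] E => A X) h1
  have e2 : (mfderiv 𝓘(ℝ, E) 𝓘(ℝ, E) ((fun x : G => f g * x) ∘ f) 1 : E →L[ℝ] E) X =
      (mfderiv 𝓘(ℝ, E) 𝓘(ℝ, E) (fun x : G => f g * x) (f 1) : E →L[ℝ] E)
        ((mfderiv 𝓘(ℝ, E) 𝓘(ℝ, E) f 1 : E →L[ℝ] E) X) :=
    congrArg (fun A : E →L[ℝ] E => A X) h2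
  have e3 := congrArg (fun A : E →L[ℝ] E =>
    A ((mfderiv 𝓘(ℝ, E) 𝓘(ℝ, E) (fun x : G => g * x) 1 : E →L[ℝ] E) X)) (h4 _ (mul_one g))
  have e4 := congrArg (fun A : E →L[ℝ] E =>
    A ((mfderiv 𝓘(ℝ, E) 𝓘(ℝ, E) f 1 : E →L[ℝ] E) X)) (h5 _ (map_one f))
  exact e3.symm.trans (e1.symm.trans ((congrArg (fun A : E →L[ℝ] E => A X) h6).trans
    (e2.trans e4)))

theorem mfderiv_inverse (hf : ContMDiff 𝓘(ℝ, E) 𝓘(ℝ, E) ∞ f)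
    (hf' : ContMDiff 𝓘(ℝ, E) 𝓘(ℝ, E) ∞ f') (h : ∀ x, f' (f x) = x) (h' : ∀ x, f (f' x) = x)
    (g : G) :
    ∃ B : E →L[ℝ] E, B.comp (mfderiv 𝓘(ℝ, E) 𝓘(ℝ, E) f g : E →L[ℝ] E) = .id ℝ E ∧
      (mfderiv 𝓘(ℝ, E) 𝓘(ℝ, E) f g : E →L[ℝ] E).comp B = .id ℝ E := by
  have hd : ∀ g : G, MDifferentiableAt 𝓘(ℝ, E) 𝓘(ℝ, E) f g := fun g =>
    hf.contMDiffAt.mdifferentiableAt (by simp)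
  have hd' : ∀ g : G, MDifferentiableAt 𝓘(ℝ, E) 𝓘(ℝ, E) f' g := fun g =>
    hf'.contMDiffAt.mdifferentiableAt (by simp)
  have h1 := mfderiv_comp g (hd' (f g)) (hd g)
  have h2 := mfderiv_comp (f g) (hd (f' (f g))) (hd' (f g))
  have h3 : f' ∘ f = id := funext h
  have h4 : f ∘ f' = id := funext h'
  have h5 : ∀ g', g' = g → (mfderiv 𝓘(ℝ, E) 𝓘(ℝ, E) f g' : E →L[ℝ] E) =
      mfderiv 𝓘(ℝ, E) 𝓘(ℝ, E) f g := by rintro _ rfl; rfl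
  have h6 : (mfderiv 𝓘(ℝ, E) 𝓘(ℝ, E) (f' ∘ f) g : E →L[ℝ] E) = .id ℝ E := by
    rw [h3]; exact mfderiv_id
  have h7 : (mfderiv 𝓘(ℝ, E) 𝓘(ℝ, E) (f ∘ f') (f g) : E →L[ℝ] E) = .id ℝ E := by
    rw [h4]; exact mfderiv_id
  refine ⟨mfderiv 𝓘(ℝ, E) 𝓘(ℝ, E) f' (f g), h1.symm.trans h6, ?_⟩
  rw [← h5 _ (h g)]
  exact h2.symm.trans h7

theorem mpullback_mulInvariantVectorField_automorphism (hf : ContMDiff 𝓘(ℝ, E) 𝓘(ℝ, E) ∞ f)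
    (hf' : ContMDiff 𝓘(ℝ, E) 𝓘(ℝ, E) ∞ f') (h : ∀ x, f' (f x) = x) (h' : ∀ x, f (f' x) = x)
    (X : E) :
    VectorField.mpullback 𝓘(ℝ, E) 𝓘(ℝ, E) f (mulInvariantVectorField (I := 𝓘(ℝ, E)) (G := G)
      ((mfderiv 𝓘(ℝ, E) 𝓘(ℝ, E) f 1 : E →L[ℝ] E) X)) =
      mulInvariantVectorField (I := 𝓘(ℝ, E)) (G := G) X := by
  ext g
  obtain ⟨B, h1, h2⟩ := mfderiv_inverse hf hf' h h' g
  have h3 : (mfderiv 𝓘(ℝ, E) 𝓘(ℝ, E) f g : E →L[ℝ] E).inverse = B :=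
    ContinuousLinearMap.inverse_eq h2 h1
  have h4 := mfderiv_mulInvariantVectorField hf g X
  refine (congrArg (fun A : E →L[ℝ] E => A (mulInvariantVectorField (I := 𝓘(ℝ, E)) (G := G)
      ((mfderiv 𝓘(ℝ, E) 𝓘(ℝ, E) f 1 : E →L[ℝ] E) X) (f g) : E)) h3).trans ?_
  refine (congrArg B h4.symm).trans ?_
  exact congrArg (fun A : E →L[ℝ] E => A (mulInvariantVectorField (I := 𝓘(ℝ, E)) (G := G) X g : E))
    h1

variable [FiniteDimensional ℝ E]

/-- The differential of an automorphism preserves the Lie bracket. -/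
theorem mfderiv_lie (hf : ContMDiff 𝓘(ℝ, E) 𝓘(ℝ, E) ∞ f)
    (hf' : ContMDiff 𝓘(ℝ, E) 𝓘(ℝ, E) ∞ f') (h : ∀ x, f' (f x) = x) (h' : ∀ x, f (f' x) = x)
    (F : GroupLieAlgebra 𝓘(ℝ, E) G →L[ℝ] GroupLieAlgebra 𝓘(ℝ, E) G)
    (hF : F = (mfderiv 𝓘(ℝ, E) 𝓘(ℝ, E) f 1 : E →L[ℝ] E))
    (X Y : GroupLieAlgebra 𝓘(ℝ, E) G) :
    F ⁅X, Y⁆ = ⁅F X, F Y⁆ := by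
  obtain ⟨B, h1, h2⟩ := mfderiv_inverse hf hf' h h' 1
  rw [← hF] at h1 h2
  have hX := mpullback_mulInvariantVectorField_automorphism hf hf' h h' X
  have hY := mpullback_mulInvariantVectorField_automorphism hf hf' h h' Y
  rw [← hF] at hX hY
  have hp := VectorField.mpullback_mlieBracket (I := 𝓘(ℝ, E)) (I' := 𝓘(ℝ, E)) (n := ∞) (f := f)
    (x₀ := (1 : G)) (mdifferentiableAt_mulInvariantVectorField (I := 𝓘(ℝ, E)) (F X))
    (mdifferentiableAt_mulInvariantVectorField (I := 𝓘(ℝ, E)) (F Y)) hf.contMDiffAt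
    (by rw [minSmoothness_of_isRCLikeNormedField]; exact ENat.LEInfty.out)
  have hX' : VectorField.mpullback 𝓘(ℝ, E) 𝓘(ℝ, E) f (mulInvariantVectorField (F X)) =
      mulInvariantVectorField X := hX
  have hY' : VectorField.mpullback 𝓘(ℝ, E) 𝓘(ℝ, E) f (mulInvariantVectorField (F Y)) =
      mulInvariantVectorField Y := hY
  rw [hX', hY', ← GroupLieAlgebra.bracket_def] at hp
  have h3 : (mfderiv 𝓘(ℝ, E) 𝓘(ℝ, E) f 1 : E →L[ℝ] E).inverse = B := by
    rw [← hF]; exact ContinuousLinearMap.inverse_eq h2 h1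
  have h4 : ∀ g : G, g = 1 → (VectorField.mlieBracket 𝓘(ℝ, E) (mulInvariantVectorField (F X))
      (mulInvariantVectorField (F Y)) g : E) = (⁅F X, F Y⁆ : GroupLieAlgebra 𝓘(ℝ, E) G) := by
    rintro _ rfl; rfl
  have h5 : (B (⁅F X, F Y⁆ : GroupLieAlgebra 𝓘(ℝ, E) G) : E) =
      (⁅X, Y⁆ : GroupLieAlgebra 𝓘(ℝ, E) G) := by
    refine Eq.trans ?_ hp
    refine (congrArg B (h4 (f 1) (map_one f)).symm).trans ?_
    exact (congrArg (fun A : E →L[ℝ] E => A _) h3).symm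
  have h6 : (F (B (⁅F X, F Y⁆ : GroupLieAlgebra 𝓘(ℝ, E) G)) : E) =
      (⁅F X, F Y⁆ : GroupLieAlgebra 𝓘(ℝ, E) G) :=
    congrArg (fun A : E →L[ℝ] E => A (⁅F X, F Y⁆ : GroupLieAlgebra 𝓘(ℝ, E) G)) h2
  exact (congrArg F h5).symm.trans h6

end Automorphism

end Adjoint

end SymmetricSpaceOrbit

namespace SymmetricSpaceOrbit

/-! ### The adjoint representation and its differential -/

section Adjoint

set_option linter.unusedSectionVars false

variable {E : Type*} [NormedAddCommGroup E] [NormedSpace ℝ E]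
  {G : Type*} [TopologicalSpace G] [ChartedSpace E G] [Group G] [LieGroup 𝓘(ℝ, E) ∞ G]

theorem contMDiff_conj (g : G) :
    ContMDiff 𝓘(ℝ, E) 𝓘(ℝ, E) ∞ (MulAut.conj g).toMonoidHom := by
  have h : ContMDiff 𝓘(ℝ, E) 𝓘(ℝ, E) ∞ (fun x : G => g * x * g⁻¹) :=
    (contMDiff_const.mul contMDiff_id).mul contMDiff_const
  exact h

theorem Ad_mul_apply (g h : G) (X : GroupLieAlgebra 𝓘(ℝ, E) G) :
    Ad (g * h) X = Ad g (Ad h X) := by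
  have h1 := mfderiv_comp_apply_one (contMDiff_conj (E := E) g) (contMDiff_conj (E := E) h) X
  have h2 : (MulAut.conj g).toMonoidHom ∘ (MulAut.conj h).toMonoidHom =
      fun x : G => (g * h) * x * (g * h)⁻¹ := by
    ext x; simp [mul_assoc]
  have h3 : (mfderiv 𝓘(ℝ, E) 𝓘(ℝ, E)
      ((MulAut.conj g).toMonoidHom ∘ (MulAut.conj h).toMonoidHom) 1 : E →L[ℝ] E) =
      mfderiv 𝓘(ℝ, E) 𝓘(ℝ, E) (fun x : G => (g * h) * x * (g * h)⁻¹) 1 := by rw [h2]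
  exact (congrArg (fun A : E →L[ℝ] E => A X) h3).symm.trans h1

theorem Ad_one_apply (X : GroupLieAlgebra 𝓘(ℝ, E) G) : Ad (1 : G) X = X := by
  have h2 : (fun x : G => 1 * x * 1⁻¹) = id := by ext x; simp
  have h3 : (mfderiv 𝓘(ℝ, E) 𝓘(ℝ, E) (fun x : G => 1 * x * 1⁻¹) 1 : E →L[ℝ] E) =
      .id ℝ E := by rw [h2]; exact mfderiv_id
  exact congrArg (fun A : E →L[ℝ] E => A X) h3

theorem Ad_lie [FiniteDimensional ℝ E] (g : G) (X Y : GroupLieAlgebra 𝓘(ℝ, E) G) :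
    Ad g ⁅X, Y⁆ = ⁅Ad g X, Ad g Y⁆ :=
  mfderiv_lie (contMDiff_conj g) (contMDiff_conj g⁻¹) (by intro x; simp [mul_assoc])
    (by intro x; simp [mul_assoc]) (Ad g) rfl X Y

namespace RiemannianSymmetricPair

variable (S : RiemannianSymmetricPair E G)

theorem dσ_dσ (X : GroupLieAlgebra 𝓘(ℝ, E) G) : S.dσ (S.dσ X) = X := by
  have h1 := mfderiv_comp_apply_one S.smooth_σ S.smooth_σ X
  have h2 : S.σ ∘ S.σ = id := funext S.involutive_σ
  have h3 : (mfderiv 𝓘(ℝ, E) 𝓘(ℝ, E) (S.σ ∘ S.σ) 1 : E →L[ℝ] E) = .id ℝ E := by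
    rw [h2]; exact mfderiv_id
  exact h1.symm.trans (congrArg (fun A : E →L[ℝ] E => A X) h3)

theorem dσ_lie [FiniteDimensional ℝ E] (X Y : GroupLieAlgebra 𝓘(ℝ, E) G) :
    S.dσ ⁅X, Y⁆ = ⁅S.dσ X, S.dσ Y⁆ :=
  mfderiv_lie S.smooth_σ S.smooth_σ S.involutive_σ S.involutive_σ S.dσ rfl X Y

theorem dσ_Ad {k : G} (hk : S.σ k = k) (X : GroupLieAlgebra 𝓘(ℝ, E) G) :
    S.dσ (Ad k X) = Ad k (S.dσ X) := by
  have h1 := mfderiv_comp_apply_one S.smooth_σ (contMDiff_conj k) X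
  have h2 := mfderiv_comp_apply_one (contMDiff_conj k) S.smooth_σ X
  have h3 : S.σ ∘ (MulAut.conj k).toMonoidHom = (MulAut.conj k).toMonoidHom ∘ S.σ := by
    ext x; simp [hk]
  have h4 : (mfderiv 𝓘(ℝ, E) 𝓘(ℝ, E) (S.σ ∘ (MulAut.conj k).toMonoidHom) 1 : E →L[ℝ] E) =
      mfderiv 𝓘(ℝ, E) 𝓘(ℝ, E) ((MulAut.conj k).toMonoidHom ∘ S.σ) 1 := by rw [h3]
  exact h1.symm.trans ((congrArg (fun A : E →L[ℝ] E => A X) h4).trans h2)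

end RiemannianSymmetricPair

/-- The adjoint action as an endomorphism of the model space, for use in calculus. -/
noncomputable def AdModel (g : G) : E →L[ℝ] E := Ad (E := E) g

theorem AdModel_mul (g h : G) : (AdModel (g * h) : E →L[ℝ] E) = (AdModel g).comp (AdModel h) :=
  ContinuousLinearMap.ext fun X => Ad_mul_apply g h X

theorem AdModel_one : (AdModel (1 : G) : E →L[ℝ] E) = .id ℝ E :=
  ContinuousLinearMap.ext fun X => Ad_one_apply X

-- Differentiate gx = (gxg⁻¹)g at x = 1. The identity determines Ad g near 1 from the first
-- derivatives of the multiplication alone.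
variable (E G) in
theorem eventually_fderiv_chartMul_Ad :
    ∀ᶠ u in nhds (chartOne E G), ∀ X : E,
      fderiv ℝ (chartMul E G) (u, chartOne E G) (0, X) =
        fderiv ℝ (chartMul E G) (chartOne E G, u)
          ((AdModel ((extChartAt 𝓘(ℝ, E) (1 : G)).symm u) : E →L[ℝ] E) X, 0) := by
  have := isManifold_one E G
  filter_upwards [eventually_contDiffAt_chartMul_left E G,
    eventually_contDiffAt_chartMul_right E G] with u hl hr X
  set φ := extChartAt 𝓘(ℝ, E) (1 : G) with hφ
  set u₀ := chartOne E G with hu₀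
  set g := φ.symm u with hg
  have hconj1 : g * 1 * g⁻¹ = 1 := by simp
  have hmd : MDifferentiableAt 𝓘(ℝ, E) 𝓘(ℝ, E) (fun x : G => g * x * g⁻¹) 1 :=
    (contMDiff_conj g).contMDiffAt.mdifferentiableAt (by simp)
  have h1 := mfderiv_eq_fderiv_extChartAt (E := E) (f := fun x : G => g * x * g⁻¹) hconj1 hmd
  have hfd : DifferentiableAt ℝ (φ ∘ (fun x : G => g * x * g⁻¹) ∘ φ.symm) u₀ := by
    rw [← mdifferentiableAt_iff_differentiableAt]
    have h2 : MDifferentiableAt 𝓘(ℝ, E) 𝓘(ℝ, E) φ.symm u₀ := by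
      have := (mdifferentiableWithinAt_extChartAt_symm (I := 𝓘(ℝ, E))
        (mem_extChartAt_target (I := 𝓘(ℝ, E)) (1 : G)))
      rwa [modelWithCornersSelf_coe, Set.range_id, mdifferentiableWithinAt_univ] at this
    have h3 : MDifferentiableAt 𝓘(ℝ, E) 𝓘(ℝ, E) (fun x : G => g * x * g⁻¹) (φ.symm u₀) := by
      rw [hu₀, hφ, extChartAt_symm_chartOne]; exact hmd
    have h4 : MDifferentiableAt 𝓘(ℝ, E) 𝓘(ℝ, E) φ (g * φ.symm u₀ * g⁻¹) := by
      rw [hu₀, hφ, extChartAt_symm_chartOne, hconj1]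
      exact mdifferentiableAt_extChartAt (mem_chart_source E (1 : G))
    exact h4.comp u₀ (h3.comp u₀ h2)
  have hval : (φ ∘ (fun x : G => g * x * g⁻¹) ∘ φ.symm) u₀ = u₀ := by
    simp only [Function.comp_apply, hu₀, hφ, extChartAt_symm_chartOne]
    rw [hconj1]; rfl
  have hA : HasFDerivAt (φ ∘ (fun x : G => g * x * g⁻¹) ∘ φ.symm)
      (AdModel g : E →L[ℝ] E) u₀ := by
    have h2 : fderiv ℝ (φ ∘ (fun x : G => g * x * g⁻¹) ∘ φ.symm) u₀ = AdModel g := h1.symm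
    rw [← h2]
    exact hfd.hasFDerivAt
  have e1 := (hl.differentiableAt (by simp)).hasFDerivAt.comp_prodMk_right
  have e2 : HasFDerivAt (fun w => chartMul E G (w, u))
      ((fderiv ℝ (chartMul E G) (u₀, u)).comp (ContinuousLinearMap.inl ℝ E E))
      ((φ ∘ (fun x : G => g * x * g⁻¹) ∘ φ.symm) u₀) := by
    rw [hval]
    exact (hr.differentiableAt (by simp)).hasFDerivAt.comp_prodMk_left
  have e3 := e2.comp u₀ hA
  have e4 : (fun v => chartMul E G (u, v)) =ᶠ[nhds u₀]
      ((fun w => chartMul E G (w, u)) ∘ (φ ∘ (fun x : G => g * x * g⁻¹) ∘ φ.symm)) := by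
    have hc : ContinuousAt (fun v => g * φ.symm v * g⁻¹) u₀ := by
      have : IsTopologicalGroup G := topologicalGroup_of_lieGroup 𝓘(ℝ, E) ∞
      exact (continuousAt_const.mul (continuousAt_chart_symm E G)).mul continuousAt_const
    have hs := hc.eventually (p := fun x => x ∈ φ.source) (by
      simp only [hu₀, hφ, extChartAt_symm_chartOne, hconj1]; exact eventually_chart_source E G)
    filter_upwards [hs] with v hv
    simp only [Function.comp_apply, chartMul, ← hφ]
    rw [φ.left_inv hv, ← hg]
    simp
  have e5 := e1.unique (e3.congr_of_eventuallyEq e4)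
  exact congrArg (fun A : E →L[ℝ] E => A X) e5

-- This is d Ad = ad at the identity. From P(u) ∘ Ad = Q(u), with P invertible near the identity, Ad
-- = P⁻¹Q is differentiable. Differentiating the identity and using symmetry of the second
-- derivative gives the chart formula for the bracket.
variable (E G) in
theorem exists_hasFDerivAt_AdModel [FiniteDimensional ℝ E] :
    ∃ A' : E →L[ℝ] E →L[ℝ] E,
      HasFDerivAt (fun u => (AdModel ((extChartAt 𝓘(ℝ, E) (1 : G)).symm u) : E →L[ℝ] E)) A'
        (chartOne E G) ∧
      ∀ Z X : GroupLieAlgebra 𝓘(ℝ, E) G, A' Z X = ⁅Z, X⁆ := by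
  set u₀ := chartOne E G with hu₀
  set A := fun u => (AdModel ((extChartAt 𝓘(ℝ, E) (1 : G)).symm u) : E →L[ℝ] E) with hA
  set P := fun u => (fderiv ℝ (chartMul E G) (u₀, u)).comp (ContinuousLinearMap.inl ℝ E E) with hP
  set Q := fun u => (fderiv ℝ (chartMul E G) (u, u₀)).comp (ContinuousLinearMap.inr ℝ E E) with hQ
  have hPQ : ∀ᶠ u in nhds u₀, (P u).comp (A u) = Q u := by
    filter_upwards [eventually_fderiv_chartMul_Ad E G] with u hu
    ext X
    exact (hu X).symm
  have hP0 : P u₀ = .id ℝ E := by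
    ext X; exact fderiv_chartMul_inl_one E G X
  have hD : HasFDerivAt (fderiv ℝ (chartMul E G))
      (fderiv ℝ (fderiv ℝ (chartMul E G)) (u₀, u₀)) (u₀, u₀) :=
    (((contDiffAt_chartMul_one E G).fderiv_right (m := 1)
      (by norm_num; exact ENat.LEInfty.out)).differentiableAt (by simp)).hasFDerivAt
  set D2 := fderiv ℝ (fderiv ℝ (chartMul E G)) (u₀, u₀) with hD2
  have hP' := hD.comp_prodMk_right.clm_comp
    (hasFDerivAt_const (ContinuousLinearMap.inl ℝ E E) u₀)
  have hQ' := hD.comp_prodMk_left.clm_comp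
    (hasFDerivAt_const (ContinuousLinearMap.inr ℝ E E) u₀)
  have hA0 : A u₀ = .id ℝ E := by
    simp only [hA, hu₀, extChartAt_symm_chartOne, AdModel_one]
  have hPinv : DifferentiableAt ℝ (fun u => (P u).inverse) u₀ := by
    have h1 : DifferentiableAt ℝ (fun B : E →L[ℝ] E => B.inverse) (P u₀) := by
      rw [hP0]
      exact (contDiffAt_map_inverse (𝕜 := ℝ) (n := 1)
        (ContinuousLinearEquiv.refl ℝ E)).differentiableAt (by simp)
    exact h1.comp u₀ hP'.differentiableAt
  have hAd : DifferentiableAt ℝ A u₀ := by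
    have h1 : DifferentiableAt ℝ (fun u => ((P u).inverse).comp (Q u)) u₀ :=
      hPinv.clm_comp hQ'.differentiableAt
    refine h1.congr_of_eventuallyEq ?_
    have h2 : ∀ᶠ u in nhds u₀, (P u).IsInvertible := by
      have h3 : ∀ᶠ B in nhds (P u₀), B.IsInvertible := by
        rw [hP0]
        exact ContinuousLinearEquiv.nhds (ContinuousLinearEquiv.refl ℝ E)
      exact (show ContinuousAt P u₀ from hP'.continuousAt).eventually h3
    filter_upwards [hPQ, h2] with u h4 h5
    rw [← h4, ← ContinuousLinearMap.comp_assoc, h5.inverse_comp_self]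
    rfl
  have h1 := (hP'.clm_comp hAd.hasFDerivAt).unique (hQ'.congr_of_eventuallyEq hPQ)
  have h2 : ∀ Z X : E, fderiv ℝ A u₀ Z X = D2 (Z, 0) (0, X) - D2 (X, 0) (0, Z) := by
    intro Z X
    have hsymm : D2 (0, Z) (X, 0) = D2 (X, 0) (0, Z) :=
      ((contDiffAt_chartMul_one E G).isSymmSndFDerivAt (by simp; exact ENat.LEInfty.out)) _ _
    have h3 : P u₀ (fderiv ℝ A u₀ Z X) + D2 (0, Z) (A u₀ X, 0) = D2 (Z, 0) (0, X) := by
      simpa [hP] using congrArg (fun T : E →L[ℝ] E →L[ℝ] E => T Z X) h1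
    rw [hP0, hA0] at h3
    rw [← hsymm]
    exact eq_sub_of_add_eq h3
  exact ⟨fderiv ℝ A u₀, hAd.hasFDerivAt, fun Z X =>
    (h2 Z X).trans (bracket_eq_fderiv_chartMul E G Z X).symm⟩

end Adjoint

end SymmetricSpaceOrbit

namespace SymmetricSpaceOrbit

/-! ### One-parameter subgroups -/

/-- A curve of operators satisfying `Φ' = Φ B` and `Φ 0 = 1` on an interval is the exponential. -/
theorem eq_exp_of_hasDerivAt {A : Type*} [NormedRing A] [NormedAlgebra ℝ A] [CompleteSpace A]
    {Φ : ℝ → A} {B : A} {δ : ℝ} (h0 : Φ 0 = 1)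
    (h : ∀ t ∈ Set.Ioo (-δ) δ, HasDerivAt Φ (Φ t * B) t) {t : ℝ} (ht : t ∈ Set.Ioo (-δ) δ) :
    Φ t = NormedSpace.exp (t • B) := by
  let +nondep : NormedAlgebra ℚ A := .restrictScalars ℚ ℝ A
  have hd : ∀ s ∈ Set.Ioo (-δ) δ,
      HasDerivAt (fun s => Φ s * NormedSpace.exp (s • (-B))) 0 s := by
    intro s hs
    have h1 := (h s hs).mul (hasDerivAt_exp_smul_const' (𝕂 := ℝ) (-B) s)
    convert! h1 using 1
    rw [mul_assoc, neg_mul, mul_neg, ← sub_eq_add_neg, sub_self]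
  obtain ⟨a, ha⟩ := isOpen_Ioo.exists_is_const_of_deriv_eq_zero (isPreconnected_Ioo)
    (fun s hs => (hd s hs).differentiableAt.differentiableWithinAt)
    (fun s hs => (hd s hs).deriv)
  have hδ : (0 : ℝ) ∈ Set.Ioo (-δ) δ := ⟨by linarith [ht.1, ht.2], by linarith [ht.1, ht.2]⟩
  have h1 := (ha t ht).trans (ha 0 hδ).symm
  simp only [h0, zero_smul, NormedSpace.exp_zero, mul_one] at h1
  have h2 : NormedSpace.exp (t • (-B)) * NormedSpace.exp (t • B) = 1 := by
    rw [← NormedSpace.exp_add_of_commute (by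
      rw [smul_neg]; exact (Commute.refl _).neg_left)]
    simp
  calc Φ t = Φ t * (NormedSpace.exp (t • (-B)) * NormedSpace.exp (t • B)) := by rw [h2, mul_one]
    _ = NormedSpace.exp (t • B) := by rw [← mul_assoc, h1, one_mul]

section Curves

set_option linter.unusedSectionVars false

variable {E : Type*} [NormedAddCommGroup E] [NormedSpace ℝ E] [FiniteDimensional ℝ E]
  {G : Type*} [TopologicalSpace G] [ChartedSpace E G] [Group G] [LieGroup 𝓘(ℝ, E) ∞ G]

variable (E G) in
/-- The adjoint representation of the Lie algebra on the model space, for use in calculus. -/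
noncomputable def adModel : E →L[ℝ] E →L[ℝ] E := (exists_hasFDerivAt_AdModel E G).choose

theorem adModel_apply (Z X : GroupLieAlgebra 𝓘(ℝ, E) G) : adModel E G Z X = ⁅Z, X⁆ :=
  (exists_hasFDerivAt_AdModel E G).choose_spec.2 Z X

theorem hasDerivAt_AdModel_of_one {c : ℝ → G} {t : ℝ} {X : E} (hc0 : c t = 1)
    (hc : HasMFDerivAt 𝓘(ℝ, ℝ) 𝓘(ℝ, E) c t ((1 : ℝ →L[ℝ] ℝ).smulRight X)) :
    HasDerivAt (fun s => (AdModel (c s) : E →L[ℝ] E)) (adModel E G X) t := by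
  have := isManifold_one E G
  have h1 : MDifferentiableAt 𝓘(ℝ, E) 𝓘(ℝ, E) (extChartAt 𝓘(ℝ, E) (1 : G)) (c t) := by
    rw [hc0]; exact mdifferentiableAt_extChartAt (mem_chart_source E (1 : G))
  have h2 : HasFDerivAt (extChartAt 𝓘(ℝ, E) (1 : G) ∘ c)
      ((mfderiv 𝓘(ℝ, E) 𝓘(ℝ, E) (extChartAt 𝓘(ℝ, E) (1 : G)) (c t) : E →L[ℝ] E).comp
        ((1 : ℝ →L[ℝ] ℝ).smulRight X)) t :=
    (h1.hasMFDerivAt.comp t hc).hasFDerivAt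
  have h2 : HasFDerivAt (extChartAt 𝓘(ℝ, E) (1 : G) ∘ c) ((1 : ℝ →L[ℝ] ℝ).smulRight X) t := by
    rw [← ContinuousLinearMap.id_comp ((1 : ℝ →L[ℝ] ℝ).smulRight X),
      ← mfderiv_extChartAt_self (E := E) hc0]
    exact h2
  have h3 : HasFDerivAt (fun u => (AdModel ((extChartAt 𝓘(ℝ, E) (1 : G)).symm u) : E →L[ℝ] E))
      (adModel E G) (chartOne E G) := (exists_hasFDerivAt_AdModel E G).choose_spec.1
  have h4 : (extChartAt 𝓘(ℝ, E) (1 : G) ∘ c) t = chartOne E G := by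
    simp only [Function.comp_apply, hc0]; rfl
  rw [← h4] at h3
  have h5 := (h3.comp t h2).hasDerivAt
  have h6 := hc.continuousAt.eventually (p := fun x => x ∈ (extChartAt 𝓘(ℝ, E) (1 : G)).source)
    (by rw [hc0]; exact eventually_chart_source E G)
  have h7 : (fun s => (AdModel (c s) : E →L[ℝ] E)) =ᶠ[nhds t]
      ((fun u => (AdModel ((extChartAt 𝓘(ℝ, E) (1 : G)).symm u) : E →L[ℝ] E)) ∘
        (extChartAt 𝓘(ℝ, E) (1 : G) ∘ c)) := by
    filter_upwards [h6] with s hs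
    exact congrArg AdModel ((extChartAt 𝓘(ℝ, E) (1 : G)).left_inv hs).symm
  refine HasDerivAt.congr_of_eventuallyEq ?_ h7
  simpa using h5

theorem hasMFDerivAt_translate {c : ℝ → G} {t : ℝ} {X : E}
    (hc : HasMFDerivAt 𝓘(ℝ, ℝ) 𝓘(ℝ, E) c t ((1 : ℝ →L[ℝ] ℝ).smulRight
      (mulInvariantVectorField (I := 𝓘(ℝ, E)) (G := G) X (c t) : E))) :
    HasMFDerivAt 𝓘(ℝ, ℝ) 𝓘(ℝ, E) (fun s => (c t)⁻¹ * c s) t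
      ((1 : ℝ →L[ℝ] ℝ).smulRight X) := by
  have hm : ∀ g h : G, MDifferentiableAt 𝓘(ℝ, E) 𝓘(ℝ, E) (fun x : G => g * x) h := fun g h =>
    (contMDiff_mul_left (I := 𝓘(ℝ, E)) (n := ∞)).contMDiffAt.mdifferentiableAt (by simp)
  have h1 := (hm (c t)⁻¹ (c t)).hasMFDerivAt.comp t hc
  have h2 : (mfderiv 𝓘(ℝ, E) 𝓘(ℝ, E) (fun x : G => (c t)⁻¹ * x) (c t) : E →L[ℝ] E)
      (mulInvariantVectorField (I := 𝓘(ℝ, E)) (G := G) X (c t) : E) = X := by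
    have h3 := mfderiv_comp (1 : G) (hm (c t)⁻¹ (c t * 1)) (hm (c t) 1)
    have h4 : ((fun x : G => (c t)⁻¹ * x) ∘ fun x : G => c t * x) = id := by ext x; simp
    have h5 : (mfderiv 𝓘(ℝ, E) 𝓘(ℝ, E)
        ((fun x : G => (c t)⁻¹ * x) ∘ fun x : G => c t * x) 1 : E →L[ℝ] E) = .id ℝ E := by
      rw [h4]; exact mfderiv_id
    have h6 : ∀ g' : G, g' = c t →
        (mfderiv 𝓘(ℝ, E) 𝓘(ℝ, E) (fun x : G => (c t)⁻¹ * x) g' : E →L[ℝ] E) =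
        mfderiv 𝓘(ℝ, E) 𝓘(ℝ, E) (fun x : G => (c t)⁻¹ * x) (c t) := by rintro _ rfl; rfl
    have h7 := congrArg (fun A : E →L[ℝ] E => A X) (h3.symm.trans h5)
    exact (congrArg (fun A : E →L[ℝ] E =>
      A (mulInvariantVectorField (I := 𝓘(ℝ, E)) (G := G) X (c t) : E))
      (h6 _ (mul_one (c t)))).symm.trans h7
  have h8 : (mfderiv 𝓘(ℝ, E) 𝓘(ℝ, E) (fun x : G => (c t)⁻¹ * x) (c t) : E →L[ℝ] E).comp
      ((1 : ℝ →L[ℝ] ℝ).smulRight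
        (mulInvariantVectorField (I := 𝓘(ℝ, E)) (G := G) X (c t) : E)) =
      (1 : ℝ →L[ℝ] ℝ).smulRight X := by
    ext
    simp only [ContinuousLinearMap.comp_apply, ContinuousLinearMap.smulRight_apply,
      one_apply_eq_self, one_smul]
    exact h2.trans (one_smul ℝ X).symm
  exact h8 ▸ h1

theorem hasDerivAt_AdModel_integralCurve {c : ℝ → G} {t : ℝ} {X : E}
    (hc : HasMFDerivAt 𝓘(ℝ, ℝ) 𝓘(ℝ, E) c t ((1 : ℝ →L[ℝ] ℝ).smulRight
      (mulInvariantVectorField (I := 𝓘(ℝ, E)) (G := G) X (c t) : E))) :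
    HasDerivAt (fun s => (AdModel (c s) : E →L[ℝ] E))
      ((AdModel (c t) : E →L[ℝ] E) * adModel E G X) t := by
  have h1 := hasDerivAt_AdModel_of_one (by simp) (hasMFDerivAt_translate hc)
  have h2 := (hasDerivAt_const t (AdModel (c t) : E →L[ℝ] E)).mul h1
  have h3 : (fun s => (AdModel (c s) : E →L[ℝ] E)) =
      fun s => (AdModel (c t) : E →L[ℝ] E) * AdModel ((c t)⁻¹ * c s) := by
    ext1 s
    rw [ContinuousLinearMap.mul_def, ← AdModel_mul, mul_inv_cancel_left]
  rw [h3]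
  convert! h2 using 1
  rw [zero_mul, zero_add]

namespace RiemannianSymmetricPair

variable (S : RiemannianSymmetricPair E G)

/-- If c is the integral curve of the left-invariant field of X, so is σ ∘ c. By uniqueness c lies
in G^σ, and by connectedness in its identity component, hence in K. -/
theorem exists_curve {X : GroupLieAlgebra 𝓘(ℝ, E) G} (hX : S.dσ X = X) :
    ∃ (c : ℝ → G) (δ : ℝ), 0 < δ ∧ c 0 = 1 ∧ ∀ t ∈ Set.Ioo (-δ) δ, c t ∈ S.K ∧
      HasMFDerivAt 𝓘(ℝ, ℝ) 𝓘(ℝ, E) c t ((1 : ℝ →L[ℝ] ℝ).smulRight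
        (mulInvariantVectorField (I := 𝓘(ℝ, E)) (G := G) X (c t) : E)) := by
  have := isManifold_one E G
  have hv : ContMDiffAt 𝓘(ℝ, E) 𝓘(ℝ, E).tangent 1
      (fun g : G => (⟨g, mulInvariantVectorField X g⟩ : TangentBundle 𝓘(ℝ, E) G)) 1 :=
    (contMDiff_mulInvariantVectorField X).contMDiffAt.of_le (by
      rw [minSmoothness_of_isRCLikeNormedField]; norm_num)
  obtain ⟨c, hc0, hc⟩ := exists_isMIntegralCurveAt_of_contMDiffAt_boundaryless (t₀ := 0) hv
  have hσ : IsMIntegralCurveAt (S.σ ∘ c) (mulInvariantVectorField X) 0 := by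
    filter_upwards [hc] with t ht
    have h1 :=
      (S.smooth_σ.contMDiffAt.mdifferentiableAt (x := c t) (by simp)).hasMFDerivAt.comp t ht
    have h2 := mfderiv_mulInvariantVectorField S.smooth_σ (c t) X
    have h3 : (mfderiv 𝓘(ℝ, E) 𝓘(ℝ, E) S.σ 1 : E →L[ℝ] E) X = X := hX
    rw [h3] at h2
    have h8 : (mfderiv 𝓘(ℝ, E) 𝓘(ℝ, E) S.σ (c t) : E →L[ℝ] E).comp
        ((1 : ℝ →L[ℝ] ℝ).smulRight
          (mulInvariantVectorField (I := 𝓘(ℝ, E)) (G := G) X (c t) : E)) =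
        (1 : ℝ →L[ℝ] ℝ).smulRight
          (mulInvariantVectorField (I := 𝓘(ℝ, E)) (G := G) X (S.σ (c t)) : E) := by
      ext
      simp only [ContinuousLinearMap.comp_apply, ContinuousLinearMap.smulRight_apply,
        one_apply_eq_self, one_smul]
      exact h2
    exact h8 ▸ h1
  have heq := isMIntegralCurveAt_eventuallyEq_of_contMDiffAt_boundaryless (by rw [hc0]; exact hv)
    hc hσ (by simp [hc0])
  obtain ⟨δ, hδ, hball⟩ := Metric.eventually_nhds_iff_ball.1 (heq.and hc)
  rw [Real.ball_eq_Ioo, zero_sub, zero_add] at hball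
  have hconn : c '' Set.Ioo (-δ) δ ⊆ connectedComponentIn {g : G | S.σ g = g} 1 := by
    refine IsPreconnected.subset_connectedComponentIn ?_ ?_ ?_
    · exact isPreconnected_Ioo.image c fun t ht =>
        (hball t ht).2.continuousAt.continuousWithinAt
    · exact ⟨0, ⟨by linarith, hδ⟩, hc0⟩
    · rintro _ ⟨t, ht, rfl⟩
      exact (hball t ht).1.symm
  exact ⟨c, δ, hδ, hc0, fun t ht =>
    ⟨S.identityComponent_subset_K (hconn ⟨t, ht, rfl⟩), (hball t ht).2⟩⟩

/-- The curve in K exists only for short times; for general t take the n-th power of its point at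
t/n. -/
theorem exists_Ad_eq_exp {X : GroupLieAlgebra 𝓘(ℝ, E) G} (hX : S.dσ X = X) (t : ℝ) :
    ∃ k ∈ S.K, (AdModel k : E →L[ℝ] E) = NormedSpace.exp (t • adModel E G X) := by
  let +nondep : NormedAlgebra ℚ (E →L[ℝ] E) := .restrictScalars ℚ ℝ _
  obtain ⟨c, δ, hδ, hc0, hc⟩ := S.exists_curve hX
  have h0 : (AdModel (c 0) : E →L[ℝ] E) = 1 := by rw [hc0, AdModel_one]; rfl
  have hlocal : ∀ s ∈ Set.Ioo (-δ) δ,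
      (AdModel (c s) : E →L[ℝ] E) = NormedSpace.exp (s • adModel E G X) := fun s hs =>
    eq_exp_of_hasDerivAt (Φ := fun s => (AdModel (c s) : E →L[ℝ] E)) h0
      (fun r hr => hasDerivAt_AdModel_integralCurve (hc r hr).2) hs
  obtain ⟨n, hn⟩ := exists_nat_gt (|t| / δ)
  have hn0 : (0 : ℝ) < n := lt_of_le_of_lt (by positivity) hn
  have hs : t / n ∈ Set.Ioo (-δ) δ := by
    rw [Set.mem_Ioo, ← abs_lt, abs_div, abs_of_pos hn0, div_lt_iff₀ hn0]
    rw [div_lt_iff₀ hδ] at hn; linarith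
  refine ⟨c (t / n) ^ n, S.K.pow_mem (hc _ hs).1 n, ?_⟩
  have hpow : ∀ (g : G) (m : ℕ), (AdModel (g ^ m) : E →L[ℝ] E) = AdModel g ^ m := by
    intro g m
    induction m with
    | zero => rw [pow_zero, pow_zero, AdModel_one]; rfl
    | succ m ih => rw [pow_succ, AdModel_mul, ih, pow_succ]; rfl
  rw [hpow, hlocal _ hs, ← NormedSpace.exp_nsmul, ← Nat.cast_smul_eq_nsmul ℝ, smul_smul,
    mul_div_cancel₀ _ hn0.ne']

end RiemannianSymmetricPair

end Curves

end SymmetricSpaceOrbit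

namespace SymmetricSpaceOrbit

/-! ### Derivations and the ideal generated by the `(-1)`-eigenspace -/

/-- The projection of a Killing Lie algebra to an ideal along its Killing complement. -/
theorem exists_idealProjection {L : Type*} [LieRing L] [LieAlgebra ℝ L] [FiniteDimensional ℝ L]
    [LieAlgebra.IsKilling ℝ L] (I : LieIdeal ℝ L) :
    ∃ π : L →ₗ[ℝ] L, (∀ z, π z ∈ I) ∧ (∀ z ∈ I, π z = z) ∧
      (∀ z w, π ⁅z, w⁆ = ⁅π z, π w⁆) ∧ ∀ z w, ⁅π z, w⁆ = ⁅π z, π w⁆ := by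
  have hc := I.isCompl_killingCompl
  have hc' : IsCompl (I : Submodule ℝ L) (LieIdeal.killingCompl ℝ L I : Submodule ℝ L) :=
    LieSubmodule.isCompl_toSubmodule.2 hc
  have hIJ : ∀ a ∈ I, ∀ b ∈ LieIdeal.killingCompl ℝ L I, ⁅a, b⁆ = 0 := by
    intro a ha b hb
    have h1 : ⁅a, b⁆ ∈ I ⊓ LieIdeal.killingCompl ℝ L I :=
      ⟨lie_mem_left ℝ L I a b ha, lie_mem_right ℝ L _ a b hb⟩
    rwa [hc.inf_eq_bot, LieSubmodule.mem_bot] at h1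
  have hmem : ∀ z, Submodule.projection _ _ hc' z ∈ I := fun z =>
    Submodule.projection_apply_mem hc' z
  have hsub : ∀ z, z - Submodule.projection _ _ hc' z ∈ LieIdeal.killingCompl ℝ L I := by
    intro z
    have : Submodule.projection _ _ hc' (z - Submodule.projection _ _ hc' z) = 0 := by
      rw [map_sub, Submodule.projection_apply_of_mem_left hc' (hmem z), sub_self]
    exact (Submodule.projection_apply_eq_zero_iff hc').1 this
  have hlie : ∀ z w, ⁅Submodule.projection _ _ hc' z, w⁆ =
      ⁅Submodule.projection _ _ hc' z, Submodule.projection _ _ hc' w⁆ := by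
    intro z w
    rw [← sub_eq_zero, ← lie_sub]
    exact hIJ _ (hmem z) _ (hsub w)
  refine ⟨Submodule.projection _ _ hc', hmem,
    fun z hz => Submodule.projection_apply_of_mem_left hc' hz, fun z w => ?_, hlie⟩
  have h1 : ⁅z, w⁆ = ⁅Submodule.projection _ _ hc' z, Submodule.projection _ _ hc' w⁆ +
      ⁅z - Submodule.projection _ _ hc' z, w⁆ := by
    rw [sub_lie, ← hlie z w, add_sub_cancel]
  rw [h1, map_add, Submodule.projection_apply_of_mem_left hc'
    (lie_mem_left ℝ L I _ _ (hmem z)),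
    (Submodule.projection_apply_eq_zero_iff hc').2 (lie_mem_left ℝ L _ _ _ (hsub z)),
    add_zero]

namespace OrthogonalSymmetric

set_option linter.unusedSectionVars false

variable {L V : Type*} [LieRing L] [LieAlgebra ℝ L] [NormedAddCommGroup V]
  [InnerProductSpace ℝ V] (D : OrthogonalSymmetric L V)

/-- The ideal generated by the `(-1)`-eigenspace. -/
noncomputable def generatedIdeal : LieIdeal ℝ L where
  toSubmodule := LinearMap.range D.e ⊔
    Submodule.span ℝ {z | ∃ v w, z = ⁅D.e v, D.e w⁆}
  lie_mem := by
    intro x z hz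
    have hfix : ∀ X, D.θ X = X → ∀ v, ⁅X, D.e v⁆ ∈ LinearMap.range D.e := fun X hX v =>
      ⟨D.act X v, D.e_act hX v⟩
    have hsplit : ⁅x, z⁆ = ⁅D.fixedPart x, z⁆ + ⁅D.e (D.pr x), z⁆ := by
      rw [← add_lie, D.fixedPart_add]
    have hF := D.θ_fixedPart x
    set X := D.fixedPart x
    set u := D.pr x
    change z ∈ LinearMap.range D.e ⊔ Submodule.span ℝ {z | ∃ v w, z = ⁅D.e v, D.e w⁆} at hz
    change ⁅x, z⁆ ∈ LinearMap.range D.e ⊔ Submodule.span ℝ {z | ∃ v w, z = ⁅D.e v, D.e w⁆}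
    have hbr : ∀ a ∈ LinearMap.range D.e, ∀ b ∈ LinearMap.range D.e,
        ⁅a, b⁆ ∈ Submodule.span ℝ {z | ∃ v w, z = ⁅D.e v, D.e w⁆} := by
      rintro _ ⟨v, rfl⟩ _ ⟨w, rfl⟩
      exact Submodule.subset_span ⟨v, w, rfl⟩
    rw [hsplit]
    obtain ⟨y, ⟨v, rfl⟩, s, hs, rfl⟩ := Submodule.mem_sup.1 hz
    rw [lie_add, lie_add]
    have h2 : Submodule.span ℝ {z | ∃ v w, z = ⁅D.e v, D.e w⁆} ≤
        (Submodule.span ℝ {z | ∃ v w, z = ⁅D.e v, D.e w⁆}).comap (LieAlgebra.ad ℝ L X) := by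
      refine Submodule.span_le.2 ?_
      rintro _ ⟨v, w, rfl⟩
      change ⁅X, ⁅D.e v, D.e w⁆⁆ ∈ Submodule.span ℝ {z | ∃ v w, z = ⁅D.e v, D.e w⁆}
      rw [leibniz_lie]
      exact add_mem (hbr _ (hfix X hF v) _ ⟨w, rfl⟩) (hbr _ ⟨v, rfl⟩ _ (hfix X hF w))
    have h3 : Submodule.span ℝ {z | ∃ v w, z = ⁅D.e v, D.e w⁆} ≤
        (LinearMap.range D.e).comap (LieAlgebra.ad ℝ L (D.e u)) := by
      refine Submodule.span_le.2 ?_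
      rintro _ ⟨v, w, rfl⟩
      exact ⟨D.T u v w, D.e_T u v w⟩
    exact add_mem (add_mem (Submodule.mem_sup_left (hfix X hF v))
      (Submodule.mem_sup_right (h2 hs)))
      (add_mem (Submodule.mem_sup_right (hbr _ ⟨u, rfl⟩ _ ⟨v, rfl⟩))
      (Submodule.mem_sup_left (h3 hs)))

theorem e_mem_generatedIdeal (v : V) : D.e v ∈ D.generatedIdeal :=
  Submodule.mem_sup_left ⟨v, rfl⟩

/-- A property stable under linear combinations that holds for the `(-1)`-eigenspace and for
brackets of its elements holds on the generated ideal. -/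
theorem generatedIdeal_le {M : Submodule ℝ L} (h1 : ∀ v, D.e v ∈ M)
    (h2 : ∀ v w, ⁅D.e v, D.e w⁆ ∈ M) {z : L} (hz : z ∈ D.generatedIdeal) : z ∈ M := by
  have h : LinearMap.range D.e ⊔ Submodule.span ℝ {z | ∃ v w, z = ⁅D.e v, D.e w⁆} ≤ M := by
    refine sup_le ?_ (Submodule.span_le.2 ?_)
    · rintro _ ⟨v, rfl⟩; exact h1 v
    · rintro _ ⟨v, w, rfl⟩; exact h2 v w
  exact h hz

/-- A derivation preserving the `(-1)`-eigenspace acts there as an element of the fixed point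
algebra. -/
theorem exists_fixed_act_eq [FiniteDimensional ℝ L] [LieAlgebra.IsKilling ℝ L] (d : L →ₗ[ℝ] L)
    (hd : ∀ a b, d ⁅a, b⁆ = ⁅d a, b⁆ + ⁅a, d b⁆) (δ : V → V) (hδ : ∀ v, d (D.e v) = D.e (δ v)) :
    ∃ X, D.θ X = X ∧ ∀ v, D.act X v = δ v := by
  let d' : LieDerivation ℝ L L :=
    ⟨d, fun a b => by rw [hd, ← lie_skew (d a) b]; abel⟩
  -- Derivations of a Killing Lie algebra are inner. Only the fixed part of x acts on V.
  obtain ⟨x, hx⟩ := LieDerivation.IsKilling.exists_eq_ad d'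
  refine ⟨D.fixedPart x, D.θ_fixedPart x, fun v => ?_⟩
  rw [act_fixedPart, act_apply]
  have h1 : ⁅x, D.e v⁆ = d (D.e v) := by
    rw [← LieDerivation.ad_apply_apply (R := ℝ), hx]; rfl
  rw [h1, hδ, D.pr_e]

end OrthogonalSymmetric

end SymmetricSpaceOrbit

namespace SymmetricSpaceOrbit

/-! ### The orthogonal symmetric Lie algebra of a Riemannian symmetric pair -/

/-- A map to continuous linear maps on a finite-dimensional space is differentiable if it is
pointwise differentiable. -/
theorem differentiableAt_clm_of_apply {E F : Type*} [NormedAddCommGroup E] [NormedSpace ℝ E]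
    [FiniteDimensional ℝ E] [NormedAddCommGroup F] [NormedSpace ℝ F] {f : ℝ → E →L[ℝ] F} {t : ℝ}
    (h : ∀ y, DifferentiableAt ℝ (fun s => f s y) t) : DifferentiableAt ℝ f t := by
  let d := Module.finrank ℝ E
  have hd : d = Module.finrank ℝ (Fin d → ℝ) := (Module.finrank_fin_fun ℝ).symm
  let e₁ := ContinuousLinearEquiv.ofFinrankEq hd
  let e₂ := (e₁.arrowCongr (1 : F ≃L[ℝ] F)).trans (ContinuousLinearEquiv.piRing (Fin d))
  rw [← Function.id_comp f, ← e₂.symm_comp_self]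
  exact e₂.symm.differentiableAt.comp t (differentiableAt_pi.mpr fun i => h _)

namespace RiemannianSymmetricPair

set_option linter.unusedSectionVars false

variable {E : Type*} [NormedAddCommGroup E] [NormedSpace ℝ E] [FiniteDimensional ℝ E]
  {G : Type*} [TopologicalSpace G] [ChartedSpace E G] [Group G] [LieGroup 𝓘(ℝ, E) ∞ G]
  (S : RiemannianSymmetricPair E G)
  {V : Type*} [NormedAddCommGroup V] [InnerProductSpace ℝ V] [FiniteDimensional ℝ V]
  {ρ : S.K →* (V ≃ₗᵢ[ℝ] V)} (e : V ≃ₗ[ℝ] S.𝔭)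

/-- The inclusion of `V ≃ 𝔭` in the Lie algebra. -/
noncomputable def incl : V →ₗ[ℝ] GroupLieAlgebra 𝓘(ℝ, E) G := S.𝔭.subtype ∘ₗ e.toLinearMap

theorem dσ_incl (v : V) : S.dσ (S.incl e v) = -S.incl e v := (e v).2

/-- The projection of the Lie algebra to `V ≃ 𝔭` along the fixed point algebra. -/
noncomputable def proj : GroupLieAlgebra 𝓘(ℝ, E) G →ₗ[ℝ] V :=
  e.symm.toLinearMap ∘ₗ LinearMap.codRestrict S.𝔭
    ((1 / 2 : ℝ) • (LinearMap.id - (S.dσ : GroupLieAlgebra 𝓘(ℝ, E) G →ₗ[ℝ] _))) (fun X => by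
      change S.dσ ((1 / 2 : ℝ) • (X - S.dσ X)) = -((1 / 2 : ℝ) • (X - S.dσ X))
      rw [map_smul, map_sub, S.dσ_dσ]
      module)

theorem incl_proj (X : GroupLieAlgebra 𝓘(ℝ, E) G) :
    S.incl e (S.proj e X) = (1 / 2 : ℝ) • (X - S.dσ X) := by
  simp [incl, proj]

theorem incl_injective : Function.Injective (S.incl e) :=
  Subtype.val_injective.comp e.injective

theorem proj_incl (v : V) : S.proj e (S.incl e v) = v := by
  apply S.incl_injective e
  rw [incl_proj, dσ_incl]
  module

/-- The inclusion of `V` in the model space. -/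
noncomputable def inclModel : V →L[ℝ] E :=
  LinearMap.toContinuousLinearMap (show V →ₗ[ℝ] E from S.incl e)

/-- The projection of the model space to `V`. -/
noncomputable def projModel : E →L[ℝ] V :=
  LinearMap.toContinuousLinearMap (show E →ₗ[ℝ] V from S.proj e)

variable {e}

theorem incl_ρ (hρ : S.IsIsotropyRepresentation ρ e) (k : S.K) (v : V) :
    S.incl e (ρ k v) = Ad (k : G) (S.incl e v) := hρ k v

theorem ρ_eq (hρ : S.IsIsotropyRepresentation ρ e) (k : S.K) :
    ((ρ k).toContinuousLinearEquiv : V →L[ℝ] V) =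
      (S.projModel e).comp ((AdModel (k : G)).comp (S.inclModel e)) := by
  ext v
  change ρ k v = S.proj e (Ad (k : G) (S.incl e v))
  rw [← S.incl_ρ hρ, S.proj_incl]

/-- Differentiate the constant ⟨ρ(k)v, ρ(k)w⟩ along the one-parameter group of operators exp(t ad
X), each of which comes from an element of K. -/
theorem skew_of_fixed (hρ : S.IsIsotropyRepresentation ρ e) {X : GroupLieAlgebra 𝓘(ℝ, E) G}
    (hX : S.dσ X = X) (v w : V) :
    ⟪S.proj e ⁅X, S.incl e v⁆, w⟫_ℝ = -⟪v, S.proj e ⁅X, S.incl e w⁆⟫_ℝ := by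
  set R : ℝ → V → V := fun t v =>
    S.projModel e (NormedSpace.exp (t • adModel E G X) (S.inclModel e v)) with hR
  have hR0 : ∀ v, R 0 v = v := by
    intro v
    simp only [hR, zero_smul, NormedSpace.exp_zero]
    exact S.proj_incl e v
  have hder : ∀ v, HasDerivAt (fun t => R t v) (S.proj e ⁅X, S.incl e v⁆) 0 := by
    intro v
    have h1 := (hasDerivAt_exp_smul_const' (𝕂 := ℝ) (adModel E G X) 0).clm_apply
      (hasDerivAt_const 0 (S.inclModel e v))
    have h2 := (S.projModel e).hasFDerivAt.comp_hasDerivAt (0 : ℝ) h1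
    convert! h2 using 1
    simp only [zero_smul, NormedSpace.exp_zero, mul_one, map_zero, add_zero]
    exact congrArg (S.projModel e) (adModel_apply X (S.incl e v)).symm
  have hconst : ∀ t, ⟪R t v, R t w⟫_ℝ = ⟪v, w⟫_ℝ := by
    intro t
    obtain ⟨k, hk, hke⟩ := S.exists_Ad_eq_exp hX t
    have h1 : ∀ v, R t v = ρ ⟨k, hk⟩ v := by
      intro v
      have h2 := congrArg (fun A : V →L[ℝ] V => A v) (S.ρ_eq hρ ⟨k, hk⟩)
      simp only [hR, ← hke]
      exact h2.symm
    rw [h1, h1, LinearIsometryEquiv.inner_map_map]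
  have h1 := (hder v).inner ℝ (hder w)
  have h2 := h1.unique ((hasDerivAt_const (0 : ℝ) ⟪v, w⟫_ℝ).congr_of_eventuallyEq
    (Filter.Eventually.of_forall hconst))
  rw [hR0, hR0] at h2
  linarith

/-- The orthogonal symmetric Lie algebra of a Riemannian symmetric pair. -/
noncomputable def orthogonalSymmetric (hρ : S.IsIsotropyRepresentation ρ e) :
    OrthogonalSymmetric (GroupLieAlgebra 𝓘(ℝ, E) G) V where
  θ := { (S.dσ : GroupLieAlgebra 𝓘(ℝ, E) G →ₗ[ℝ] GroupLieAlgebra 𝓘(ℝ, E) G) with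
         map_lie' := fun {X Y} => S.dσ_lie X Y }
  e := S.incl e
  pr := S.proj e
  θ_θ := S.dσ_dσ
  θ_e := S.dσ_incl e
  pr_e := S.proj_incl e
  e_pr := S.incl_proj e
  skew := fun _ v w hX => S.skew_of_fixed hρ hX v w

theorem act_eq (hρ : S.IsIsotropyRepresentation ρ e) (X : GroupLieAlgebra 𝓘(ℝ, E) G) (v : V) :
    (S.orthogonalSymmetric hρ).act X v = S.projModel e (adModel E G X (S.inclModel e v)) :=
  congrArg (S.projModel e) (adModel_apply X (S.incl e v)).symm

/-- The one-parameter group generated by an element of the fixed point algebra lies in `ρ(K)`. -/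
theorem exists_ρ_eq_exp (hρ : S.IsIsotropyRepresentation ρ e) {X : GroupLieAlgebra 𝓘(ℝ, E) G}
    (hX : S.dσ X = X) :
    ∃ k : ℝ → S.K, IsSmoothFamily ρ k ∧ (∀ v, ρ (k 0) v = v) ∧
      (∀ v, HasDerivAt (fun t => ρ (k t) v) ((S.orthogonalSymmetric hρ).act X v) 0) ∧
      ∀ v, (S.orthogonalSymmetric hρ).act X v = 0 → ∀ t, ρ (k t) v = v := by
  choose k hk hke using S.exists_Ad_eq_exp hX
  have hρk : ∀ t, ((ρ ⟨k t, hk t⟩).toContinuousLinearEquiv : V →L[ℝ] V) =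
      (S.projModel e).comp ((NormedSpace.exp (t • adModel E G X)).comp (S.inclModel e)) := by
    intro t; rw [S.ρ_eq hρ, hke]
  have hρv : ∀ v t, ρ ⟨k t, hk t⟩ v =
      S.projModel e (NormedSpace.exp (t • adModel E G X) (S.inclModel e v)) := fun v t =>
    congrArg (fun A : V →L[ℝ] V => A v) (hρk t)
  have hd : ∀ v t, HasDerivAt (fun t => ρ ⟨k t, hk t⟩ v)
      (S.projModel e ((NormedSpace.exp (t • adModel E G X))
        (adModel E G X (S.inclModel e v)))) t := by
    intro v t
    have h1 := (hasDerivAt_exp_smul_const (𝕂 := ℝ) (adModel E G X) t).clm_apply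
      (hasDerivAt_const t (S.inclModel e v))
    have h2 := (S.projModel e).hasFDerivAt.comp_hasDerivAt t h1
    simp only [hρv]
    convert! h2 using 1
    simp
  have h0 : ∀ v, ρ ⟨k 0, hk 0⟩ v = v := by
    intro v
    rw [hρv, zero_smul, NormedSpace.exp_zero]
    exact S.proj_incl e v
  refine ⟨fun t => ⟨k t, hk t⟩, ?_, h0, fun v => ?_, fun v hv t => ?_⟩
  · rw [IsSmoothFamily]
    simp only [hρk]
    have hexp : ContDiff ℝ ∞ (NormedSpace.exp : (E →L[ℝ] E) → (E →L[ℝ] E)) :=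
      contDiff_iff_contDiffAt.2 fun x =>
        (NormedSpace.exp_analytic (𝕂 := ℝ) x).contDiffAt
    exact contDiff_const.clm_comp ((hexp.comp (contDiff_id.smul contDiff_const)).clm_comp
      contDiff_const)
  · convert! hd v 0 using 1
    rw [zero_smul, NormedSpace.exp_zero, S.act_eq]
    rfl
  · have hz : adModel E G X (S.inclModel e v) = 0 := by
      have h1 := (S.orthogonalSymmetric hρ).e_act (X := X) hX v
      rw [hv, map_zero] at h1
      exact (adModel_apply X (S.incl e v)).trans h1.symm
    have h1 : ∀ t, HasDerivAt (fun t => ρ ⟨k t, hk t⟩ v) 0 t := by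
      intro t
      convert! hd v t using 1
      rw [hz, map_zero, map_zero]
    exact (is_const_of_deriv_eq_zero (fun t => (h1 t).differentiableAt) (fun t => (h1 t).deriv)
      t 0).trans (h0 v)

variable [LieAlgebra.IsKilling ℝ (GroupLieAlgebra 𝓘(ℝ, E) G)]

/-- The velocity of a curve in `ρ(K)` comes from the fixed point algebra. -/
theorem exists_act_eq_deriv_of_one (hρ : S.IsIsotropyRepresentation ρ e) {c : ℝ → S.K} {t₀ : ℝ}
    (h0 : c t₀ = 1)
    (hc : DifferentiableAt ℝ (fun t => ((ρ (c t)).toContinuousLinearEquiv : V →L[ℝ] V)) t₀) :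
    ∃ X, S.dσ X = X ∧ ∀ v, HasDerivAt (fun t => ρ (c t) v)
      ((S.orthogonalSymmetric hρ).act X v) t₀ := by
  set D := S.orthogonalSymmetric hρ with hD
  have : FiniteDimensional ℝ (GroupLieAlgebra 𝓘(ℝ, E) G) := inferInstanceAs (FiniteDimensional ℝ E)
  -- Only ρ ∘ c is known to be differentiable, which controls Ad(c) on 𝔭 and, by the product rule,
  -- on the ideal generated by 𝔭. Precomposing with π discards the complementary ideal, about which
  -- nothing is known.
  obtain ⟨π, hπI, hπ, hπlie, hπlie'⟩ := exists_idealProjection D.generatedIdeal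
  have hcv : ∀ v, DifferentiableAt ℝ (fun t => ρ (c t) v) t₀ := fun v =>
    hc.clm_apply (differentiableAt_const v)
  have hAde : ∀ t v, (AdModel (c t : G) : E →L[ℝ] E) (S.inclModel e v) =
      S.inclModel e (ρ (c t) v) := fun t v => (S.incl_ρ hρ (c t) v).symm
  have hlie : ∀ t (a b : E), (AdModel (c t : G) : E →L[ℝ] E) (adModel E G a b) =
      adModel E G ((AdModel (c t : G) : E →L[ℝ] E) a) ((AdModel (c t : G) : E →L[ℝ] E) b) := by
    intro t a b
    refine (congrArg (AdModel (c t : G) : E →L[ℝ] E) (adModel_apply (E := E) (G := G) a b)).trans ?_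
    exact (Ad_lie (c t : G) _ _).trans (adModel_apply (E := E) (G := G) _ _).symm
  let M : Submodule ℝ E :=
    { carrier := {z | DifferentiableAt ℝ (fun t => (AdModel (c t : G) : E →L[ℝ] E) z) t₀}
      add_mem' := fun {a b} ha hb => by
        change DifferentiableAt ℝ _ _
        simp only [map_add]; exact DifferentiableAt.add ha hb
      zero_mem' := by
        change DifferentiableAt ℝ _ _
        simp
      smul_mem' := fun r a ha => by
        change DifferentiableAt ℝ _ _
        simp only [map_smul]; exact DifferentiableAt.const_smul ha r }
  have hMe : ∀ v, S.inclModel e v ∈ M := by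
    intro v
    change DifferentiableAt ℝ _ _
    simp only [hAde]
    exact (S.inclModel e).differentiableAt.comp t₀ (hcv v)
  have hMlie : ∀ a ∈ M, ∀ b ∈ M, adModel E G a b ∈ M := by
    intro a ha b hb
    change DifferentiableAt ℝ _ _
    simp only [hlie]
    exact ((adModel E G).differentiableAt.comp t₀ ha).clm_apply hb
  have hMI : ∀ z, (π z : E) ∈ M := by
    intro z
    refine D.generatedIdeal_le (M := (M : Submodule ℝ (GroupLieAlgebra 𝓘(ℝ, E) G))) hMe ?_ (hπI z)
    intro v w
    have := hMlie _ (hMe v) _ (hMe w)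
    rwa [show adModel E G (S.inclModel e v) (S.inclModel e w) = ⁅S.incl e v, S.incl e w⁆ from
      adModel_apply _ _] at this
  let πE : E →L[ℝ] E := LinearMap.toContinuousLinearMap (show E →ₗ[ℝ] E from π)
  have hF : DifferentiableAt ℝ (fun t => (AdModel (c t : G) : E →L[ℝ] E).comp πE) t₀ :=
    differentiableAt_clm_of_apply hMI
  set F' := deriv (fun t => (AdModel (c t : G) : E →L[ℝ] E).comp πE) t₀ with hF'
  have hFz : ∀ z, HasDerivAt (fun t => (AdModel (c t : G) : E →L[ℝ] E) (πE z)) (F' z) t₀ := by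
    intro z
    have h1 := hF.hasDerivAt.clm_apply (hasDerivAt_const t₀ z)
    convert! h1 using 1
    simp [hF']
  have hA0 : (AdModel (c t₀ : G) : E →L[ℝ] E) = .id ℝ E := by
    rw [h0]; exact AdModel_one
  have hE : ∀ a b : E, F' (adModel E G a b) =
      adModel E G (F' a) (πE b) + adModel E G (πE a) (F' b) := by
    intro a b
    have h1 := ((adModel E G).hasFDerivAt.comp_hasDerivAt t₀ (hFz a)).clm_apply (hFz b)
    have h2 : πE (adModel E G a b) = adModel E G (πE a) (πE b) :=
      (congrArg πE (adModel_apply (E := E) (G := G) a b)).trans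
        ((hπlie a b).trans (adModel_apply (E := E) (G := G) (π a) (π b)).symm)
    have h3 := hFz (adModel E G a b)
    simp only [h2, hlie] at h3
    have h4 := h3.unique h1
    rw [h4]
    simp [hA0]
  let d : GroupLieAlgebra 𝓘(ℝ, E) G →ₗ[ℝ] GroupLieAlgebra 𝓘(ℝ, E) G :=
    show E →ₗ[ℝ] E from F'
  have hd : ∀ a b, d ⁅a, b⁆ = ⁅d a, π b⁆ + ⁅π a, d b⁆ := fun a b =>
    (congrArg F' (adModel_apply (E := E) (G := G) a b)).symm.trans ((hE a b).trans
      (congrArg₂ (fun x y : E => x + y) (adModel_apply (E := E) (G := G) (d a) (π b))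
        (adModel_apply (E := E) (G := G) (π a) (d b))))
  have hππ : ∀ z, π (π z) = π z := fun z => hπ _ (hπI z)
  have hder : ∀ v, HasDerivAt (fun t => ρ (c t) v) (deriv (fun t => ρ (c t) v) t₀) t₀ := fun v =>
    (hcv v).hasDerivAt
  have hde : ∀ v, (π ∘ₗ d) (D.e v) = D.e (deriv (fun t => ρ (c t) v) t₀) := by
    intro v
    have h1 : πE (S.inclModel e v) = S.inclModel e v := hπ _ (D.e_mem_generatedIdeal v)
    have h2 := hFz (S.inclModel e v)
    simp only [h1, hAde] at h2
    have h3 := h2.unique ((S.inclModel e).hasFDerivAt.comp_hasDerivAt t₀ (hder v))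
    have h4 : d (D.e v) = D.e (deriv (fun t => ρ (c t) v) t₀) := h3
    rw [LinearMap.comp_apply, h4]
    exact hπ _ (D.e_mem_generatedIdeal _)
  -- The derivative d satisfies a Leibniz rule twisted by π. Composing with π makes it an honest
  -- derivation of the whole algebra, since brackets with the ideal depend only on the projection.
  obtain ⟨X, hX, hXv⟩ := D.exists_fixed_act_eq (π ∘ₗ d) (fun a b => by
    rw [LinearMap.comp_apply, hd, map_add, hπlie, hπlie, hππ, hππ, LinearMap.comp_apply,
      LinearMap.comp_apply, hπlie' (d a) b, ← lie_skew a, hπlie' (d b) a, lie_skew]) _ hde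
  exact ⟨X, hX, fun v => by rw [hXv]; exact hder v⟩

/-- Right translation by c(t₀)⁻¹ reduces to a curve through the identity. -/
theorem exists_act_eq_deriv (hρ : S.IsIsotropyRepresentation ρ e) {c : ℝ → S.K} {t₀ : ℝ}
    (hc : DifferentiableAt ℝ (fun t => ((ρ (c t)).toContinuousLinearEquiv : V →L[ℝ] V)) t₀) :
    ∃ X, S.dσ X = X ∧ ∀ v, HasDerivAt (fun t => ρ (c t) v)
      ((S.orthogonalSymmetric hρ).act X (ρ (c t₀) v)) t₀ := by
  have h1 : ∀ t v, ρ (c t * (c t₀)⁻¹) v = ρ (c t) (ρ (c t₀)⁻¹ v) := by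
    intro t v; rw [map_mul, map_inv]; rfl
  obtain ⟨X, hX, hXv⟩ := S.exists_act_eq_deriv_of_one hρ (c := fun t => c t * (c t₀)⁻¹) (t₀ := t₀)
    (by simp) (by
      refine differentiableAt_clm_of_apply fun v => ?_
      change DifferentiableAt ℝ (fun t => ρ (c t * (c t₀)⁻¹) v) t₀
      simp only [h1]
      exact hc.clm_apply (differentiableAt_const (ρ (c t₀)⁻¹ v)))
  refine ⟨X, hX, fun v => ?_⟩
  have h2 := hXv (ρ (c t₀) v)
  simp only [h1] at h2
  have h3 : ρ (c t₀)⁻¹ (ρ (c t₀) v) = v := by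
    rw [map_inv]; exact (ρ (c t₀)).symm_apply_apply v
  rwa [h3] at h2

end RiemannianSymmetricPair

end SymmetricSpaceOrbit

namespace SymmetricSpaceOrbit

/-! ### The second fundamental form of the orbit through a root vector -/

namespace RiemannianSymmetricPair

set_option linter.unusedSectionVars false

variable {E : Type*} [NormedAddCommGroup E] [NormedSpace ℝ E] [FiniteDimensional ℝ E]
  {G : Type*} [TopologicalSpace G] [ChartedSpace E G] [Group G] [LieGroup 𝓘(ℝ, E) ∞ G]
  (S : RiemannianSymmetricPair E G)
  {V : Type*} [NormedAddCommGroup V] [InnerProductSpace ℝ V] [FiniteDimensional ℝ V]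
  {ρ : S.K →* (V ≃ₗᵢ[ℝ] V)} {e : V ≃ₗ[ℝ] S.𝔭}

theorem act_mem_orbitTangentSpace (hρ : S.IsIsotropyRepresentation ρ e)
    {X : GroupLieAlgebra 𝓘(ℝ, E) G} (hX : S.dσ X = X) (p : V) :
    (S.orthogonalSymmetric hρ).act X p ∈ orbitTangentSpace ρ p := by
  obtain ⟨k, hk, hk0, hkd, -⟩ := S.exists_ρ_eq_exp hρ hX
  exact Submodule.subset_span ⟨k, hk, hk0 p, (hkd p).deriv.symm⟩

theorem inner_act_eq_zero_of_mem_orbitNormalSpace (hρ : S.IsIsotropyRepresentation ρ e)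
    {X : GroupLieAlgebra 𝓘(ℝ, E) G} (hX : S.dσ X = X) {p ξ : V}
    (hξ : ξ ∈ orbitNormalSpace ρ p) : ⟪(S.orthogonalSymmetric hρ).act X p, ξ⟫_ℝ = 0 :=
  (Submodule.mem_orthogonal _ _).1 hξ _
    (Submodule.mem_sup_right (S.act_mem_orbitTangentSpace hρ hX p))

theorem dσ_Ad_of_mem {X : GroupLieAlgebra 𝓘(ℝ, E) G} (hX : S.dσ X = X) (k : S.K) :
    S.dσ (Ad (k : G) X) = Ad (k : G) X := by
  rw [S.dσ_Ad (S.K_le_fixed k k.2), hX]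

theorem ρ_act (hρ : S.IsIsotropyRepresentation ρ e) {X : GroupLieAlgebra 𝓘(ℝ, E) G}
    (hX : S.dσ X = X) (k : S.K) (v : V) :
    ρ k ((S.orthogonalSymmetric hρ).act X v) =
      (S.orthogonalSymmetric hρ).act (Ad (k : G) X) (ρ k v) := by
  set D := S.orthogonalSymmetric hρ with hD
  apply D.e_injective
  have h1 : ∀ w, D.e (ρ k w) = Ad (k : G) (D.e w) := S.incl_ρ hρ k
  rw [h1, D.e_act (show D.θ X = X from hX),
    D.e_act (show D.θ (Ad (k : G) X) = _ from S.dσ_Ad_of_mem hX k), h1, Ad_lie]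

variable [LieAlgebra.IsKilling ℝ (GroupLieAlgebra 𝓘(ℝ, E) G)]

/-- The velocities and the normal part of the second derivative of a surface in the orbit. -/
theorem exists_act_of_surface (hρ : S.IsIsotropyRepresentation ρ e) {k : ℝ × ℝ → S.K}
    (hk : IsSmoothFamily ρ k) {p : V} (hp : ρ (k (0, 0)) p = p) :
    ∃ X Y : GroupLieAlgebra 𝓘(ℝ, E) G, S.dσ X = X ∧ S.dσ Y = Y ∧
      deriv (fun s : ℝ => ρ (k (s, 0)) p) 0 = (S.orthogonalSymmetric hρ).act X p ∧
      deriv (fun t : ℝ => ρ (k (0, t)) p) 0 = (S.orthogonalSymmetric hρ).act Y p ∧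
      ∀ ξ ∈ orbitNormalSpace ρ p,
        ⟪deriv (fun s : ℝ => deriv (fun t : ℝ => ρ (k (s, t)) p) 0) 0, ξ⟫_ℝ =
          ⟪(S.orthogonalSymmetric hρ).act Y ((S.orthogonalSymmetric hρ).act X p), ξ⟫_ℝ := by
  set D := S.orthogonalSymmetric hρ with hD
  set R : ℝ × ℝ → V →L[ℝ] V := fun x => ((ρ (k x)).toContinuousLinearEquiv : V →L[ℝ] V) with hR
  have hRsm : ContDiff ℝ ∞ R := hk
  have hRd : Differentiable ℝ R := hRsm.differentiable (by simp)
  have hR1 : ∀ s, HasFDerivAt (fun s : ℝ => (s, (0 : ℝ))) (ContinuousLinearMap.inl ℝ ℝ ℝ) s :=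
    fun s => hasFDerivAt_prodMk_left s 0
  have hR2 : ∀ s t, HasFDerivAt (fun t : ℝ => (s, t)) (ContinuousLinearMap.inr ℝ ℝ ℝ) t :=
    fun s t => hasFDerivAt_prodMk_right s t
  have hd1 : ∀ s, DifferentiableAt ℝ (fun s => R (s, 0)) s := fun s =>
    DifferentiableAt.comp (f := fun s : ℝ => (s, (0 : ℝ))) s (hRd (s, 0)) (hR1 s).differentiableAt
  have hd2 : ∀ s t, DifferentiableAt ℝ (fun t => R (s, t)) t := fun s t =>
    DifferentiableAt.comp (f := fun t : ℝ => (s, t)) t (hRd (s, t)) (hR2 s t).differentiableAt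
  set W : ℝ → V →L[ℝ] V := fun s => deriv (fun t => R (s, t)) 0 with hW
  have hWeq : ∀ s, W s = fderiv ℝ R (s, 0) (0, 1) := by
    intro s
    have h1 := ((hRd (s, 0)).hasFDerivAt.comp (0 : ℝ) (hR2 s 0)).hasDerivAt
    exact h1.deriv.trans (by simp)
  have hWd : DifferentiableAt ℝ W 0 := by
    have h1 : DifferentiableAt ℝ (fderiv ℝ R) ((0 : ℝ), (0 : ℝ)) :=
      (hRsm.fderiv_right (m := 1) (by norm_num; exact ENat.LEInfty.out)).differentiable
        (by simp) _
    have h2 : W = fun s => fderiv ℝ R (s, 0) (0, 1) := funext hWeq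
    rw [h2]
    exact (h1.comp (0 : ℝ) (hR1 0).differentiableAt).clm_apply (differentiableAt_const _)
  have hWv : ∀ s v, HasDerivAt (fun t => ρ (k (s, t)) v) (W s v) 0 := by
    intro s v
    have h1 := (hd2 s 0).hasDerivAt.clm_apply (hasDerivAt_const (0 : ℝ) v)
    rw [map_zero, add_zero] at h1
    exact h1
  have hX : ∀ s, ∃ X, S.dσ X = X ∧ ∀ v, W s v = D.act X (ρ (k (s, 0)) v) := by
    intro s
    obtain ⟨X, hX, hXv⟩ := S.exists_act_eq_deriv hρ (c := fun t => k (s, t)) (hd2 s 0)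
    exact ⟨X, hX, fun v => (hWv s v).unique (hXv v)⟩
  obtain ⟨X, hX0, hXv⟩ := S.exists_act_eq_deriv hρ (c := fun s => k (s, 0)) (hd1 0)
  obtain ⟨Y, hY0, hYv⟩ := hX 0
  refine ⟨X, Y, hX0, hY0, ?_, ?_, fun ξ hξ => ?_⟩
  · rw [(hXv p).deriv, hp]
  · rw [(hWv 0 p).deriv, hYv, hp]
  -- Pulling p back along the s-curve makes W(s)q(s) tangent to the orbit at the fixed point p for
  -- every s, hence orthogonal to ξ. Differentiating at s = 0 gives ⟨W'(0)p, ξ⟩ = -⟨W(0)q'(0), ξ⟩ =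
  -- ⟨YXp, ξ⟩, with no need for the generators of W(s) to depend smoothly on s.
  · set q : ℝ → V := fun s => (R (s, 0)).inverse p with hq
    have hqd : DifferentiableAt ℝ q 0 := by
      have h1 : DifferentiableAt ℝ (fun B : V →L[ℝ] V => B.inverse) (R ((0 : ℝ), (0 : ℝ))) :=
        (contDiffAt_map_inverse (𝕜 := ℝ) (n := 1)
          (ρ (k ((0 : ℝ), (0 : ℝ)))).toContinuousLinearEquiv).differentiableAt (by simp)
      exact (h1.comp (0 : ℝ) (hd1 0)).clm_apply (differentiableAt_const p)
    have hRq : ∀ s, ρ (k (s, 0)) (q s) = p := by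
      intro s
      have h1 : q s = (ρ (k (s, 0))).symm p := by
        simp only [hq, hR, ContinuousLinearMap.inverse_equiv]; rfl
      rw [h1, LinearIsometryEquiv.apply_symm_apply]
    have hq0 : q 0 = p := (ρ (k (0, 0))).injective ((hRq 0).trans hp.symm)
    have h1 : ∀ s, ⟪W s (q s), ξ⟫_ℝ = 0 := by
      intro s
      obtain ⟨Z, hZ, hZv⟩ := hX s
      rw [hZv, hRq]
      exact S.inner_act_eq_zero_of_mem_orbitNormalSpace hρ hZ hξ
    have h2 := (hWd.hasDerivAt.clm_apply hqd.hasDerivAt).inner ℝ (hasDerivAt_const (0 : ℝ) ξ)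
    have h3 := h2.unique ((hasDerivAt_const (0 : ℝ) (0 : ℝ)).congr_of_eventuallyEq
      (Filter.Eventually.of_forall h1))
    have h4 : deriv (fun s => R (s, 0)) 0 p + ρ (k (0, 0)) (deriv q 0) = 0 := by
      have h5 := (hd1 0).hasDerivAt.clm_apply hqd.hasDerivAt
      have h6 := h5.unique ((hasDerivAt_const (0 : ℝ) p).congr_of_eventuallyEq
        (Filter.Eventually.of_forall hRq))
      rw [hq0] at h6
      exact h6
    have h7 : deriv (fun s => R (s, 0)) 0 p = D.act X p := by
      have h8 := (hd1 0).hasDerivAt.clm_apply (hasDerivAt_const (0 : ℝ) p)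
      have h9 := h8.unique (hXv p)
      rw [hp] at h9
      simpa using h9
    have h10 : W 0 (deriv q 0) = -D.act Y (D.act X p) := by
      rw [hYv, eq_neg_of_add_eq_zero_right h4, h7, map_neg]
    have h11 : deriv (fun s : ℝ => deriv (fun t : ℝ => ρ (k (s, t)) p) 0) 0 = deriv W 0 p := by
      have h12 : (fun s : ℝ => deriv (fun t : ℝ => ρ (k (s, t)) p) 0) = fun s => W s p :=
        funext fun s => (hWv s p).deriv
      have h13 := hWd.hasDerivAt.clm_apply (hasDerivAt_const (0 : ℝ) p)
      rw [h12]
      simpa using h13.deriv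
    rw [hq0, h10, inner_zero_right, zero_add, inner_add_left, inner_neg_left] at h3
    rw [h11]
    linarith

/-- A normal vector at `p` is moved to the section through `p` by the stabilizer of `p`. -/
theorem exists_ρ_mem_section (hρ : S.IsIsotropyRepresentation ρ e) {Sec : Submodule ℝ V}
    (hS : (S.orthogonalSymmetric hρ).IsMaxAbelian Sec) {p : V} (hpS : p ∈ Sec) {ξ : V}
    (hξ : ξ ∈ orbitNormalSpace ρ p) : ∃ k : S.K, ρ k p = p ∧ ρ k ξ ∈ Sec := by
  have : FiniteDimensional ℝ (GroupLieAlgebra 𝓘(ℝ, E) G) := inferInstanceAs (FiniteDimensional ℝ E)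
  set D := S.orthogonalSymmetric hρ with hD
  obtain ⟨h, hh, hreg⟩ := hS.exists_regular
  have hcpt : IsCompact ((AdModel : G → E →L[ℝ] E) '' (S.K : Set G)) := S.isCompact_Ad_K
  have hcl : IsClosed {M : E →L[ℝ] E | S.projModel e (M (S.inclModel e p)) = p} :=
    isClosed_eq (by fun_prop) continuous_const
  have hval : ∀ (k : S.K) v, S.projModel e ((AdModel (k : G) : E →L[ℝ] E) (S.inclModel e v)) =
      ρ k v := fun k v => (congrArg (fun A : V →L[ℝ] V => A v) (S.ρ_eq hρ k)).symm
  -- Compactness is available for Ad(K) as a set of operators, so the maximum is taken over the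
  -- operators in Ad(K) that fix p.
  obtain ⟨M, ⟨⟨k, hk, rfl⟩, hMp⟩, hMmax⟩ := (hcpt.inter_right hcl).exists_isMaxOn
    (f := fun M => ⟪S.projModel e (M (S.inclModel e ξ)), h⟫_ℝ)
    ⟨AdModel 1, ⟨1, S.K.one_mem, rfl⟩, by
      change S.projModel e ((AdModel ((1 : S.K) : G) : E →L[ℝ] E) (S.inclModel e p)) = p
      rw [hval, map_one]; rfl⟩ (by fun_prop)
  have hkp : ρ ⟨k, hk⟩ p = p := (hval ⟨k, hk⟩ p).symm.trans hMp
  have hmax : ∀ k' : S.K, ρ k' p = p → ⟪ρ k' ξ, h⟫_ℝ ≤ ⟪ρ ⟨k, hk⟩ ξ, h⟫_ℝ := by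
    intro k' hk'
    have h1 := hMmax (a := AdModel (k' : G)) ⟨⟨k', k'.2, rfl⟩, (hval k' p).trans hk'⟩
    change ⟪S.projModel e ((AdModel (k' : G) : E →L[ℝ] E) (S.inclModel e ξ)), h⟫_ℝ ≤
      ⟪S.projModel e ((AdModel ((⟨k, hk⟩ : S.K) : G) : E →L[ℝ] E) (S.inclModel e ξ)), h⟫_ℝ at h1
    rwa [hval, hval] at h1
  refine ⟨⟨k, hk⟩, hkp, hreg _ ?_⟩
  have hpξ : ⁅D.e p, D.e ξ⁆ = 0 := D.lie_eq_zero_of_normal fun X hX =>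
    S.inner_act_eq_zero_of_mem_orbitNormalSpace hρ hX hξ
  have hpξ' : ⁅D.e p, D.e (ρ ⟨k, hk⟩ ξ)⁆ = 0 := by
    have h1 : ∀ w, D.e (ρ ⟨k, hk⟩ w) = Ad k (D.e w) := S.incl_ρ hρ ⟨k, hk⟩
    have h2 : D.e p = Ad k (D.e p) := by rw [← h1, hkp]
    rw [h2, h1, ← Ad_lie, hpξ, map_zero]
  rw [← lie_skew, neg_eq_zero]
  -- If Z kills p, its one-parameter group stays in the stabilizer, so the derivative at the maximum
  -- vanishes.
  refine D.lie_eq_zero_of_critical hpξ' (hS.lie_eq_zero p hpS h hh) fun Z hZ hZp => ?_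
  obtain ⟨c, -, hc0, hcd, hcp⟩ := S.exists_ρ_eq_exp hρ (X := Z) hZ
  have hder := (hcd (ρ ⟨k, hk⟩ ξ)).inner ℝ (hasDerivAt_const (0 : ℝ) h)
  rw [inner_zero_right, zero_add] at hder
  refine IsLocalMax.hasDerivAt_eq_zero (Filter.Eventually.of_forall fun t => ?_) hder
  have h1 := hmax (c t * ⟨k, hk⟩) (by
    rw [map_mul]; exact (congrArg (ρ (c t)) hkp).trans (hcp p hZp t))
  rw [map_mul] at h1
  rw [hc0]
  exact h1

/-- Pair the second derivative C with its own normal component w: then ‖w‖² = ⟨C, w⟩ ≤ 2‖w‖ for unit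
velocities. The inequality for general normal vectors follows from the one on the section by moving
ξ with k in the stabilizer of p and replacing X, Y by Ad(k)X, Ad(k)Y. -/
theorem norm_secondFundamentalForm_le (hρ : S.IsIsotropyRepresentation ρ e) {Sec : Submodule ℝ V}
    (hS : (S.orthogonalSymmetric hρ).IsMaxAbelian Sec) {α : StrongDual ℝ Sec}
    (hα : α ∈ (S.orthogonalSymmetric hρ).roots Sec) {p : Sec}
    (hp : p = (1 / ‖α‖) • OrthogonalSymmetric.dualVec α) :
    secondFundamentalFormNorm ρ (p : V) ≤ 2 := by
  have : FiniteDimensional ℝ (GroupLieAlgebra 𝓘(ℝ, E) G) := inferInstanceAs (FiniteDimensional ℝ E)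
  set D := S.orthogonalSymmetric hρ with hD
  have key : ∀ X Y : GroupLieAlgebra 𝓘(ℝ, E) G, S.dσ X = X → S.dσ Y = Y →
      ∀ ξ ∈ orbitNormalSpace ρ (p : V),
      ⟪D.act Y (D.act X p), ξ⟫_ℝ ≤ 2 * ‖D.act X p‖ * ‖D.act Y p‖ * ‖ξ‖ := by
    intro X Y hX hY ξ hξ
    obtain ⟨k, hkp, hkξ⟩ := S.exists_ρ_mem_section hρ hS p.2 hξ
    have h1 := hS.inner_act_act_le hα hp ⟨ρ k ξ, hkξ⟩ (Ad (k : G) X) (Ad (k : G) Y)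
    rw [← hkp, ← S.ρ_act hρ hX, ← S.ρ_act hρ hY, ← S.ρ_act hρ hY,
      LinearIsometryEquiv.norm_map, LinearIsometryEquiv.norm_map] at h1
    simp only [Submodule.coe_norm, LinearIsometryEquiv.norm_map,
      LinearIsometryEquiv.inner_map_map] at h1
    exact h1
  refine iSup_le fun u => iSup_le fun v => iSup_le fun w => iSup_le fun hu => iSup_le fun hv =>
    iSup_le fun hw => ?_
  obtain ⟨k, hk, hkp, hku, hkv, rfl⟩ := hw
  obtain ⟨X, Y, hX, hY, hXu, hYv, hξ⟩ := S.exists_act_of_surface hρ hk hkp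
  set C := deriv (fun s : ℝ => deriv (fun t : ℝ => ρ (k (s, t)) (p : V)) 0) 0
  set w := (orbitNormalSpace ρ (p : V)).starProjection C with hw
  have hwm : w ∈ orbitNormalSpace ρ (p : V) := Submodule.starProjection_apply_mem _ _
  have h1 : ‖w‖ ^ 2 = ⟪C, w⟫_ℝ := by
    rw [← real_inner_self_eq_norm_sq, ← sub_eq_zero, ← inner_sub_left, ← neg_sub, inner_neg_left,
      hw, Submodule.starProjection_inner_eq_zero _ _ hwm, neg_zero]
  have h2 := key X Y hX hY w hwm
  rw [← hξ w hwm, ← h1, ← hXu, ← hYv, ← hku, ← hkv, hu, hv] at h2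
  have h3 : ‖w‖ ≤ 2 := by
    by_contra! hlt
    nlinarith [norm_nonneg w]
  calc ENNReal.ofReal ‖w‖ ≤ ENNReal.ofReal 2 := ENNReal.ofReal_le_ofReal h3
    _ = 2 := by simp

/-- A vector commuting with Sec can be adjoined to it, so by maximality it already lies in Sec. -/
theorem IsMaximalAbelian.isMaxAbelian (hρ : S.IsIsotropyRepresentation ρ e) {Sec : Submodule ℝ V}
    (h : S.IsMaximalAbelian e Sec) : (S.orthogonalSymmetric hρ).IsMaxAbelian Sec := by
  set D := S.orthogonalSymmetric hρ with hD
  have h0 : ∀ v ∈ Sec, ∀ w ∈ Sec, ⁅D.e v, D.e w⁆ = 0 := h.prop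
  refine ⟨h0, fun v hv => ?_⟩
  have h1 : Sec ⊔ Submodule.span ℝ {v} ≤ Sec := by
    refine h.2 ?_ le_sup_left
    intro a ha b hb
    obtain ⟨a', ha', _, hr, rfl⟩ := Submodule.mem_sup.1 ha
    obtain ⟨b', hb', _, hs, rfl⟩ := Submodule.mem_sup.1 hb
    obtain ⟨r, rfl⟩ := Submodule.mem_span_singleton.1 hr
    obtain ⟨s, rfl⟩ := Submodule.mem_span_singleton.1 hs
    change ⁅D.e _, D.e _⁆ = 0
    have hv' : ⁅D.e v, D.e b'⁆ = 0 := by rw [← lie_skew, hv b' hb', neg_zero]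
    simp [h0 a' ha' b' hb', hv a' ha', hv']
  exact h1 (Submodule.mem_sup_right (Submodule.mem_span_singleton_self v))

theorem restrictedRoots_eq (hρ : S.IsIsotropyRepresentation ρ e) (Sec : Submodule ℝ V) :
    S.restrictedRoots e Sec = (S.orthogonalSymmetric hρ).roots Sec := by
  set D := S.orthogonalSymmetric hρ with hD
  ext α
  refine and_congr_right fun _ => exists_congr fun ε => ?_
  have h1 : ∀ x (h : Sec), ⁅(e (h : V) : GroupLieAlgebra 𝓘(ℝ, E) G), S.bracket e h x⁆ =
      (ε * α h ^ 2) • (e x : GroupLieAlgebra 𝓘(ℝ, E) G) ↔ D.T h h x = (ε * α h ^ 2) • x := by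
    intro x h
    rw [← D.e_injective.eq_iff, D.e_T, map_smul]
    rfl
  simp only [h1, OrthogonalSymmetric.IsWeightVector, exists_and_left]

theorem nontrivial_of_rank (hrank : 1 < S.rank) (e : V ≃ₗ[ℝ] S.𝔭) : Nontrivial V := by
  by_contra hV
  rw [not_nontrivial_iff_subsingleton] at hV
  have hp : Subsingleton S.𝔭 := e.symm.toEquiv.subsingleton
  have h1 : S.rank ≤ 0 := by
    refine csSup_le ⟨0, ⊥, bot_le, by simp, by simp⟩ ?_
    rintro n ⟨𝔞, h𝔞, -, rfl⟩
    have h2 : 𝔞 = ⊥ := by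
      rw [eq_bot_iff]
      intro x hx
      have h3 : (⟨x, h𝔞 hx⟩ : S.𝔭) = 0 := Subsingleton.elim _ _
      exact congrArg Subtype.val h3
    rw [h2, finrank_bot]
  omega

theorem exists_isMaximalAbelian (e : V ≃ₗ[ℝ] S.𝔭) : ∃ Sec, S.IsMaximalAbelian e Sec := by
  obtain ⟨Sec, -, h⟩ := exists_maximal_ge_of_wellFoundedGT
    (fun A : Submodule ℝ V => ∀ v ∈ A, ∀ w ∈ A, S.bracket e v w = 0) ⊥ (by simp [bracket])
  exact ⟨Sec, h⟩

end RiemannianSymmetricPair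

/-- A nonempty finite set has a highest element with respect to every vector ordering. -/
theorem VectorOrdering.exists_isHighest {W : Type*} [AddCommGroup W] [Module ℝ W]
    (O : VectorOrdering W) {Δ : Set W} (hf : Δ.Finite) (hne : Δ.Nonempty) :
    ∃ a, O.IsHighest Δ a := by
  induction Δ, hf using Set.Finite.induction_on with
  | empty => exact absurd hne Set.not_nonempty_empty
  | @insert a s ha _ ih =>
    rcases s.eq_empty_or_nonempty with rfl | hs
    · exact ⟨a, by simp, fun b hb hba => absurd (by simpa using hb) hba⟩
    · obtain ⟨m, hm, hmax⟩ := ih hs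
      have ham : a ≠ m := fun h => ha (h ▸ hm)
      rcases O.total (a - m) (sub_ne_zero.2 ham) with h | h
      · refine ⟨a, Set.mem_insert a s, fun b hb hba => ?_⟩
        have hbs : b ∈ s := hb.resolve_left hba
        rcases eq_or_ne b m with rfl | hbm
        · exact h
        · have h1 := O.add_pos _ _ h (hmax b hbs hbm)
          rwa [sub_add_sub_cancel] at h1
      · refine ⟨m, Set.mem_insert_of_mem a hm, fun b hb hbm => ?_⟩
        rcases hb with rfl | hb
        · rwa [neg_sub] at h
        · exact hmax b hb hbm

theorem smul_corootVector {V : Type*} [NormedAddCommGroup V] [InnerProductSpace ℝ V]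
    [FiniteDimensional ℝ V] {Sec : Submodule ℝ V} {α : StrongDual ℝ Sec} (hα : α ≠ 0) :
    (‖α‖ / 2) • corootVector Sec α = (1 / ‖α‖) • OrthogonalSymmetric.dualVec α := by
  have h := OrthogonalSymmetric.norm_pos_of_ne_zero hα
  rw [corootVector, smul_smul, OrthogonalSymmetric.dualVec]
  congr 1
  field_simp

end SymmetricSpaceOrbit
-- The main theorem
open SymmetricSpaceOrbit in
theorem mainTheorem6
    {E : Type*} [NormedAddCommGroup E] [NormedSpace ℝ E] [FiniteDimensional ℝ E]
    {G : Type*} [TopologicalSpace G] [T2Space G] [ChartedSpace E G] [Group G]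
    [LieGroup 𝓘(ℝ, E) ∞ G]
    [LieAlgebra.IsKilling ℝ (GroupLieAlgebra 𝓘(ℝ, E) G)]
    (S : RiemannianSymmetricPair E G) (hrank : 1 < S.rank)
    {V : Type*} [NormedAddCommGroup V] [InnerProductSpace ℝ V] [FiniteDimensional ℝ V]
    (ρ : S.K →* (V ≃ₗᵢ[ℝ] V)) (e : V ≃ₗ[ℝ] S.𝔭) (hρ : S.IsIsotropyRepresentation ρ e) :
    (∃ p : V, ‖p‖ = 1 ∧ secondFundamentalFormNorm ρ p ≤ 2) ∧
    ∀ Sec : Submodule ℝ V, S.IsMaximalAbelian e Sec →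
      (∀ O : VectorOrdering (StrongDual ℝ Sec), ∃ α : StrongDual ℝ Sec,
        O.IsHighest (S.restrictedRoots e Sec) α) ∧
      ∀ α ∈ S.restrictedRoots e Sec,
        ‖(((‖α‖ / 2) • corootVector Sec α : Sec) : V)‖ = 1 ∧
        secondFundamentalFormNorm ρ (((‖α‖ / 2) • corootVector Sec α : Sec) : V) ≤ 2 := by
  have : FiniteDimensional ℝ (GroupLieAlgebra 𝓘(ℝ, E) G) := inferInstanceAs (FiniteDimensional ℝ E)
  have : Nontrivial V := S.nontrivial_of_rank hrank e
  have hroot : ∀ Sec : Submodule ℝ V, S.IsMaximalAbelian e Sec →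
      ∀ α ∈ S.restrictedRoots e Sec,
        ‖(((‖α‖ / 2) • corootVector Sec α : Sec) : V)‖ = 1 ∧
        secondFundamentalFormNorm ρ (((‖α‖ / 2) • corootVector Sec α : Sec) : V) ≤ 2 := by
    intro Sec hSec α hα
    have hS := RiemannianSymmetricPair.IsMaximalAbelian.isMaxAbelian S hρ hSec
    rw [S.restrictedRoots_eq hρ] at hα
    have hp := smul_corootVector hα.1
    refine ⟨?_, S.norm_secondFundamentalForm_le hρ hS hα hp⟩
    have h := OrthogonalSymmetric.norm_pos_of_ne_zero hα.1
    rw [hp, Submodule.norm_coe, norm_smul, OrthogonalSymmetric.norm_dualVec,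
      Real.norm_of_nonneg (one_div_nonneg.2 h.le), one_div_mul_cancel h.ne']
  have hne : ∀ Sec : Submodule ℝ V, S.IsMaximalAbelian e Sec →
      (S.restrictedRoots e Sec).Nonempty := by
    intro Sec hSec
    rw [S.restrictedRoots_eq hρ]
    exact (RiemannianSymmetricPair.IsMaximalAbelian.isMaxAbelian S hρ hSec).roots_nonempty
  refine ⟨?_, fun Sec hSec => ⟨fun O => ?_, hroot Sec hSec⟩⟩
  · obtain ⟨Sec, hSec⟩ := S.exists_isMaximalAbelian e
    obtain ⟨α, hα⟩ := hne Sec hSec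
    exact ⟨_, hroot Sec hSec α hα⟩
  · refine O.exists_isHighest ?_ (hne Sec hSec)
    rw [S.restrictedRoots_eq hρ]
    exact (S.orthogonalSymmetric hρ).finite_roots Sec
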